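/- Let $\mathcal X,\mathcal Y_0,\mathcal Y_1,\mathcal Y_2$ be finite sets and let $(X,Y_0,Y_1,Y_2)$ have a joint pmf $P$ on $\mathcal X\times\mathcal Y_0\times\mathcal Y_1\times\mathcal Y_2$ such that $Y_1 - (X,Y_0) - Y_2$ is a Markov chain. Logarithms are natural. Operational region. Let $(X_i,Y_{0,i},Y_{1,i},Y_{2,i})_{i\ge 1}$ be i.i.d. copies of $(X,Y_0,Y_1,Y_2)$. A code of block length $n\ge 1$ consists of encoders $\phi_k:\mathcal Y_k^n\to\{1,\dots,M_k\}$, $k=1,2$, and a decoder $\psi$ which maps $(\phi_1(Y_1^n),\phi_2(Y_2^n),Y_0^n)$ to an $n$-tuple $(\hat X_1,\dots,\hat X_n)$ of pmfs on $\mathcal X$. A tuple $(R_1,R_2,D)$ with $D\ge 0$ is achievable if for some $n\ge 1$ there is a code of block length $n$ with $R_k\ge\frac1n\log M_k$ for $k=1,2$ and $$D\ \ge\ \mathbb E\Big[\frac1n\sum_{i=1}^n\log\frac1{\hat X_i(X_i)}\Big]$$ (where $\log\frac10=+\infty$). The rate-distortion region $\mathcal{RD}^\star_{\mathrm{CEO}}\subset\mathbb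 R^3$ of the two-encoder discrete memoryless CEO problem with decoder side information under logarithmic loss is the closure of the set of achievable tuples. Single-letter regions. For $k\in\{1,2\}$ let $\bar k$ be the other element of $\{1,2\}$, and let $$D^k_{\mathrm{CEO}}(R_1,R_2):=\inf\ H(X\mid U_1,U_2,Y_0)\quad\text{subject to}\quad R_k\ge I(Y_k;U_k\mid U_{\bar k},Y_0),\quad R_{\bar k}\ge I(Y_{\bar k};U_{\bar k}\mid Y_0),$$ where the infimum is over all pairs of auxiliary random variables $U_1,U_2$ with finite alphabets such that $U_1 - Y_1 - (X,Y_0) - Y_2 - U_2$ is a Markov chain, and is $+\infty$ if no pair satisfies the constraints. Let $$\mathcal{RD}^k_{\mathrm{CEO}}:=\{(R_1,R_2,D)\in\mathbb R^3: D\ge D^k_{\mathrm{CEO}}(R_1,R_2)\}.$$ Then $$\mathcal{RD}^\star_{\mathrm{CEO}}=\mathrm{conv}\big(\mathcal{RD}^1_{\mathrm{CEO}}\cup\mathcal{RD}^2_{\mathrm{CEO}}\big).$$ -/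

import Mathlib

open scoped ENNReal

noncomputable section

namespace CEO

/-! Information measures of random variables on a finite sample space `Ω` with weights `p`.
All logarithms are natural. -/

open Classical in
/-- The probability mass function of the random variable `f` when `Ω` carries the weights `p`. -/
def law {Ω α : Type*} [Fintype Ω] (p : Ω → ℝ) (f : Ω → α) (a : α) : ℝ :=
  ∑ ω : Ω, if f ω = a then p ω else 0

/-- Conditional entropy `H(f | g) = - ∑ P(a, b) log P(a | b)`; terms with `P(a, b) = 0` vanish. -/
def condEntropy {Ω α β : Type*} [Fintype Ω] [Fintype α] [Fintype β]
    (p : Ω → ℝ) (f : Ω → α) (g : Ω → β) : ℝ :=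
  -∑ a : α, ∑ b : β,
    law p (fun ω => (f ω, g ω)) (a, b) *
      Real.log (law p (fun ω => (f ω, g ω)) (a, b) / law p g b)

/-- Conditional mutual information `I(f ; g | h) = H(f | h) - H(f | g, h)`. -/
def condMutualInfo {Ω α β γ : Type*} [Fintype Ω] [Fintype α] [Fintype β] [Fintype γ]
    (p : Ω → ℝ) (f : Ω → α) (g : Ω → β) (h : Ω → γ) : ℝ :=
  condEntropy p f h - condEntropy p f (fun ω => (g ω, h ω))

section Source

variable {𝒳 𝒴₀ 𝒴₁ 𝒴₂ : Type*} [Fintype 𝒳] [Fintype 𝒴₀] [Fintype 𝒴₁] [Fintype 𝒴₂]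

/-- The Markov chain `Y₁ - (X, Y₀) - Y₂` for the joint pmf `P` of `(X, Y₀, Y₁, Y₂)`:
`P(x, y₀, y₁, y₂) P(x, y₀) = P(x, y₀, y₁) P(x, y₀, y₂)`. -/
def IsMarkov (P : 𝒳 × 𝒴₀ × 𝒴₁ × 𝒴₂ → ℝ) : Prop :=
  ∀ x y₀ y₁ y₂,
    P (x, y₀, y₁, y₂) * (∑ b₁ : 𝒴₁, ∑ b₂ : 𝒴₂, P (x, y₀, b₁, b₂)) =
      (∑ b₂ : 𝒴₂, P (x, y₀, y₁, b₂)) * (∑ b₁ : 𝒴₁, P (x, y₀, b₁, y₂))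

/-! ### The operational rate-distortion region -/

/-- Letter-wise logarithmic loss `log (1 / q(x)) ∈ [0, ∞]` of the soft estimate `q` (a pmf on the
source alphabet) when the source letter is `x`. -/
def logLoss {𝒳 : Type*} (q : 𝒳 → ℝ) (x : 𝒳) : ℝ≥0∞ :=
  if q x = 0 then ∞ else ENNReal.ofReal (Real.log (1 / q x))

/-- Expected average logarithmic loss of the block-length-`n` code `(φ₁, φ₂, ψ)` when
`(X, Y₀, Y₁, Y₂)ⁿ` is i.i.d. with law `P`. The decoder outputs one soft estimate per letter. -/
def expectedLoss (P : 𝒳 × 𝒴₀ × 𝒴₁ × 𝒴₂ → ℝ) {n M₁ M₂ : ℕ}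
    (φ₁ : (Fin n → 𝒴₁) → Fin M₁) (φ₂ : (Fin n → 𝒴₂) → Fin M₂)
    (ψ : Fin M₁ → Fin M₂ → (Fin n → 𝒴₀) → Fin n → 𝒳 → ℝ) : ℝ≥0∞ :=
  ∑ s : Fin n → 𝒳 × 𝒴₀ × 𝒴₁ × 𝒴₂,
    ENNReal.ofReal (∏ i, P (s i)) *
      ((∑ i, logLoss
          (ψ (φ₁ fun j => (s j).2.2.1) (φ₂ fun j => (s j).2.2.2) (fun j => (s j).2.1) i)
          (s i).1) / (n : ℝ≥0∞))

/-- `(R₁, R₂, D)` is achieved by some code of some block length `n ≥ 1`. -/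
def IsAchievable (P : 𝒳 × 𝒴₀ × 𝒴₁ × 𝒴₂ → ℝ) (R₁ R₂ D : ℝ) : Prop :=
  ∃ (n M₁ M₂ : ℕ) (φ₁ : (Fin n → 𝒴₁) → Fin M₁) (φ₂ : (Fin n → 𝒴₂) → Fin M₂)
    (ψ : Fin M₁ → Fin M₂ → (Fin n → 𝒴₀) → Fin n → 𝒳 → ℝ),
    0 < n ∧
    (∀ m₁ m₂ y i, ψ m₁ m₂ y i ∈ stdSimplex ℝ 𝒳) ∧
    Real.log M₁ / n ≤ R₁ ∧ Real.log M₂ / n ≤ R₂ ∧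
    0 ≤ D ∧ expectedLoss P φ₁ φ₂ ψ ≤ ENNReal.ofReal D

/-- The rate-distortion region of the two-encoder discrete memoryless CEO problem with decoder side
information under logarithmic loss: the closure of the set of achievable tuples. -/
def rdRegion (P : 𝒳 × 𝒴₀ × 𝒴₁ × 𝒴₂ → ℝ) : Set (ℝ × ℝ × ℝ) :=
  closure {t | IsAchievable P t.1 t.2.1 t.2.2}

/-! ### The two single-letter regions -/

/-- `W` is a conditional pmf `P_{U|Y}`, where `U` takes values in `Fin m`. -/
def IsChannel {𝒴 : Type*} {m : ℕ} (W : 𝒴 → Fin m → ℝ) : Prop :=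
  ∀ y, W y ∈ stdSimplex ℝ (Fin m)

/-- The joint pmf of `(X, Y₀, Y₁, Y₂, U₁, U₂)` with `U₁ - Y₁ - (X, Y₀) - Y₂ - U₂`. -/
def auxJoint (P : 𝒳 × 𝒴₀ × 𝒴₁ × 𝒴₂ → ℝ) {m₁ m₂ : ℕ}
    (W₁ : 𝒴₁ → Fin m₁ → ℝ) (W₂ : 𝒴₂ → Fin m₂ → ℝ) :
    𝒳 × 𝒴₀ × 𝒴₁ × 𝒴₂ × Fin m₁ × Fin m₂ → ℝ :=
  fun (x, y₀, y₁, y₂, u₁, u₂) => P (x, y₀, y₁, y₂) * W₁ y₁ u₁ * W₂ y₂ u₂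

/-- `H(X | U₁, U₂, Y₀)`. -/
def distortion (P : 𝒳 × 𝒴₀ × 𝒴₁ × 𝒴₂ → ℝ) {m₁ m₂ : ℕ}
    (W₁ : 𝒴₁ → Fin m₁ → ℝ) (W₂ : 𝒴₂ → Fin m₂ → ℝ) : ℝ :=
  condEntropy (auxJoint P W₁ W₂) (fun (x, _, _, _, _, _) => x)
    (fun (_, y₀, _, _, u₁, u₂) => (u₁, u₂, y₀))

/-- The distortion-rate function of the order in which `U₂` is decoded first: the infimum of
`H(X | U₁, U₂, Y₀)` subject to `R₁ ≥ I(Y₁; U₁ | U₂, Y₀)` and `R₂ ≥ I(Y₂; U₂ | Y₀)`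
(equal to `+∞` if no choice of auxiliaries is feasible). -/
def distortionRate₁ (P : 𝒳 × 𝒴₀ × 𝒴₁ × 𝒴₂ → ℝ) (R₁ R₂ : ℝ) : EReal :=
  sInf {d : EReal | ∃ (m₁ m₂ : ℕ) (W₁ : 𝒴₁ → Fin m₁ → ℝ) (W₂ : 𝒴₂ → Fin m₂ → ℝ),
    IsChannel W₁ ∧ IsChannel W₂ ∧
    condMutualInfo (auxJoint P W₁ W₂) (fun (_, _, y₁, _, _, _) => y₁)
      (fun (_, _, _, _, u₁, _) => u₁) (fun (_, y₀, _, _, _, u₂) => (u₂, y₀)) ≤ R₁ ∧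
    condMutualInfo (auxJoint P W₁ W₂) (fun (_, _, _, y₂, _, _) => y₂)
      (fun (_, _, _, _, _, u₂) => u₂) (fun (_, y₀, _, _, _, _) => y₀) ≤ R₂ ∧
    d = ((distortion P W₁ W₂ : ℝ) : EReal)}

/-- The distortion-rate function of the order in which `U₁` is decoded first: the infimum of
`H(X | U₁, U₂, Y₀)` subject to `R₂ ≥ I(Y₂; U₂ | U₁, Y₀)` and `R₁ ≥ I(Y₁; U₁ | Y₀)`
(equal to `+∞` if no choice of auxiliaries is feasible). -/
def distortionRate₂ (P : 𝒳 × 𝒴₀ × 𝒴₁ × 𝒴₂ → ℝ) (R₁ R₂ : ℝ) : EReal :=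
  sInf {d : EReal | ∃ (m₁ m₂ : ℕ) (W₁ : 𝒴₁ → Fin m₁ → ℝ) (W₂ : 𝒴₂ → Fin m₂ → ℝ),
    IsChannel W₁ ∧ IsChannel W₂ ∧
    condMutualInfo (auxJoint P W₁ W₂) (fun (_, _, _, y₂, _, _) => y₂)
      (fun (_, _, _, _, _, u₂) => u₂) (fun (_, y₀, _, _, u₁, _) => (u₁, y₀)) ≤ R₂ ∧
    condMutualInfo (auxJoint P W₁ W₂) (fun (_, _, y₁, _, _, _) => y₁)
      (fun (_, _, _, _, u₁, _) => u₁) (fun (_, y₀, _, _, _, _) => y₀) ≤ R₁ ∧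
    d = ((distortion P W₁ W₂ : ℝ) : EReal)}

/-- `{(R₁, R₂, D) : D ≥ D¹(R₁, R₂)}`. -/
def rdRegion₁ (P : 𝒳 × 𝒴₀ × 𝒴₁ × 𝒴₂ → ℝ) : Set (ℝ × ℝ × ℝ) :=
  {t | distortionRate₁ P t.1 t.2.1 ≤ (t.2.2 : EReal)}

/-- `{(R₁, R₂, D) : D ≥ D²(R₁, R₂)}`. -/
def rdRegion₂ (P : 𝒳 × 𝒴₀ × 𝒴₁ × 𝒴₂ → ℝ) : Set (ℝ × ℝ × ℝ) :=
  {t | distortionRate₂ P t.1 t.2.1 ≤ (t.2.2 : EReal)}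

end Source

end CEO

end

/-! Both inclusions are controlled by a few numbers attached to auxiliaries `U₁, U₂`: the noise
descriptions `a_k = I(Y_k; U_k | X, Y₀)` and the equivocations `h₀ = H(X | Y₀)`, `h_k = H(X | U_k,
Y₀)`, `h₁₂ = H(X | U₁, U₂, Y₀)`.

Converse. By Gibbs' inequality (`cent_le_cross`) the logarithmic loss of a code is at least the
equivocation left by its messages, so distortion becomes entropy. The chain rule then gives `a_k ≤
R_k`, `a₁ + h₂ - D ≤ R₁`, `a₂ + h₁ - D ≤ R₂`, `a₁ + a₂ + h₀ - D ≤ R₁ + R₂` and `h₁₂ ≤ D`, with every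
number averaged over a position `i` and over the value `q` of `(X, Y₀)` at the other positions.
Given `q`, the Markov hypothesis turns the two messages into outputs of two separate channels fed by
`Y₁` and `Y₂` at position `i` (`law_letter_messages`), so each pair `(i, q)` supplies admissible
auxiliaries. The polyhedron cut out by these inequalities lies in every convex upper set that
contains the single-letter corner points (`mem_of_outer_bound`), and those points lie in the two
regions (`cost_le_corner`). Time sharing is absorbed by the convex hull.

Closedness. The operational region is a closure, so the convex hull must be shown closed.
Carathéodory's theorem bounds the auxiliary alphabets, each region becomes a compact set plus the
positive orthant (`rdRegion₁_eq`), and so does the hull of their union.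

Achievability. Each auxiliary sequence is hashed to a pair of indices. The first is nearly uniform
whatever the observation, so it can play the role of common randomness and later be frozen; the
second is transmitted. The pair identifies the sequence given what the decoder already knows
(`exists_one_shot_code`). Chebyshev's inequality supplies typicality, and smoothing the estimate
keeps the loss bounded when decoding fails. Exchanging the encoders gives the other decoding order,
and concatenating codes makes the operational region convex (`convex_rdRegion`). -/

open scoped ENNReal

noncomputable section

namespace CEO

set_option linter.unusedSectionVars false

/-! ### Entropy on a weighted finite sample space -/

section Entropy

variable {Ω α β γ δ : Type*} [Fintype Ω]

open Classical in
theorem law_congr (p : Ω → ℝ) {f : Ω → α} {g : Ω → β} {a : α} {b : β}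
    (h : ∀ ω, f ω = a ↔ g ω = b) : law p f a = law p g b := by
  simp only [law, h]

theorem law_nonneg {p : Ω → ℝ} (hp : ∀ ω, 0 ≤ p ω) (f : Ω → α) (a : α) : 0 ≤ law p f a := by
  refine Finset.sum_nonneg fun ω _ => ?_
  split_ifs
  exacts [hp ω, le_rfl]

theorem le_law {p : Ω → ℝ} (hp : ∀ ω, 0 ≤ p ω) (f : Ω → α) (ω : Ω) : p ω ≤ law p f (f ω) := by
  classical
  have := Finset.single_le_sum (f := fun ω' => if f ω' = f ω then p ω' else 0)
    (fun ω' _ => by split_ifs; exacts [hp ω', le_rfl]) (Finset.mem_univ ω)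
  simpa [law] using this

theorem sum_law_mul [Fintype α] (p : Ω → ℝ) (f : Ω → α) (φ : α → ℝ) :
    ∑ a, law p f a * φ a = ∑ ω, p ω * φ (f ω) := by
  classical
  simp only [law, Finset.sum_mul]
  rw [Finset.sum_comm]
  refine Finset.sum_congr rfl fun ω _ => ?_
  rw [Finset.sum_eq_single (f ω)]
  · simp
  · intro b _ hb
    simp [Ne.symm hb]
  · simp

theorem sum_law [Fintype α] (p : Ω → ℝ) (f : Ω → α) : ∑ a, law p f a = ∑ ω, p ω := by
  simpa using sum_law_mul p f (fun _ => 1)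

theorem law_law [Fintype α] (p : Ω → ℝ) (F : Ω → α) (e : α → β) (b : β) :
    law (law p F) e b = law p (fun ω => e (F ω)) b := by
  classical
  have := sum_law_mul p F (fun a => if e a = b then 1 else 0)
  simpa [law] using this

theorem sum_law_pair [Fintype α] (p : Ω → ℝ) (f : Ω → α) (g : Ω → β) (b : β) :
    ∑ a, law p (fun ω => (f ω, g ω)) (a, b) = law p g b := by
  classical
  simp only [law]
  rw [Finset.sum_comm]
  refine Finset.sum_congr rfl fun ω _ => ?_
  rw [Finset.sum_eq_single (f ω)]
  · simp
  · intro c _ hc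
    simp [Ne.symm hc]
  · simp

theorem law_pair_le [Fintype α] {p : Ω → ℝ} (hp : ∀ ω, 0 ≤ p ω) (f : Ω → α) (g : Ω → β)
    (a : α) (b : β) : law p (fun ω => (f ω, g ω)) (a, b) ≤ law p g b := by
  rw [← sum_law_pair p f g b]
  exact Finset.single_le_sum (f := fun a => law p (fun ω => (f ω, g ω)) (a, b))
    (fun a _ => law_nonneg hp _ _) (Finset.mem_univ a)

/-- Entropy of a random variable, written as an average over the sample space. It depends only on
the partition of the sample space that the random variable generates. -/
def ent (p : Ω → ℝ) (f : Ω → α) : ℝ := -∑ ω, p ω * Real.log (law p f (f ω))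

/-- Conditional entropy as a difference of entropies. -/
def cent (p : Ω → ℝ) (f : Ω → α) (g : Ω → β) : ℝ := ent p (fun ω => (f ω, g ω)) - ent p g

theorem ent_congr (p : Ω → ℝ) {f : Ω → α} {g : Ω → β}
    (h : ∀ ω ω', f ω = f ω' ↔ g ω = g ω') : ent p f = ent p g := by
  unfold ent
  congr 1
  refine Finset.sum_congr rfl fun ω _ => ?_
  rw [law_congr p (f := f) (g := g) (a := f ω) (b := g ω) fun ω' => h ω' ω]

theorem cent_congr (p : Ω → ℝ) {f : Ω → α} {g : Ω → β} {f' : Ω → γ} {g' : Ω → δ}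
    (h : ∀ ω ω', (f ω = f ω' ∧ g ω = g ω') ↔ (f' ω = f' ω' ∧ g' ω = g' ω'))
    (hg : ∀ ω ω', g ω = g ω' ↔ g' ω = g' ω') : cent p f g = cent p f' g' := by
  unfold cent
  rw [ent_congr p (f := fun ω => (f ω, g ω)) (g := fun ω => (f' ω, g' ω)), ent_congr p hg]
  simpa using h

theorem condEntropy_eq_sum [Fintype α] [Fintype β] (p : Ω → ℝ) (f : Ω → α) (g : Ω → β) :
    condEntropy p f g = -∑ ω, p ω *
      Real.log (law p (fun ω => (f ω, g ω)) (f ω, g ω) / law p g (g ω)) := by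
  unfold condEntropy
  rw [← sum_law_mul p (fun ω => (f ω, g ω))
    (fun x => Real.log (law p (fun ω => (f ω, g ω)) x / law p g x.2)), Fintype.sum_prod_type]

theorem condEntropy_eq_cent [Fintype α] [Fintype β] {p : Ω → ℝ} (hp : ∀ ω, 0 ≤ p ω)
    (f : Ω → α) (g : Ω → β) : condEntropy p f g = cent p f g := by
  rw [condEntropy_eq_sum, cent, ent, ent, ← neg_add', neg_inj, ← Finset.sum_neg_distrib,
    ← Finset.sum_add_distrib]
  refine Finset.sum_congr rfl fun ω _ => ?_
  rcases (hp ω).eq_or_lt with h | h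
  · simp [← h]
  · rw [Real.log_div (h.trans_le (le_law hp (fun ω => (f ω, g ω)) ω)).ne'
      (h.trans_le (le_law hp g ω)).ne']
    ring

/-- Gibbs' inequality: the conditional entropy is at most the average logarithmic loss of any
soft estimate. -/
theorem cent_le_cross [Fintype α] [Fintype β] {p : Ω → ℝ} (hp : ∀ ω, 0 ≤ p ω) (f : Ω → α)
    (g : Ω → β) (q : β → α → ℝ) (hq : ∀ b a, 0 ≤ q b a) (hq1 : ∀ b, ∑ a, q b a ≤ 1)
    (hpos : ∀ ω, 0 < p ω → 0 < q (g ω) (f ω)) :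
    cent p f g ≤ -∑ ω, p ω * Real.log (q (g ω) (f ω)) := by
  rw [← condEntropy_eq_cent hp, condEntropy_eq_sum, neg_le_neg_iff, ← sub_nonneg,
    ← Finset.sum_sub_distrib]
  set l := law p (fun ω => (f ω, g ω)) with hl
  -- This is `1 - 1/x ≤ log x` with `x` the ratio of the true conditional probability to `q`. The
  -- average of `1/x` is at most one because `q b` has total mass at most one.
  have key : ∀ ω, p ω - p ω * (q (g ω) (f ω) * law p g (g ω) / l (f ω, g ω)) ≤
      p ω * Real.log (l (f ω, g ω) / law p g (g ω)) - p ω * Real.log (q (g ω) (f ω)) := by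
    intro ω
    rcases (hp ω).eq_or_lt with h | h
    · simp [← h]
    have h1 : 0 < l (f ω, g ω) := h.trans_le (le_law hp (fun ω => (f ω, g ω)) ω)
    have h2 : 0 < law p g (g ω) := h.trans_le (le_law hp g ω)
    have h3 := hpos ω h
    rw [← mul_sub, ← Real.log_div (by positivity) (by positivity)]
    have := Real.one_sub_inv_le_log_of_pos (x := l (f ω, g ω) / law p g (g ω) / q (g ω) (f ω))
      (by positivity)
    have e : (l (f ω, g ω) / law p g (g ω) / q (g ω) (f ω))⁻¹ =
      q (g ω) (f ω) * law p g (g ω) / l (f ω, g ω) := by field_simp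
    rw [e] at this
    calc _ = p ω * (1 - q (g ω) (f ω) * law p g (g ω) / l (f ω, g ω)) := by ring
      _ ≤ _ := by gcongr
  refine le_trans ?_ (Finset.sum_le_sum fun ω _ => key ω)
  rw [Finset.sum_sub_distrib, sub_nonneg,
    ← sum_law_mul p (fun ω => (f ω, g ω)) (fun x => q x.2 x.1 * law p g x.2 / l x),
    ← sum_law p g]
  rw [Fintype.sum_prod_type_right]
  refine Finset.sum_le_sum fun b _ => ?_
  calc ∑ a, l (a, b) * (q b a * law p g b / l (a, b)) ≤ ∑ a, q b a * law p g b := by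
        refine Finset.sum_le_sum fun a _ => ?_
        rcases eq_or_ne (l (a, b)) 0 with h | h
        · rw [h, zero_mul]
          exact mul_nonneg (hq _ _) (law_nonneg hp _ _)
        · rw [mul_div_cancel₀ _ h]
    _ = (∑ a, q b a) * law p g b := by rw [Finset.sum_mul]
    _ ≤ 1 * law p g b := by
        gcongr
        exacts [law_nonneg hp _ _, hq1 b]
    _ = _ := one_mul _

theorem cent_nonneg [Fintype α] {p : Ω → ℝ} (hp : ∀ ω, 0 ≤ p ω) (f : Ω → α)
    (g : Ω → β) : 0 ≤ cent p f g := by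
  unfold cent ent
  rw [← neg_add', neg_nonneg, ← Finset.sum_neg_distrib, ← Finset.sum_add_distrib]
  refine Finset.sum_nonpos fun ω _ => ?_
  rcases (hp ω).eq_or_lt with h | h
  · simp [← h]
  have h1 : 0 < law p (fun ω => (f ω, g ω)) (f ω, g ω) := h.trans_le (le_law hp _ ω)
  have := Real.log_le_log h1 (law_pair_le hp f g (f ω) (g ω))
  nlinarith

/-- Conditioning reduces entropy. -/
theorem cent_pair_le [Fintype α] [Fintype β] [Fintype γ] {p : Ω → ℝ} (hp : ∀ ω, 0 ≤ p ω)
    (f : Ω → α) (g : Ω → β) (h : Ω → γ) :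
    cent p f (fun ω => (g ω, h ω)) ≤ cent p f h := by
  -- Gibbs' inequality for the estimate that ignores `g` and uses the conditional law of `f` given
  -- `h` alone.
  refine (cent_le_cross hp f (fun ω => (g ω, h ω))
    (fun b a => law p (fun ω => (f ω, h ω)) (a, b.2) / law p h b.2) ?_ ?_ ?_).trans ?_
  · exact fun b a => div_nonneg (law_nonneg hp _ _) (law_nonneg hp _ _)
  · intro b
    rw [← Finset.sum_div, sum_law_pair]
    exact div_self_le_one _
  · intro ω hω
    exact div_pos (hω.trans_le (le_law hp (fun ω => (f ω, h ω)) ω)) (hω.trans_le (le_law hp h ω))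
  · rw [← condEntropy_eq_cent hp, condEntropy_eq_sum]

/-- Conditioning on a finer random variable reduces entropy. -/
theorem cent_le_of_determines [Fintype α] [Fintype β] [Fintype γ] {p : Ω → ℝ}
    (hp : ∀ ω, 0 ≤ p ω) (f : Ω → α) (g : Ω → β) (h : Ω → γ)
    (hgh : ∀ ω ω', g ω = g ω' → h ω = h ω') : cent p f g ≤ cent p f h := by
  refine le_trans (le_of_eq ?_) (cent_pair_le hp f g h)
  refine cent_congr p ?_ ?_
  · intro ω ω'
    simp only [Prod.mk.injEq]
    have := hgh ω ω'
    tauto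
  · intro ω ω'
    simp only [Prod.mk.injEq]
    have := hgh ω ω'
    tauto

theorem cent_eq_zero_of_determines (p : Ω → ℝ) (f : Ω → α) (g : Ω → β)
    (hgf : ∀ ω ω', g ω = g ω' → f ω = f ω') : cent p f g = 0 := by
  unfold cent
  rw [ent_congr p (f := fun ω => (f ω, g ω)) (g := g), sub_self]
  intro ω ω'
  simp only [Prod.mk.injEq]
  have := hgf ω ω'
  tauto

/-- The chain rule. -/
theorem cent_chain (p : Ω → ℝ) (f : Ω → α) (g : Ω → β) (h : Ω → γ) :
    cent p (fun ω => (f ω, g ω)) h = cent p g h + cent p f (fun ω => (g ω, h ω)) := by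
  unfold cent
  rw [ent_congr p (f := fun ω => ((f ω, g ω), h ω)) (g := fun ω => (f ω, g ω, h ω))]
  · ring
  · intro ω ω'
    simp [and_assoc]

/-- Two expansions of one joint entropy. This is the symmetry of conditional mutual information, in
a subtraction-free form that combines linearly with other entropy inequalities. -/
theorem cent_swap (p : Ω → ℝ) (f : Ω → α) (g : Ω → β) (h : Ω → γ) :
    cent p g h + cent p f (fun ω => (g ω, h ω)) = cent p f h + cent p g (fun ω => (f ω, h ω)) := by
  rw [← cent_chain, ← cent_chain]
  refine cent_congr p ?_ ?_ <;> intro ω ω' <;> simp [and_comm]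

/-- Gibbs' inequality against the uniform estimate. -/
theorem cent_le_log_card [Fintype α] [Nonempty α] [Fintype β] {p : Ω → ℝ} (hp : ∀ ω, 0 ≤ p ω)
    (hp1 : ∑ ω, p ω = 1) (f : Ω → α) (g : Ω → β) : cent p f g ≤ Real.log (Fintype.card α) := by
  have hc : (0 : ℝ) < Fintype.card α := by exact_mod_cast Fintype.card_pos
  refine (cent_le_cross hp f g (fun _ _ => (Fintype.card α : ℝ)⁻¹) ?_ ?_ ?_).trans ?_
  · intros; positivity
  · intro b
    simp
  · intros; positivity
  · simp [← Finset.sum_mul, hp1]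

/-- Conditional independence makes the additional conditioning irrelevant. -/
theorem cent_pair_eq_of_indep {p : Ω → ℝ}
    (hp : ∀ ω, 0 ≤ p ω) (f : Ω → α) (g : Ω → β) (h : Ω → γ)
    (hi : ∀ ω, 0 < p ω → law p (fun ω => (f ω, g ω, h ω)) (f ω, g ω, h ω) * law p h (h ω) =
      law p (fun ω => (f ω, h ω)) (f ω, h ω) * law p (fun ω => (g ω, h ω)) (g ω, h ω)) :
    cent p f (fun ω => (g ω, h ω)) = cent p f h := by
  unfold cent ent
  rw [← neg_add', ← neg_add', neg_inj, ← Finset.sum_neg_distrib, ← Finset.sum_neg_distrib,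
    ← Finset.sum_add_distrib, ← Finset.sum_add_distrib]
  refine Finset.sum_congr rfl fun ω _ => ?_
  rcases (hp ω).eq_or_lt with h0 | h0
  · simp [← h0]
  have h1 := h0.trans_le (le_law hp (fun ω => (f ω, g ω, h ω)) ω)
  have h2 := h0.trans_le (le_law hp (fun ω => (f ω, h ω)) ω)
  have h3 := h0.trans_le (le_law hp (fun ω => (g ω, h ω)) ω)
  have h4 := h0.trans_le (le_law hp h ω)
  have := congrArg Real.log (hi ω h0)
  rw [Real.log_mul h1.ne' h4.ne', Real.log_mul h2.ne' h3.ne'] at this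
  linear_combination p ω * this

theorem condEntropy_map [Fintype α] [Fintype β] [Fintype γ] (p : Ω → ℝ) (F : Ω → γ) (f : γ → α)
    (g : γ → β) :
    condEntropy p (fun ω => f (F ω)) (fun ω => g (F ω)) = condEntropy (law p F) f g := by
  simp only [condEntropy, law_law]

/-- Neither `w` nor the `B q` need be normalised. This matters for the alphabet reduction, where `B
q` is an unnormalised slice of a joint law. -/
theorem law_mixture [Fintype γ] [Fintype δ] (p : Ω → ℝ)
    (F : Ω → γ) (Q : Ω → δ) (w : δ → ℝ) (B : δ → γ → ℝ)
    (hlaw : ∀ v q, law p (fun ω => (F ω, Q ω)) (v, q) = w q * B q v) (e : γ → α) (c : α) (q : δ) :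
    law p (fun ω => (e (F ω), Q ω)) (c, q) = w q * law (B q) e c := by
  classical
  rw [← law_law p (fun ω => (F ω, Q ω)) (fun x => (e x.1, x.2)) (c, q)]
  unfold law
  simp only [Fintype.sum_prod_type, Finset.mul_sum]
  refine Finset.sum_congr rfl fun v _ => ?_
  rw [Finset.sum_eq_single q]
  · have := hlaw v q
    unfold law at this
    rw [this]
    simp
  · intro b _ hb
    simp [hb]
  · simp

/-- Conditional entropy given a mixing variable is the mixture of the conditional entropies. -/
theorem condEntropy_mixture [Fintype α] [Fintype β] [Fintype γ] [Fintype δ] (p : Ω → ℝ)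
    (F : Ω → γ) (Q : Ω → δ) (w : δ → ℝ) (B : δ → γ → ℝ)
    (hlaw : ∀ v q, law p (fun ω => (F ω, Q ω)) (v, q) = w q * B q v) (f : γ → α) (g : γ → β) :
    condEntropy p (fun ω => f (F ω)) (fun ω => (g (F ω), Q ω)) =
      ∑ q, w q * condEntropy (B q) f g := by
  classical
  have key := fun e : γ → β => law_mixture p F Q w B hlaw e
  have key2 : ∀ a b q, law p (fun ω => (f (F ω), g (F ω), Q ω)) (a, b, q) =
      w q * law (B q) (fun v => (f v, g v)) (a, b) := by
    intro a b q
    rw [← law_mixture p F Q w B hlaw (fun v => (f v, g v))]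
    exact law_congr p fun ω => by simp [and_assoc]
  simp only [condEntropy, mul_neg, Finset.sum_neg_distrib, neg_inj, Finset.mul_sum]
  rw [Finset.sum_comm (s := (Finset.univ : Finset δ))]
  refine Finset.sum_congr rfl fun a _ => ?_
  rw [Fintype.sum_prod_type, Finset.sum_comm]
  refine Finset.sum_congr rfl fun q _ => Finset.sum_congr rfl fun b _ => ?_
  rw [key2 a b q, key g b q]
  rcases eq_or_ne (w q) 0 with h | h
  · simp [h]
  · rw [mul_div_mul_left _ _ h, mul_assoc]

section Tuple

variable {ι : Type*} [Fintype ι]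

open Classical in
/-- Subadditivity of the entropy of a tuple. -/
theorem cent_tuple_le [Fintype α] [Fintype β] {p : Ω → ℝ} (hp : ∀ ω, 0 ≤ p ω)
    (X : Ω → ι → α) (G : Ω → β) :
    cent p X G ≤ ∑ i, cent p (fun ω => X ω i) G := by
  suffices ∀ s : Finset ι, cent p (fun ω (j : s) => X ω j) G ≤ ∑ i ∈ s, cent p (fun ω => X ω i) G by
    refine le_trans (le_of_eq ?_) (this Finset.univ)
    refine cent_congr p ?_ fun _ _ => Iff.rfl
    intro ω ω'
    simp [funext_iff]
  intro s
  induction s using Finset.induction_on with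
  | empty =>
    rw [cent_eq_zero_of_determines]
    · simp
    · intro ω ω' _
      funext j
      exact absurd j.2 (Finset.notMem_empty _)
  | insert i s hi ih =>
    rw [Finset.sum_insert hi]
    have h1 : cent p (fun ω (j : (insert i s : Finset ι)) => X ω j) G =
        cent p (fun ω => (X ω i, fun j : s => X ω j)) G := by
      refine cent_congr p ?_ fun _ _ => Iff.rfl
      intro ω ω'
      simp [funext_iff]
    rw [h1, cent_chain]
    have := cent_pair_le hp (fun ω => X ω i) (fun ω (j : s) => X ω j) G
    linarith

open Classical in
/-- The entropy of a tuple is at least the sum of the entropies of each entry given all others. -/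
theorem sum_cent_le_cent_tuple [Fintype α] [Fintype β] {p : Ω → ℝ} (hp : ∀ ω, 0 ≤ p ω)
    (X : Ω → ι → α) (G : Ω → β) :
    ∑ i, cent p (fun ω => X ω i) (fun ω => (fun j : {j // j ≠ i} => X ω j, G ω)) ≤
      cent p X G := by
  suffices ∀ s : Finset ι,
      ∑ i ∈ s, cent p (fun ω => X ω i) (fun ω => (fun j : {j // j ≠ i} => X ω j, G ω)) ≤
      cent p (fun ω (j : s) => X ω j) G by
    refine le_trans (this Finset.univ) (le_of_eq ?_)
    refine cent_congr p ?_ fun _ _ => Iff.rfl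
    intro ω ω'
    simp [funext_iff]
  intro s
  induction s using Finset.induction_on with
  | empty => simpa using cent_nonneg hp _ _
  | insert i s hi ih =>
    rw [Finset.sum_insert hi]
    have h1 : cent p (fun ω (j : (insert i s : Finset ι)) => X ω j) G =
        cent p (fun ω => (X ω i, fun j : s => X ω j)) G := by
      refine cent_congr p ?_ fun _ _ => Iff.rfl
      intro ω ω'
      simp [funext_iff]
    rw [h1, cent_chain]
    have := cent_le_of_determines hp (fun ω => X ω i)
      (fun ω => (fun j : {j // j ≠ i} => X ω j, G ω)) (fun ω => (fun j : s => X ω j, G ω)) ?_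
    · linarith
    · intro ω ω'
      simp only [Prod.mk.injEq, funext_iff]
      rintro ⟨h1, h2⟩
      refine ⟨fun j => h1 ⟨j, ?_⟩, h2⟩
      rintro rfl
      exact hi j.2

end Tuple

end Entropy

section Entropy

variable {Ω α β γ δ : Type*} [Fintype Ω]

theorem ent_map [Fintype γ] (p : Ω → ℝ) (F : Ω → γ) (f : γ → α) :
    ent p (fun ω => f (F ω)) = ent (law p F) f := by
  unfold ent
  rw [sum_law_mul p F (fun v => Real.log (law (law p F) f (f v)))]
  simp only [law_law]

theorem cent_map [Fintype γ] (p : Ω → ℝ) (F : Ω → γ) (f : γ → α) (g : γ → β) :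
    cent p (fun ω => f (F ω)) (fun ω => g (F ω)) = cent (law p F) f g := by
  unfold cent
  rw [ent_map p F g, ← ent_map p F (fun v => (f v, g v))]

theorem condMutualInfo_map {ε : Type*} [Fintype α] [Fintype β] [Fintype γ] [Fintype ε]
    (p : Ω → ℝ) (F : Ω → ε) (f : ε → α) (g : ε → β) (h : ε → γ) :
    condMutualInfo p (fun ω => f (F ω)) (fun ω => g (F ω)) (fun ω => h (F ω)) =
      condMutualInfo (law p F) f g h := by
  simp only [condMutualInfo, condEntropy, law_law]

theorem law_of_injective (p : Ω → ℝ) {F : Ω → γ} (hF : Function.Injective F) (ω : Ω) :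
    law p F (F ω) = p ω := by
  classical
  simp [law, hF.eq_iff]

end Entropy

/-! ### The joint law with auxiliaries, and the single-letter regions as upward closures -/

section SingleLetter

variable {𝒳 𝒴₀ 𝒴₁ 𝒴₂ : Type*} [Fintype 𝒳] [Fintype 𝒴₀] [Fintype 𝒴₁] [Fintype 𝒴₂]
  {m₁ m₂ : ℕ}

/-- The joint law of the sources and the first auxiliary variable. -/
def auxLeft (P : 𝒳 × 𝒴₀ × 𝒴₁ × 𝒴₂ → ℝ) (W₁ : 𝒴₁ → Fin m₁ → ℝ) :
    𝒳 × 𝒴₀ × 𝒴₁ × 𝒴₂ × Fin m₁ → ℝ :=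
  fun v => P (v.1, v.2.1, v.2.2.1, v.2.2.2.1) * W₁ v.2.2.1 v.2.2.2.2

/-- The joint law of the sources and the second auxiliary variable. -/
def auxRight (P : 𝒳 × 𝒴₀ × 𝒴₁ × 𝒴₂ → ℝ) (W₂ : 𝒴₂ → Fin m₂ → ℝ) :
    𝒳 × 𝒴₀ × 𝒴₁ × 𝒴₂ × Fin m₂ → ℝ :=
  fun v => P (v.1, v.2.1, v.2.2.1, v.2.2.2.1) * W₂ v.2.2.2.1 v.2.2.2.2

/-- The joint law with the roles of the two encoders exchanged. -/
def swapLaw (P : 𝒳 × 𝒴₀ × 𝒴₁ × 𝒴₂ → ℝ) : 𝒳 × 𝒴₀ × 𝒴₂ × 𝒴₁ → ℝ :=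
  fun v => P (v.1, v.2.1, v.2.2.2, v.2.2.1)

variable {P : 𝒳 × 𝒴₀ × 𝒴₁ × 𝒴₂ → ℝ} {W₁ : 𝒴₁ → Fin m₁ → ℝ} {W₂ : 𝒴₂ → Fin m₂ → ℝ}

theorem auxJoint_nonneg (hP : ∀ s, 0 ≤ P s) (h₁ : IsChannel W₁) (h₂ : IsChannel W₂)
    (v : 𝒳 × 𝒴₀ × 𝒴₁ × 𝒴₂ × Fin m₁ × Fin m₂) : 0 ≤ auxJoint P W₁ W₂ v :=
  mul_nonneg (mul_nonneg (hP _) ((h₁ _).1 _)) ((h₂ _).1 _)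

/-- The rows of `W₁` sum to one, so `U₁` can be summed out. Hence no quantity that avoids `U₁`
depends on `W₁`. -/
theorem law_auxJoint_right (h₁ : IsChannel W₁) :
    law (auxJoint P W₁ W₂) (fun v => (v.1, v.2.1, v.2.2.1, v.2.2.2.1, v.2.2.2.2.2)) =
      auxRight P W₂ := by
  classical
  funext ⟨x, y₀, y₁, y₂, u₂⟩
  have : ∀ c, (∑ u, auxJoint P W₁ W₂ (x, y₀, y₁, y₂, u, c)) = auxRight P W₂ (x, y₀, y₁, y₂, c) := by
    intro c
    have := (h₁ y₁).2
    simp only [auxJoint, auxRight, ← Finset.sum_mul, ← Finset.mul_sum, this, mul_one]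
  unfold law
  simp only [Fintype.sum_prod_type, Prod.mk.injEq]
  rw [Finset.sum_eq_single x (by intro b _ hb; simp [hb]) (by simp),
    Finset.sum_eq_single y₀ (by intro b _ hb; simp [hb]) (by simp),
    Finset.sum_eq_single y₁ (by intro b _ hb; simp [hb]) (by simp),
    Finset.sum_eq_single y₂ (by intro b _ hb; simp [hb]) (by simp), ← this]
  simp

theorem law_auxJoint_left (h₂ : IsChannel W₂) :
    law (auxJoint P W₁ W₂) (fun v => (v.1, v.2.1, v.2.2.1, v.2.2.2.1, v.2.2.2.2.1)) =
      auxLeft P W₁ := by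
  classical
  funext ⟨x, y₀, y₁, y₂, u₁⟩
  have : ∀ c, (∑ u, auxJoint P W₁ W₂ (x, y₀, y₁, y₂, c, u)) = auxLeft P W₁ (x, y₀, y₁, y₂, c) := by
    intro c
    have := (h₂ y₂).2
    simp only [auxJoint, auxLeft, ← Finset.mul_sum, this, mul_one]
  unfold law
  simp only [Fintype.sum_prod_type, Prod.mk.injEq]
  rw [Finset.sum_eq_single x (by intro b _ hb; simp [hb]) (by simp),
    Finset.sum_eq_single y₀ (by intro b _ hb; simp [hb]) (by simp),
    Finset.sum_eq_single y₁ (by intro b _ hb; simp [hb]) (by simp),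
    Finset.sum_eq_single y₂ (by intro b _ hb; simp [hb]) (by simp), ← this]
  simp

theorem law_auxLeft (h₁ : IsChannel W₁) :
    law (auxLeft P W₁) (fun v => (v.1, v.2.1, v.2.2.1, v.2.2.2.1)) = P := by
  classical
  funext ⟨x, y₀, y₁, y₂⟩
  have : (∑ u, auxLeft P W₁ (x, y₀, y₁, y₂, u)) = P (x, y₀, y₁, y₂) := by
    have := (h₁ y₁).2
    simp only [auxLeft, ← Finset.mul_sum, this, mul_one]
  unfold law
  simp only [Fintype.sum_prod_type, Prod.mk.injEq]
  rw [Finset.sum_eq_single x (by intro b _ hb; simp [hb]) (by simp),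
    Finset.sum_eq_single y₀ (by intro b _ hb; simp [hb]) (by simp),
    Finset.sum_eq_single y₁ (by intro b _ hb; simp [hb]) (by simp),
    Finset.sum_eq_single y₂ (by intro b _ hb; simp [hb]) (by simp), ← this]
  simp

theorem law_auxJoint_source (h₁ : IsChannel W₁) (h₂ : IsChannel W₂) :
    law (auxJoint P W₁ W₂) (fun v => (v.1, v.2.1, v.2.2.1, v.2.2.2.1)) = P := by
  conv_rhs => rw [← law_auxLeft (P := P) h₁, ← law_auxJoint_left h₂]
  funext s
  rw [law_law]

theorem law_auxJoint_swap :
    law (auxJoint P W₁ W₂)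
      (fun v => (v.1, v.2.1, v.2.2.2.1, v.2.2.1, v.2.2.2.2.2, v.2.2.2.2.1)) =
      auxJoint (swapLaw P) W₂ W₁ := by
  funext ⟨x, y₀, y₂, y₁, u₂, u₁⟩
  refine (law_of_injective _ ?_ (x, y₀, y₁, y₂, u₁, u₂)).trans ?_
  · rintro ⟨a, b, c, d, e, f⟩ ⟨a', b', c', d', e', f'⟩ h
    simp only [Prod.mk.injEq] at h ⊢
    tauto
  · simp [auxJoint, swapLaw, mul_right_comm]

theorem law_auxLeft_pair (y : 𝒴₁) (u : Fin m₁) :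
    law (auxLeft P W₁) (fun v => (v.2.2.2.2, v.2.2.1)) (u, y) =
      W₁ y u * law P (fun s => s.2.2.1) y := by
  classical
  simp only [law, Fintype.sum_prod_type, Finset.mul_sum, auxLeft]
  refine Finset.sum_congr rfl fun x _ => Finset.sum_congr rfl fun y₀ _ =>
    Finset.sum_congr rfl fun y₁ _ => Finset.sum_congr rfl fun y₂ _ => ?_
  rw [Finset.sum_eq_single u]
  · by_cases h : y₁ = y
    · simp [h, mul_comm]
    · simp [h]
  · intro b _ hb
    simp [hb]
  · simp

/-- Given its own observation, the first auxiliary variable is independent of everything else. -/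
theorem cent_aux_markov (hP : ∀ s, 0 ≤ P s) (h₁ : IsChannel W₁) (h₂ : IsChannel W₂) :
    cent (auxJoint P W₁ W₂) (fun v => v.2.2.2.2.1)
      (fun v => ((v.1, v.2.1, v.2.2.2.1, v.2.2.2.2.2), v.2.2.1)) =
    cent (auxJoint P W₁ W₂) (fun v => v.2.2.2.2.1) (fun v => v.2.2.1) := by
  refine cent_pair_eq_of_indep (auxJoint_nonneg hP h₁ h₂) _ _ _ ?_
  rintro ⟨x, y₀, y₁, y₂, u₁, u₂⟩ -
  have e1 := law_of_injective (auxJoint P W₁ W₂) (F := fun v => (v.2.2.2.2.1,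
    (v.1, v.2.1, v.2.2.2.1, v.2.2.2.2.2), v.2.2.1)) (by
      rintro ⟨a, b, c, d, e, f⟩ ⟨a', b', c', d', e', f'⟩ h
      simp only [Prod.mk.injEq] at h ⊢
      tauto) (x, y₀, y₁, y₂, u₁, u₂)
  have e2 : law (auxJoint P W₁ W₂) (fun v => ((v.1, v.2.1, v.2.2.2.1, v.2.2.2.2.2), v.2.2.1))
      ((x, y₀, y₂, u₂), y₁) = auxRight P W₂ (x, y₀, y₁, y₂, u₂) := by
    have := law_law (auxJoint P W₁ W₂)
      (fun v => (v.1, v.2.1, v.2.2.1, v.2.2.2.1, v.2.2.2.2.2))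
      (fun v => ((v.1, v.2.1, v.2.2.2.1, v.2.2.2.2), v.2.2.1)) ((x, y₀, y₂, u₂), y₁)
    rw [← this, law_auxJoint_right h₁]
    refine law_of_injective (auxRight P W₂) (F := fun v => ((v.1, v.2.1, v.2.2.2.1, v.2.2.2.2),
      v.2.2.1)) ?_ (x, y₀, y₁, y₂, u₂)
    rintro ⟨a, b, c, d, e⟩ ⟨a', b', c', d', e'⟩ h
    simp only [Prod.mk.injEq] at h ⊢
    tauto
  have e3 : law (auxJoint P W₁ W₂) (fun v => (v.2.2.2.2.1, v.2.2.1)) (u₁, y₁) =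
      W₁ y₁ u₁ * law P (fun s => s.2.2.1) y₁ := by
    rw [← law_auxLeft_pair, ← law_auxJoint_left h₂, law_law]
  have e4 : law (auxJoint P W₁ W₂) (fun v => v.2.2.1) y₁ = law P (fun s => s.2.2.1) y₁ := by
    conv_rhs => rw [← law_auxJoint_source (P := P) h₁ h₂, law_law]
  dsimp only at e1 e2 e3 e4 ⊢
  rw [e1, e2, e3, e4]
  simp only [auxJoint, auxRight]
  ring

/-- The triple of rates and distortion of the decoding order in which `U₂` is decoded first. -/
def cost (P : 𝒳 × 𝒴₀ × 𝒴₁ × 𝒴₂ → ℝ) (W₁ : 𝒴₁ → Fin m₁ → ℝ) (W₂ : 𝒴₂ → Fin m₂ → ℝ) :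
    ℝ × ℝ × ℝ :=
  (cent (auxJoint P W₁ W₂) (fun v => v.2.2.1) (fun v => (v.2.2.2.2.2, v.2.1)) -
    cent (auxJoint P W₁ W₂) (fun v => v.2.2.1) (fun v => (v.2.2.2.2.1, v.2.2.2.2.2, v.2.1)),
   cent (auxJoint P W₁ W₂) (fun v => v.2.2.2.1) (fun v => v.2.1) -
    cent (auxJoint P W₁ W₂) (fun v => v.2.2.2.1) (fun v => (v.2.2.2.2.2, v.2.1)),
   cent (auxJoint P W₁ W₂) (fun v => v.1) (fun v => (v.2.2.2.2.1, v.2.2.2.2.2, v.2.1)))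

/-- The infimum need not be attained, so a slack `ε` is unavoidable here. For empty `S` both sides
fail, in agreement with the value `+∞`. -/
theorem sInf_le_coe_iff (S : Set EReal) (D : ℝ) :
    sInf S ≤ (D : EReal) ↔ ∀ ε : ℝ, 0 < ε → ∃ d ∈ S, d ≤ ((D + ε : ℝ) : EReal) := by
  constructor
  · intro h ε hε
    have : sInf S < ((D + ε : ℝ) : EReal) :=
      h.trans_lt (by exact_mod_cast (by linarith : D < D + ε))
    obtain ⟨d, hd, hlt⟩ := sInf_lt_iff.1 this
    exact ⟨d, hd, hlt.le⟩
  · intro h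
    refine le_of_forall_gt fun c hc => ?_
    obtain ⟨q, hq1, hq2⟩ := EReal.lt_iff_exists_real_btwn.1 hc
    have hq1' : D < q := by exact_mod_cast hq1
    obtain ⟨d, hd, hle⟩ := h (q - D) (by linarith)
    refine (sInf_le hd).trans_lt (hle.trans_lt ?_)
    rwa [add_sub_cancel]

/-- Membership becomes domination of a cost triple in the product order. The slack touches only the
distortion, since the rate constraints are not relaxed. -/
theorem mem_rdRegion₁_iff (hP : ∀ s, 0 ≤ P s) (t : ℝ × ℝ × ℝ) :
    t ∈ rdRegion₁ P ↔ ∀ ε : ℝ, 0 < ε → ∃ (m₁ m₂ : ℕ) (W₁ : 𝒴₁ → Fin m₁ → ℝ)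
      (W₂ : 𝒴₂ → Fin m₂ → ℝ), IsChannel W₁ ∧ IsChannel W₂ ∧
        cost P W₁ W₂ ≤ (t.1, t.2.1, t.2.2 + ε) := by
  show distortionRate₁ P t.1 t.2.1 ≤ (t.2.2 : EReal) ↔ _
  unfold distortionRate₁
  rw [sInf_le_coe_iff]
  refine forall₂_congr fun ε hε => ?_
  constructor
  · rintro ⟨d, ⟨m₁, m₂, W₁, W₂, h₁, h₂, hr₁, hr₂, rfl⟩, hd⟩
    refine ⟨m₁, m₂, W₁, W₂, h₁, h₂, ?_, ?_, ?_⟩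
    · have hr := hr₁
      unfold condMutualInfo at hr
      rwa [condEntropy_eq_cent (auxJoint_nonneg hP h₁ h₂),
        condEntropy_eq_cent (auxJoint_nonneg hP h₁ h₂)] at hr
    · have hr := hr₂
      unfold condMutualInfo at hr
      rwa [condEntropy_eq_cent (auxJoint_nonneg hP h₁ h₂),
        condEntropy_eq_cent (auxJoint_nonneg hP h₁ h₂)] at hr
    · have := EReal.coe_le_coe_iff.1 hd
      unfold distortion at this
      rwa [condEntropy_eq_cent (auxJoint_nonneg hP h₁ h₂)] at this
  · rintro ⟨m₁, m₂, W₁, W₂, h₁, h₂, hr₁, hr₂, hd⟩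
    refine ⟨_, ⟨m₁, m₂, W₁, W₂, h₁, h₂, ?_, ?_, rfl⟩, ?_⟩
    · unfold condMutualInfo
      rw [condEntropy_eq_cent (auxJoint_nonneg hP h₁ h₂),
        condEntropy_eq_cent (auxJoint_nonneg hP h₁ h₂)]
      exact hr₁
    · unfold condMutualInfo
      rw [condEntropy_eq_cent (auxJoint_nonneg hP h₁ h₂),
        condEntropy_eq_cent (auxJoint_nonneg hP h₁ h₂)]
      exact hr₂
    · refine EReal.coe_le_coe_iff.2 ?_
      unfold distortion
      rw [condEntropy_eq_cent (auxJoint_nonneg hP h₁ h₂)]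
      exact hd

theorem cost_mem_rdRegion₁ (hP : ∀ s, 0 ≤ P s) (h₁ : IsChannel W₁) (h₂ : IsChannel W₂)
    {t : ℝ × ℝ × ℝ} (h : cost P W₁ W₂ ≤ t) : t ∈ rdRegion₁ P := by
  rw [mem_rdRegion₁_iff hP]
  intro ε hε
  refine ⟨m₁, m₂, W₁, W₂, h₁, h₂, h.trans ⟨le_rfl, le_rfl, ?_⟩⟩
  show t.2.2 ≤ t.2.2 + ε
  linarith

theorem isUpperSet_rdRegion₁ (hP : ∀ s, 0 ≤ P s) : IsUpperSet (rdRegion₁ P) := by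
  intro s t hst hs
  rw [mem_rdRegion₁_iff hP] at hs ⊢
  intro ε hε
  obtain ⟨m₁, m₂, W₁, W₂, h₁, h₂, h⟩ := hs ε hε
  exact ⟨m₁, m₂, W₁, W₂, h₁, h₂, h.trans ⟨hst.1, hst.2.1, add_le_add hst.2.2 le_rfl⟩⟩

/-- Exchange of the two rates. -/
def swapRates (t : ℝ × ℝ × ℝ) : ℝ × ℝ × ℝ := (t.2.1, t.1, t.2.2)

/-- The two decoding orders are mirror images, so everything needs proof only for the order in which
`U₂` is decoded first. -/
theorem mem_rdRegion₂_iff (hP : ∀ s, 0 ≤ P s) (t : ℝ × ℝ × ℝ) :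
    t ∈ rdRegion₂ P ↔ swapRates t ∈ rdRegion₁ (swapLaw P) := by
  have key : ∀ (m₁ m₂ : ℕ) (W₁ : 𝒴₁ → Fin m₁ → ℝ) (W₂ : 𝒴₂ → Fin m₂ → ℝ),
      distortion (swapLaw P) W₂ W₁ = condEntropy (auxJoint P W₁ W₂) (fun (x, _, _, _, _, _) => x)
        (fun (_, y₀, _, _, u₁, u₂) => (u₂, u₁, y₀)) := by
    intro m₁ m₂ W₁ W₂
    unfold distortion
    rw [← law_auxJoint_swap, ← condEntropy_map]
  have hrate : distortionRate₂ P t.1 t.2.1 = distortionRate₁ (swapLaw P) t.2.1 t.1 := ?_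
  · show distortionRate₂ P t.1 t.2.1 ≤ _ ↔ distortionRate₁ (swapLaw P) t.2.1 t.1 ≤ _
    rw [hrate]
    rfl
  unfold distortionRate₁ distortionRate₂
  congr 1
  ext d
  constructor
  · rintro ⟨m₁, m₂, W₁, W₂, h₁, h₂, hr₂, hr₁, rfl⟩
    refine ⟨m₂, m₁, W₂, W₁, h₂, h₁, ?_, ?_, ?_⟩
    · rw [← law_auxJoint_swap, ← condMutualInfo_map]
      exact hr₂
    · rw [← law_auxJoint_swap, ← condMutualInfo_map]
      exact hr₁
    · rw [key]
      unfold distortion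
      rw [condEntropy_eq_cent (auxJoint_nonneg hP h₁ h₂),
        condEntropy_eq_cent (auxJoint_nonneg hP h₁ h₂)]
      congr 1
      apply cent_congr <;>
      · rintro ⟨a, b, c, d, e, f⟩ ⟨a', b', c', d', e', f'⟩
        simp only [Prod.mk.injEq]
        tauto
  · rintro ⟨m₂, m₁, W₂, W₁, h₂, h₁, hr₂, hr₁, rfl⟩
    refine ⟨m₁, m₂, W₁, W₂, h₁, h₂, ?_, ?_, ?_⟩
    · rw [← law_auxJoint_swap, ← condMutualInfo_map] at hr₂
      exact hr₂
    · rw [← law_auxJoint_swap, ← condMutualInfo_map] at hr₁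
      exact hr₁
    · rw [key]
      unfold distortion
      rw [condEntropy_eq_cent (auxJoint_nonneg hP h₁ h₂),
        condEntropy_eq_cent (auxJoint_nonneg hP h₁ h₂)]
      congr 1
      apply cent_congr <;>
      · rintro ⟨a, b, c, d, e, f⟩ ⟨a', b', c', d', e', f'⟩
        simp only [Prod.mk.injEq]
        tauto

end SingleLetter

/-! ### Corner points of the outer bound -/

section Corners

variable {𝒳 𝒴₀ 𝒴₁ 𝒴₂ : Type*} [Fintype 𝒳] [Fintype 𝒴₀] [Fintype 𝒴₁] [Fintype 𝒴₂]
  {m₁ m₂ : ℕ}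

/-- `I(Y₁; U₁ | X, Y₀)`. -/
def noiseInfo₁ (P : 𝒳 × 𝒴₀ × 𝒴₁ × 𝒴₂ → ℝ) (W₁ : 𝒴₁ → Fin m₁ → ℝ) (W₂ : 𝒴₂ → Fin m₂ → ℝ) : ℝ :=
  cent (auxJoint P W₁ W₂) (fun v => v.2.2.1) (fun v => (v.1, v.2.1)) -
    cent (auxJoint P W₁ W₂) (fun v => v.2.2.1) (fun v => (v.2.2.2.2.1, v.1, v.2.1))

/-- `I(Y₂; U₂ | X, Y₀)`. -/
def noiseInfo₂ (P : 𝒳 × 𝒴₀ × 𝒴₁ × 𝒴₂ → ℝ) (W₁ : 𝒴₁ → Fin m₁ → ℝ) (W₂ : 𝒴₂ → Fin m₂ → ℝ) : ℝ :=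
  cent (auxJoint P W₁ W₂) (fun v => v.2.2.2.1) (fun v => (v.1, v.2.1)) -
    cent (auxJoint P W₁ W₂) (fun v => v.2.2.2.1) (fun v => (v.2.2.2.2.2, v.1, v.2.1))

/-- `H(X | Y₀)`. -/
def equivoc₀ (P : 𝒳 × 𝒴₀ × 𝒴₁ × 𝒴₂ → ℝ) : ℝ :=
  cent P (fun v => v.1) (fun v => v.2.1)

/-- `H(X | U₁, Y₀)`. -/
def equivoc₁ (P : 𝒳 × 𝒴₀ × 𝒴₁ × 𝒴₂ → ℝ) (W₁ : 𝒴₁ → Fin m₁ → ℝ) (W₂ : 𝒴₂ → Fin m₂ → ℝ) : ℝ :=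
  cent (auxJoint P W₁ W₂) (fun v => v.1) (fun v => (v.2.2.2.2.1, v.2.1))

/-- `H(X | U₂, Y₀)`. -/
def equivoc₂ (P : 𝒳 × 𝒴₀ × 𝒴₁ × 𝒴₂ → ℝ) (W₁ : 𝒴₁ → Fin m₁ → ℝ) (W₂ : 𝒴₂ → Fin m₂ → ℝ) : ℝ :=
  cent (auxJoint P W₁ W₂) (fun v => v.1) (fun v => (v.2.2.2.2.2, v.2.1))

/-- `H(X | U₁, U₂, Y₀)`. -/
def equivoc₁₂ (P : 𝒳 × 𝒴₀ × 𝒴₁ × 𝒴₂ → ℝ) (W₁ : 𝒴₁ → Fin m₁ → ℝ) (W₂ : 𝒴₂ → Fin m₂ → ℝ) : ℝ :=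
  cent (auxJoint P W₁ W₂) (fun v => v.1) (fun v => (v.2.2.2.2.1, v.2.2.2.2.2, v.2.1))

variable {P : 𝒳 × 𝒴₀ × 𝒴₁ × 𝒴₂ → ℝ} {W₁ : 𝒴₁ → Fin m₁ → ℝ} {W₂ : 𝒴₂ → Fin m₂ → ℝ}

theorem noiseInfo₁_nonneg (hP : ∀ s, 0 ≤ P s) (h₁ : IsChannel W₁) (h₂ : IsChannel W₂) :
    0 ≤ noiseInfo₁ P W₁ W₂ :=
  sub_nonneg.2 (cent_pair_le (auxJoint_nonneg hP h₁ h₂) _ _ _)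

theorem noiseInfo₂_nonneg (hP : ∀ s, 0 ≤ P s) (h₁ : IsChannel W₁) (h₂ : IsChannel W₂) :
    0 ≤ noiseInfo₂ P W₁ W₂ :=
  sub_nonneg.2 (cent_pair_le (auxJoint_nonneg hP h₁ h₂) _ _ _)

theorem cent_source {α β : Type*} (h₁ : IsChannel W₁) (h₂ : IsChannel W₂)
    (f : 𝒳 × 𝒴₀ × 𝒴₁ × 𝒴₂ → α) (g : 𝒳 × 𝒴₀ × 𝒴₁ × 𝒴₂ → β) :
    cent (auxJoint P W₁ W₂) (fun v => f (v.1, v.2.1, v.2.2.1, v.2.2.2.1))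
      (fun v => g (v.1, v.2.1, v.2.2.1, v.2.2.2.1)) = cent P f g := by
  have := cent_map (auxJoint P W₁ W₂) (fun v => (v.1, v.2.1, v.2.2.1, v.2.2.2.1)) f g
  rwa [law_auxJoint_source h₁ h₂] at this

theorem cent_right {α β : Type*} (h₁ : IsChannel W₁) (f : 𝒳 × 𝒴₀ × 𝒴₁ × 𝒴₂ × Fin m₂ → α)
    (g : 𝒳 × 𝒴₀ × 𝒴₁ × 𝒴₂ × Fin m₂ → β) :
    cent (auxJoint P W₁ W₂) (fun v => f (v.1, v.2.1, v.2.2.1, v.2.2.2.1, v.2.2.2.2.2))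
      (fun v => g (v.1, v.2.1, v.2.2.1, v.2.2.2.1, v.2.2.2.2.2)) = cent (auxRight P W₂) f g := by
  have := cent_map (auxJoint P W₁ W₂)
    (fun v => (v.1, v.2.1, v.2.2.1, v.2.2.2.1, v.2.2.2.2.2)) f g
  rwa [law_auxJoint_right h₁] at this

/-- The corner rates are `I(Y₁; U₁ | X, Y₀) + I(X; U₁ | U₂, Y₀)` and `I(Y₂; U₂ | X, Y₀) + I(X; U₂ |
Y₀)`. They dominate the required rates because adjoining `X` can only add information. An inequality
suffices as the region is an upper set, and it does not need the Markov property of the source. -/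
theorem cost_le_corner (hP : ∀ s, 0 ≤ P s) (h₁ : IsChannel W₁) (h₂ : IsChannel W₂) :
    cost P W₁ W₂ ≤ (noiseInfo₁ P W₁ W₂ + equivoc₂ P W₁ W₂ - equivoc₁₂ P W₁ W₂,
      noiseInfo₂ P W₁ W₂ + equivoc₀ P - equivoc₂ P W₁ W₂, equivoc₁₂ P W₁ W₂) := by
  have hJ := auxJoint_nonneg hP h₁ h₂
  refine ⟨?_, ?_, le_rfl⟩
  · show cent _ _ _ - cent _ _ _ ≤ noiseInfo₁ P W₁ W₂ + equivoc₂ P W₁ W₂ - equivoc₁₂ P W₁ W₂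
    unfold noiseInfo₁ equivoc₂ equivoc₁₂
    have e1 := cent_swap (auxJoint P W₁ W₂) (fun v => v.2.2.1) (fun v => v.2.2.2.2.1)
      (fun v => (v.2.2.2.2.2, v.2.1))
    have e2 := cent_swap (auxJoint P W₁ W₂) (fun v => v.2.2.1) (fun v => v.2.2.2.2.1)
      (fun v => (v.1, v.2.1))
    have e3 := cent_swap (auxJoint P W₁ W₂) (fun v => v.1) (fun v => v.2.2.2.2.1)
      (fun v => (v.2.2.2.2.2, v.2.1))
    -- All informations are first rewritten as entropies of `U₁`. Dropping `U₂` from a condition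
    -- raises one of them, and `U₁` depends on the remaining variables only through `Y₁`, which
    -- settles the other comparison.
    have i1 := cent_le_of_determines hJ (fun v => v.2.2.2.2.1)
      (fun v => (v.1, v.2.2.2.2.2, v.2.1)) (fun v => (v.1, v.2.1)) (by
        rintro ω ω' h
        simp only [Prod.mk.injEq] at h ⊢
        tauto)
    have i2 := cent_le_of_determines hJ (fun v => v.2.2.2.2.1)
      (fun v => (v.2.2.1, v.1, v.2.1)) (fun v => v.2.2.1) (by
        rintro ω ω' h
        simp only [Prod.mk.injEq] at h ⊢
        tauto)
    have i3 := cent_le_of_determines hJ (fun v => v.2.2.2.2.1)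
      (fun v => ((v.1, v.2.1, v.2.2.2.1, v.2.2.2.2.2), v.2.2.1))
      (fun v => (v.2.2.1, v.2.2.2.2.2, v.2.1)) (by
        rintro ω ω' h
        simp only [Prod.mk.injEq] at h ⊢
        tauto)
    rw [cent_aux_markov hP h₁ h₂] at i3
    linarith
  · show cent _ _ _ - cent _ _ _ ≤ noiseInfo₂ P W₁ W₂ + equivoc₀ P - equivoc₂ P W₁ W₂
    unfold noiseInfo₂ equivoc₂ equivoc₀
    rw [← cent_source h₁ h₂ (P := P)]
    have e1 := cent_swap (auxJoint P W₁ W₂) (fun v => v.2.2.2.1) (fun v => v.2.2.2.2.2)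
      (fun v => v.2.1)
    have e2 := cent_swap (auxJoint P W₁ W₂) (fun v => v.2.2.2.1) (fun v => v.2.2.2.2.2)
      (fun v => (v.1, v.2.1))
    have e3 := cent_swap (auxJoint P W₁ W₂) (fun v => v.1) (fun v => v.2.2.2.2.2)
      (fun v => v.2.1)
    have i1 := cent_le_of_determines hJ (fun v => v.2.2.2.2.2)
      (fun v => (v.2.2.2.1, v.1, v.2.1)) (fun v => (v.2.2.2.1, v.2.1)) (by
        rintro ω ω' h
        simp only [Prod.mk.injEq] at h ⊢
        tauto)
    linarith

/-- The channel with a constant output. -/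
def trivialChannel (𝒴 : Type*) : 𝒴 → Fin 1 → ℝ := fun _ _ => 1

theorem isChannel_trivialChannel (𝒴 : Type*) : IsChannel (trivialChannel 𝒴) := by
  intro y
  refine ⟨fun _ => zero_le_one, ?_⟩
  simp [trivialChannel]

theorem corner_mem_rdRegion₁ (hP : ∀ s, 0 ≤ P s) (h₁ : IsChannel W₁) (h₂ : IsChannel W₂) :
    (noiseInfo₁ P W₁ W₂ + equivoc₂ P W₁ W₂ - equivoc₁₂ P W₁ W₂,
      noiseInfo₂ P W₁ W₂ + equivoc₀ P - equivoc₂ P W₁ W₂, equivoc₁₂ P W₁ W₂) ∈ rdRegion₁ P :=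
  cost_mem_rdRegion₁ hP h₁ h₂ (cost_le_corner hP h₁ h₂)

/-- A silent first encoder: with constant `U₁` the rate of encoder one vanishes and `h₁₂` collapses
to `h₂`, while the quantities of `U₂` are unchanged. -/
theorem semicorner_mem_rdRegion₁ (hP : ∀ s, 0 ≤ P s) (h₁ : IsChannel W₁) (h₂ : IsChannel W₂) :
    (0, noiseInfo₂ P W₁ W₂ + equivoc₀ P - equivoc₂ P W₁ W₂, equivoc₂ P W₁ W₂) ∈
      rdRegion₁ P := by
  have ht := isChannel_trivialChannel 𝒴₁
  refine cost_mem_rdRegion₁ hP ht h₂ ((cost_le_corner hP ht h₂).trans (le_of_eq ?_))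
  have e1 : noiseInfo₁ P (trivialChannel 𝒴₁) W₂ = 0 := by
    unfold noiseInfo₁
    rw [sub_eq_zero]
    apply cent_congr <;> intro ω ω' <;> simp [Subsingleton.elim ω.2.2.2.2.1 ω'.2.2.2.2.1]
  have e2 : equivoc₁₂ P (trivialChannel 𝒴₁) W₂ = equivoc₂ P W₁ W₂ := by
    unfold equivoc₁₂ equivoc₂
    have := cent_right (P := P) (W₂ := W₂) h₁ (fun v => v.1) (fun v => (v.2.2.2.2, v.2.1))
    rw [this]
    have := cent_right (P := P) (W₂ := W₂) ht (fun v => v.1) (fun v => (v.2.2.2.2, v.2.1))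
    rw [← this]
    apply cent_congr <;> intro ω ω' <;> simp [Subsingleton.elim ω.2.2.2.2.1 ω'.2.2.2.2.1]
  have e3 : equivoc₂ P (trivialChannel 𝒴₁) W₂ = equivoc₂ P W₁ W₂ := by
    unfold equivoc₂
    have := cent_right (P := P) (W₂ := W₂) h₁ (fun v => v.1) (fun v => (v.2.2.2.2, v.2.1))
    rw [this]
    exact cent_right (P := P) (W₂ := W₂) ht (fun v => v.1) (fun v => (v.2.2.2.2, v.2.1))
  have e4 : noiseInfo₂ P (trivialChannel 𝒴₁) W₂ = noiseInfo₂ P W₁ W₂ := by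
    unfold noiseInfo₂
    congr 1
    · exact (cent_source (P := P) ht h₂ (fun v => v.2.2.2) (fun v => (v.1, v.2.1))).trans
        (cent_source (P := P) h₁ h₂ (fun v => v.2.2.2) (fun v => (v.1, v.2.1))).symm
    · exact (cent_right (P := P) (W₂ := W₂) ht (fun v => v.2.2.2.1)
        (fun v => (v.2.2.2.2, v.1, v.2.1))).trans
        (cent_right (P := P) (W₂ := W₂) h₁ (fun v => v.2.2.2.1)
          (fun v => (v.2.2.2.2, v.1, v.2.1))).symm
  rw [e1, e2, e3, e4]
  simp

theorem origin_mem_rdRegion₁ (hP : ∀ s, 0 ≤ P s) : (0, 0, equivoc₀ P) ∈ rdRegion₁ P := by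
  have ht₁ := isChannel_trivialChannel 𝒴₁
  have ht₂ := isChannel_trivialChannel 𝒴₂
  refine isUpperSet_rdRegion₁ hP (le_of_eq ?_) (semicorner_mem_rdRegion₁ hP ht₁ ht₂)
  have e1 : noiseInfo₂ P (trivialChannel 𝒴₁) (trivialChannel 𝒴₂) = 0 := by
    unfold noiseInfo₂
    rw [sub_eq_zero]
    apply cent_congr <;> intro ω ω' <;> simp [Subsingleton.elim ω.2.2.2.2.2 ω'.2.2.2.2.2]
  have e2 : equivoc₂ P (trivialChannel 𝒴₁) (trivialChannel 𝒴₂) = equivoc₀ P := by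
    unfold equivoc₂ equivoc₀
    rw [← cent_source (P := P) ht₁ ht₂]
    apply cent_congr <;> intro ω ω' <;> simp [Subsingleton.elim ω.2.2.2.2.2 ω'.2.2.2.2.2]
  rw [e1, e2]
  simp

theorem noiseInfo₁_swap : noiseInfo₁ (swapLaw P) W₂ W₁ = noiseInfo₂ P W₁ W₂ := by
  unfold noiseInfo₁ noiseInfo₂
  rw [← law_auxJoint_swap, ← cent_map, ← cent_map]

theorem noiseInfo₂_swap : noiseInfo₂ (swapLaw P) W₂ W₁ = noiseInfo₁ P W₁ W₂ := by
  unfold noiseInfo₁ noiseInfo₂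
  rw [← law_auxJoint_swap, ← cent_map, ← cent_map]

theorem equivoc₂_swap : equivoc₂ (swapLaw P) W₂ W₁ = equivoc₁ P W₁ W₂ := by
  unfold equivoc₁ equivoc₂
  rw [← law_auxJoint_swap, ← cent_map]

theorem equivoc₁₂_swap : equivoc₁₂ (swapLaw P) W₂ W₁ = equivoc₁₂ P W₁ W₂ := by
  unfold equivoc₁₂
  rw [← law_auxJoint_swap, ← cent_map]
  apply cent_congr <;>
  · rintro ω ω'
    simp only [Prod.mk.injEq]
    tauto

theorem law_swap : law P (fun v => (v.1, v.2.1, v.2.2.2, v.2.2.1)) = swapLaw P := by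
  funext ⟨x, y₀, y₂, y₁⟩
  refine (law_of_injective _ ?_ (x, y₀, y₁, y₂)).trans rfl
  rintro ⟨a, b, c, d⟩ ⟨a', b', c', d'⟩ h
  simp only [Prod.mk.injEq] at h ⊢
  tauto

theorem equivoc₀_swap : equivoc₀ (swapLaw P) = equivoc₀ P := by
  unfold equivoc₀
  rw [← law_swap, ← cent_map]

theorem corner_mem_rdRegion₂ (hP : ∀ s, 0 ≤ P s) (h₁ : IsChannel W₁) (h₂ : IsChannel W₂) :
    (noiseInfo₁ P W₁ W₂ + equivoc₀ P - equivoc₁ P W₁ W₂,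
      noiseInfo₂ P W₁ W₂ + equivoc₁ P W₁ W₂ - equivoc₁₂ P W₁ W₂, equivoc₁₂ P W₁ W₂) ∈
      rdRegion₂ P := by
  rw [mem_rdRegion₂_iff hP]
  have := corner_mem_rdRegion₁ (P := swapLaw P) (fun s => hP _) h₂ h₁
  rwa [noiseInfo₁_swap, noiseInfo₂_swap, equivoc₂_swap, equivoc₁₂_swap, equivoc₀_swap] at this

theorem semicorner_mem_rdRegion₂ (hP : ∀ s, 0 ≤ P s) (h₁ : IsChannel W₁) (h₂ : IsChannel W₂) :
    (noiseInfo₁ P W₁ W₂ + equivoc₀ P - equivoc₁ P W₁ W₂, 0, equivoc₁ P W₁ W₂) ∈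
      rdRegion₂ P := by
  rw [mem_rdRegion₂_iff hP]
  have := semicorner_mem_rdRegion₁ (P := swapLaw P) (fun s => hP _) h₂ h₁
  rwa [noiseInfo₂_swap, equivoc₂_swap, equivoc₀_swap] at this

end Corners

/-! ### The polyhedron of the outer bound -/

section Polyhedral

/-- A corner of the outer bound is a mixture of single-letter corner points. -/
theorem exists_corner_mem {S : Set (ℝ × ℝ × ℝ)} (hS : Convex ℝ S) (hU : IsUpperSet S)
    {a₁ a₂ h₀ h₂ h₁₂ D : ℝ} (ha₁ : 0 ≤ a₁) (ha₂ : 0 ≤ a₂) (hD : D < h₀) (hD' : h₁₂ ≤ D)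
    (hA : (a₁ + h₂ - h₁₂, a₂ + h₀ - h₂, h₁₂) ∈ S) (hB : (0, a₂ + h₀ - h₂, h₂) ∈ S)
    (hC : (0, 0, h₀) ∈ S) :
    (a₁ + max 0 (h₂ - D), a₂ + h₀ - D - max 0 (h₂ - D), D) ∈ S := by
  -- If `D` lies between `h₂` and `h₀`, the semicorner is mixed with the origin point; if it lies
  -- between `h₁₂` and `h₂`, the corner is mixed with the semicorner. In both cases the weight `l`
  -- makes the third coordinate equal to `D`.
  rcases le_or_gt h₂ D with h | h
  · have hpos : 0 < h₀ - h₂ := by linarith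
    set l := (h₀ - D) / (h₀ - h₂) with hl
    have hl0 : 0 ≤ l := div_nonneg (by linarith) hpos.le
    have hl1 : l ≤ 1 := (div_le_one hpos).2 (by linarith)
    have hmul : l * (h₀ - h₂) = h₀ - D := div_mul_cancel₀ _ hpos.ne'
    refine hU ?_ (hS hB hC hl0 (sub_nonneg.2 hl1) (by ring))
    rw [max_eq_left (by linarith)]
    refine ⟨?_, ?_, ?_⟩ <;> simp
    · exact ha₁
    · nlinarith
    · nlinarith
  · have hpos : 0 < h₂ - h₁₂ := by linarith
    set l := (h₂ - D) / (h₂ - h₁₂) with hl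
    have hl0 : 0 ≤ l := div_nonneg (by linarith) hpos.le
    have hl1 : l ≤ 1 := (div_le_one hpos).2 (by linarith)
    have hmul : l * (h₂ - h₁₂) = h₂ - D := div_mul_cancel₀ _ hpos.ne'
    refine hU ?_ (hS hA hB hl0 (sub_nonneg.2 hl1) (by ring))
    rw [max_eq_right (by linarith)]
    refine ⟨?_, ?_, ?_⟩ <;> simp
    · nlinarith
    · nlinarith
    · nlinarith

theorem convex_swapRates {S : Set (ℝ × ℝ × ℝ)} (hS : Convex ℝ S) :
    Convex ℝ (swapRates ⁻¹' S) := by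
  intro x hx y hy a b ha hb hab
  exact hS hx hy ha hb hab

theorem isUpperSet_swapRates {S : Set (ℝ × ℝ × ℝ)} (hS : IsUpperSet S) :
    IsUpperSet (swapRates ⁻¹' S) := by
  intro x y hxy hx
  exact hS (show swapRates x ≤ swapRates y from ⟨hxy.2.1, hxy.1, hxy.2.2⟩) hx

/-- The outer bound is contained in every convex upper set which contains the corner points. -/
theorem mem_of_outer_bound {S : Set (ℝ × ℝ × ℝ)} (hS : Convex ℝ S) (hU : IsUpperSet S)
    {a₁ a₂ h₀ h₁ h₂ h₁₂ R₁ R₂ D : ℝ} (ha₁ : 0 ≤ a₁) (ha₂ : 0 ≤ a₂)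
    (hA : (a₁ + h₂ - h₁₂, a₂ + h₀ - h₂, h₁₂) ∈ S) (hB : (0, a₂ + h₀ - h₂, h₂) ∈ S)
    (hA' : (a₁ + h₀ - h₁, a₂ + h₁ - h₁₂, h₁₂) ∈ S) (hB' : (a₁ + h₀ - h₁, 0, h₁) ∈ S)
    (hC : (0, 0, h₀) ∈ S) (b₁ : a₁ ≤ R₁) (b₂ : a₂ ≤ R₂) (c₁ : a₁ + h₂ - D ≤ R₁)
    (c₂ : a₂ + h₁ - D ≤ R₂) (c₁₂ : a₁ + a₂ + h₀ - D ≤ R₁ + R₂) (hD : h₁₂ ≤ D) :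
    (R₁, R₂, D) ∈ S := by
  rcases le_or_gt h₀ D with h | h
  · exact hU (show (0, 0, h₀) ≤ (R₁, R₂, D) from ⟨ha₁.trans b₁, ha₂.trans b₂, h⟩) hC
  have E1 := exists_corner_mem hS hU ha₁ ha₂ h hD hA hB hC
  have E2 := exists_corner_mem (convex_swapRates hS) (isUpperSet_swapRates hU) ha₂ ha₁ h hD
    hA' hB' hC
  change (a₁ + h₀ - D - max 0 (h₁ - D), a₂ + max 0 (h₁ - D), D) ∈ S at E2
  have f₁ : a₁ + max 0 (h₂ - D) ≤ R₁ := by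
    rw [← le_sub_iff_add_le']
    exact max_le (by linarith) (by linarith)
  have f₂ : a₂ + max 0 (h₁ - D) ≤ R₂ := by
    rw [← le_sub_iff_add_le']
    exact max_le (by linarith) (by linarith)
  set k₂ := max 0 (h₂ - D)
  set k₁ := max 0 (h₁ - D)
  -- `E1` and `E2` are the ends of the segment on which the sum rate is `a₁ + a₂ + h₀ - D`. Either
  -- `E2` is dominated by the target, or a mixture of the two has first coordinate exactly `R₁`, and
  -- the bound on `R₁ + R₂` controls the second coordinate.
  rcases le_or_gt (a₁ + h₀ - D - k₁) R₁ with g | g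
  · exact hU (show (a₁ + h₀ - D - k₁, a₂ + k₁, D) ≤ (R₁, R₂, D) from ⟨g, f₂, le_rfl⟩) E2
  · have hpos : 0 < (a₁ + h₀ - D - k₁) - (a₁ + k₂) := by linarith
    set l := (R₁ - (a₁ + k₂)) / ((a₁ + h₀ - D - k₁) - (a₁ + k₂)) with hl
    have hl0 : 0 ≤ l := div_nonneg (by linarith) hpos.le
    have hl1 : l ≤ 1 := (div_le_one hpos).2 (by linarith)
    have hmul : l * ((a₁ + h₀ - D - k₁) - (a₁ + k₂)) = R₁ - (a₁ + k₂) :=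
      div_mul_cancel₀ _ hpos.ne'
    refine hU ?_ (hS E1 E2 (sub_nonneg.2 hl1) hl0 (by ring))
    refine ⟨?_, ?_, ?_⟩ <;> simp <;> nlinarith

/-- The same with the quantities averaged over a time-sharing variable. -/
theorem mem_of_averaged_outer_bound {J : Type*} [Fintype J] {S : Set (ℝ × ℝ × ℝ)}
    (hS : Convex ℝ S) (hU : IsUpperSet S) (w : J → ℝ) (hw : ∀ j, 0 ≤ w j) (hw1 : ∑ j, w j = 1)
    (a₁ a₂ h₁ h₂ h₁₂ : J → ℝ) {h₀ R₁ R₂ D : ℝ} (ha₁ : ∀ j, 0 ≤ a₁ j) (ha₂ : ∀ j, 0 ≤ a₂ j)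
    (hA : ∀ j, (a₁ j + h₂ j - h₁₂ j, a₂ j + h₀ - h₂ j, h₁₂ j) ∈ S)
    (hB : ∀ j, (0, a₂ j + h₀ - h₂ j, h₂ j) ∈ S)
    (hA' : ∀ j, (a₁ j + h₀ - h₁ j, a₂ j + h₁ j - h₁₂ j, h₁₂ j) ∈ S)
    (hB' : ∀ j, (a₁ j + h₀ - h₁ j, 0, h₁ j) ∈ S)
    (hC : (0, 0, h₀) ∈ S) (b₁ : ∑ j, w j * a₁ j ≤ R₁) (b₂ : ∑ j, w j * a₂ j ≤ R₂)
    (c₁ : ∑ j, w j * a₁ j + ∑ j, w j * h₂ j - D ≤ R₁)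
    (c₂ : ∑ j, w j * a₂ j + ∑ j, w j * h₁ j - D ≤ R₂)
    (c₁₂ : ∑ j, w j * a₁ j + ∑ j, w j * a₂ j + h₀ - D ≤ R₁ + R₂)
    (hD : ∑ j, w j * h₁₂ j ≤ D) : (R₁, R₂, D) ∈ S := by
  -- The corner points are averaged with the common weights before the polyhedral argument is
  -- applied; since `h₀` does not depend on `j`, the averages have the same shape as single corners.
  have avg : ∀ f : J → ℝ × ℝ × ℝ, (∀ j, f j ∈ S) →
      (∑ j, w j * (f j).1, ∑ j, w j * (f j).2.1, ∑ j, w j * (f j).2.2) ∈ S := by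
    intro f hf
    have := hS.sum_mem (t := Finset.univ) (fun j _ => hw j) hw1 (fun j _ => hf j)
    convert this using 1
    simp [Prod.ext_iff, Prod.fst_sum, Prod.snd_sum]
  have hh : ∑ j, w j * h₀ = h₀ := by rw [← Finset.sum_mul, hw1, one_mul]
  have gA := avg _ hA
  have gB := avg _ hB
  have gA' := avg _ hA'
  have gB' := avg _ hB'
  simp only [mul_sub, mul_add, Finset.sum_sub_distrib, Finset.sum_add_distrib, hh, mul_zero,
    Finset.sum_const_zero] at gA gB gA' gB'
  exact mem_of_outer_bound hS hU (Finset.sum_nonneg fun j _ => mul_nonneg (hw j) (ha₁ j))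
    (Finset.sum_nonneg fun j _ => mul_nonneg (hw j) (ha₂ j)) gA gB gA' gB' hC b₁ b₂ c₁ c₂ c₁₂ hD

end Polyhedral

/-! ### Product laws -/

section Product

variable {ι S : Type*} [Fintype ι] [Fintype S]

theorem sum_pi_prod [DecidableEq ι] {κ : ι → Type*} [∀ i, Fintype (κ i)] (f : ∀ i, κ i → ℝ) :
    ∑ s : (∀ i, κ i), ∏ i, f i (s i) = ∏ i, ∑ a, f i a := by
  rw [Finset.prod_univ_sum, Fintype.piFinset_univ]

/-- The law of independent copies. -/
def prodLaw (ι : Type*) [Fintype ι] (P : S → ℝ) (s : ι → S) : ℝ := ∏ i, P (s i)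

theorem prodLaw_nonneg {P : S → ℝ} (hP : ∀ a, 0 ≤ P a) (s : ι → S) : 0 ≤ prodLaw ι P s :=
  Finset.prod_nonneg fun _ _ => hP _

theorem sum_prodLaw [DecidableEq ι] {P : S → ℝ} (hP : ∑ a, P a = 1) :
    ∑ s, prodLaw ι P s = 1 := by
  unfold prodLaw
  rw [sum_pi_prod (fun (_ : ι) a => P a)]
  simp [hP]

end Product

/-! ### One letter of a block and the other letters -/

section NLetter

variable {𝒳 𝒴₀ 𝒴₁ 𝒴₂ : Type*} [Fintype 𝒳] [Fintype 𝒴₀] [Fintype 𝒴₁] [Fintype 𝒴₂]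

/-- Insert the letter `y` at position `i` of a tuple indexed by the other positions. -/
def glue {n : ℕ} {𝒴 : Type*} (i : Fin n) (y : 𝒴) (b : {j // j ≠ i} → 𝒴) : Fin n → 𝒴 :=
  (Equiv.funSplitAt i 𝒴).symm (y, b)

theorem glue_self {n : ℕ} {𝒴 : Type*} (i : Fin n) (y : 𝒴) (b : {j // j ≠ i} → 𝒴) :
    glue i y b i = y := by
  simp [glue]

theorem glue_of_ne {n : ℕ} {𝒴 : Type*} (i : Fin n) (y : 𝒴) (b : {j // j ≠ i} → 𝒴)
    (j : {j // j ≠ i}) : glue i y b j = b j := by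
  simp [glue, j.2]

theorem comp_glue {n : ℕ} {𝒴 𝒵 : Type*} (i : Fin n) (y : 𝒴) (b : {j // j ≠ i} → 𝒴) (f : 𝒴 → 𝒵) :
    (fun j => f (glue i y b j)) = glue i (f y) (fun j => f (b j)) := by
  funext j
  by_cases h : j = i
  · subst h
    rw [glue_self, glue_self]
  · rw [glue_of_ne i y b ⟨j, h⟩, glue_of_ne i (f y) _ ⟨j, h⟩]

theorem sum_glue {n : ℕ} {𝒴 : Type*} [Fintype 𝒴] (i : Fin n) (f : (Fin n → 𝒴) → ℝ) :
    ∑ s, f s = ∑ y, ∑ b, f (glue i y b) := by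
  rw [← (Equiv.funSplitAt i 𝒴).symm.sum_comp, Fintype.sum_prod_type]
  rfl

theorem prodLaw_glue {n : ℕ} {𝒴 : Type*} [Fintype 𝒴] (i : Fin n) (P : 𝒴 → ℝ) (y : 𝒴)
    (b : {j // j ≠ i} → 𝒴) : prodLaw (Fin n) P (glue i y b) = P y * ∏ j, P (b j) := by
  unfold prodLaw
  rw [Fintype.prod_eq_mul_prod_subtype_ne _ i, glue_self]
  simp only [glue_of_ne]

/-- The channel from one letter to the message, when the other letters are drawn from their
conditional law given the remaining sources. -/
def blockChannel {n M : ℕ} {𝒴 𝒵 : Type*} [Fintype 𝒴] (V : 𝒵 → 𝒴 → ℝ) (φ : (Fin n → 𝒴) → Fin M)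
    (i : Fin n) (q : {j // j ≠ i} → 𝒵) (y : 𝒴) (u : Fin M) : ℝ :=
  ∑ b : {j // j ≠ i} → 𝒴, if φ (glue i y b) = u then ∏ j, V (q j) (b j) else 0

theorem isChannel_blockChannel {n M : ℕ} {𝒴 𝒵 : Type*} [Fintype 𝒴] {V : 𝒵 → 𝒴 → ℝ}
    (hV : ∀ z, V z ∈ stdSimplex ℝ 𝒴) (φ : (Fin n → 𝒴) → Fin M) (i : Fin n)
    (q : {j // j ≠ i} → 𝒵) : IsChannel (blockChannel V φ i q) := by
  intro y
  refine ⟨fun u => Finset.sum_nonneg fun b _ => ?_, ?_⟩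
  · split_ifs
    exacts [Finset.prod_nonneg fun j _ => (hV _).1 _, le_rfl]
  · unfold blockChannel
    rw [Finset.sum_comm]
    simp only [Finset.sum_ite_eq, Finset.mem_univ, if_true]
    rw [sum_pi_prod (fun j a => V (q j) a)]
    exact Finset.prod_eq_one fun j _ => (hV _).2

/-- The law of one letter together with the messages and the other source letters. -/
theorem law_letter_messages {n M₁ M₂ : ℕ} {P : 𝒳 × 𝒴₀ × 𝒴₁ × 𝒴₂ → ℝ} {P₀ : 𝒳 × 𝒴₀ → ℝ}
    {V₁ : 𝒳 × 𝒴₀ → 𝒴₁ → ℝ} {V₂ : 𝒳 × 𝒴₀ → 𝒴₂ → ℝ}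
    (hfac : ∀ x y₀ y₁ y₂, P (x, y₀, y₁, y₂) = P₀ (x, y₀) * V₁ (x, y₀) y₁ * V₂ (x, y₀) y₂)
    (φ₁ : (Fin n → 𝒴₁) → Fin M₁) (φ₂ : (Fin n → 𝒴₂) → Fin M₂) (i : Fin n)
    (v : 𝒳 × 𝒴₀ × 𝒴₁ × 𝒴₂ × Fin M₁ × Fin M₂) (q : {j // j ≠ i} → 𝒳 × 𝒴₀) :
    law (prodLaw (Fin n) P) (fun s => (((s i).1, (s i).2.1, (s i).2.2.1, (s i).2.2.2,
        φ₁ (fun j => (s j).2.2.1), φ₂ (fun j => (s j).2.2.2)),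
        fun j : {j // j ≠ i} => ((s j).1, (s j).2.1))) (v, q) =
      (∏ j, P₀ (q j)) * auxJoint P (blockChannel V₁ φ₁ i q) (blockChannel V₂ φ₂ i q) v := by
  classical
  obtain ⟨x, y₀, y₁, y₂, u₁, u₂⟩ := v
  have hfac' : ∀ s, P s = P₀ (s.1, s.2.1) * V₁ (s.1, s.2.1) s.2.2.1 * V₂ (s.1, s.2.1) s.2.2.2 :=
    fun s => hfac s.1 s.2.1 s.2.2.1 s.2.2.2
  unfold law
  -- The letter at position `i` is fixed by `v`, so only the other letters remain to be summed.
  rw [sum_glue i, Finset.sum_eq_single (x, y₀, y₁, y₂)]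
  rotate_left
  · rintro ⟨a, b, c, d⟩ - hne
    refine Finset.sum_eq_zero fun t _ => if_neg ?_
    intro h
    simp only [glue_self, Prod.mk.injEq] at h
    apply hne
    simp [h]
  · simp
  -- Separating the other letters into their `(X, Y₀)`, `Y₁` and `Y₂` parts. The first part is
  -- pinned to `q`, and the sums over the other two factor into the two block channels.
  let e : ({j // j ≠ i} → 𝒳 × 𝒴₀) × ({j // j ≠ i} → 𝒴₁) × ({j // j ≠ i} → 𝒴₂) ≃
      ({j // j ≠ i} → 𝒳 × 𝒴₀ × 𝒴₁ × 𝒴₂) :=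
    { toFun := fun t j => ((t.1 j).1, (t.1 j).2, t.2.1 j, t.2.2 j)
      invFun := fun t => (fun j => ((t j).1, (t j).2.1), fun j => (t j).2.2.1,
        fun j => (t j).2.2.2)
      left_inv := fun t => rfl
      right_inv := fun t => rfl }
  rw [← e.sum_comp, Fintype.sum_prod_type, Finset.sum_eq_single q]
  rotate_left
  · intro q' _ hq
    refine Finset.sum_eq_zero fun t _ => if_neg ?_
    intro h
    apply hq
    have := (Prod.mk.injEq .. ▸ h).2
    rw [← this]
    funext j
    rw [glue_of_ne]
    rfl
  · simp
  rw [Fintype.sum_prod_type]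
  simp only [auxJoint, blockChannel]
  rw [mul_assoc, Finset.sum_mul_sum, Finset.mul_sum, Finset.mul_sum]
  refine Finset.sum_congr rfl fun b _ => ?_
  rw [Finset.mul_sum, Finset.mul_sum]
  refine Finset.sum_congr rfl fun c _ => ?_
  have hq : (fun j : {j // j ≠ i} => ((glue i (x, y₀, y₁, y₂) (e (q, b, c)) j).1,
      (glue i (x, y₀, y₁, y₂) (e (q, b, c)) j).2.1)) = q := by
    funext j
    rw [glue_of_ne]
    rfl
  have hprod : ∏ j, P (e (q, b, c) j) =
      (∏ j, P₀ (q j)) * (∏ j, V₁ (q j) (b j)) * ∏ j, V₂ (q j) (c j) := by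
    rw [← Finset.prod_mul_distrib, ← Finset.prod_mul_distrib]
    exact Finset.prod_congr rfl fun j _ => hfac' _
  have h1 : (fun j => (glue i (x, y₀, y₁, y₂) (e (q, b, c)) j).2.2.1) = glue i y₁ b :=
    comp_glue i _ _ (fun s : 𝒳 × 𝒴₀ × 𝒴₁ × 𝒴₂ => s.2.2.1)
  have h2 : (fun j => (glue i (x, y₀, y₁, y₂) (e (q, b, c)) j).2.2.2) = glue i y₂ c :=
    comp_glue i _ _ (fun s : 𝒳 × 𝒴₀ × 𝒴₁ × 𝒴₂ => s.2.2.2)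
  refine (if_congr (Q := φ₁ (glue i y₁ b) = u₁ ∧ φ₂ (glue i y₂ c) = u₂) ?_ rfl rfl).trans ?_
  · simp only [h1, h2, hq, glue_self, Prod.mk.injEq, true_and, and_true]
  rw [prodLaw_glue, hprod]
  by_cases h1 : φ₁ (glue i y₁ b) = u₁ <;> by_cases h2 : φ₂ (glue i y₂ c) = u₂ <;> simp [h1, h2]
  ring

/-- One letter is independent of the others. -/
theorem law_letter_rest {n : ℕ} {S : Type*} [Fintype S] (P : S → ℝ) (i : Fin n) (v : S)
    (q : {j // j ≠ i} → S) :
    law (prodLaw (Fin n) P) (fun s => (s i, fun j : {j // j ≠ i} => s j)) (v, q) =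
      (∏ j, P (q j)) * P v := by
  have := law_of_injective (prodLaw (Fin n) P) (F := fun s => (s i, fun j : {j // j ≠ i} => s j))
    (Equiv.funSplitAt i S).injective (glue i v q)
  simp only [glue_self, glue_of_ne] at this
  rw [this, prodLaw_glue, mul_comm]

/-- A Markov source factorizes. -/
theorem IsMarkov.exists_factorization {P : 𝒳 × 𝒴₀ × 𝒴₁ × 𝒴₂ → ℝ} [Nonempty 𝒴₁] [Nonempty 𝒴₂]
    (hM : IsMarkov P) (hP : ∀ s, 0 ≤ P s) :
    ∃ (P₀ : 𝒳 × 𝒴₀ → ℝ) (V₁ : 𝒳 × 𝒴₀ → 𝒴₁ → ℝ) (V₂ : 𝒳 × 𝒴₀ → 𝒴₂ → ℝ), (∀ z, 0 ≤ P₀ z) ∧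
      (∑ z, P₀ z = ∑ s, P s) ∧ (∀ z, V₁ z ∈ stdSimplex ℝ 𝒴₁) ∧ (∀ z, V₂ z ∈ stdSimplex ℝ 𝒴₂) ∧
      ∀ x y₀ y₁ y₂, P (x, y₀, y₁, y₂) = P₀ (x, y₀) * V₁ (x, y₀) y₁ * V₂ (x, y₀) y₂ := by
  classical
  have c1 : (0 : ℝ) < Fintype.card 𝒴₁ := by exact_mod_cast Fintype.card_pos
  have c2 : (0 : ℝ) < Fintype.card 𝒴₂ := by exact_mod_cast Fintype.card_pos
  set P₀ : 𝒳 × 𝒴₀ → ℝ := fun z => ∑ b₁, ∑ b₂, P (z.1, z.2, b₁, b₂) with hP₀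
  have hP₀' : ∀ z, 0 ≤ P₀ z := fun z =>
    Finset.sum_nonneg fun _ _ => Finset.sum_nonneg fun _ _ => hP _
  -- On null values of `(X, Y₀)` the conditional law is set to uniform, so that `V₁` and `V₂` are
  -- pmfs everywhere.
  refine ⟨P₀, fun z y₁ => if P₀ z = 0 then (Fintype.card 𝒴₁ : ℝ)⁻¹ else
      (∑ b₂, P (z.1, z.2, y₁, b₂)) / P₀ z,
    fun z y₂ => if P₀ z = 0 then (Fintype.card 𝒴₂ : ℝ)⁻¹ else
      (∑ b₁, P (z.1, z.2, b₁, y₂)) / P₀ z, hP₀', ?_, ?_, ?_, ?_⟩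
  · simp only [hP₀, Fintype.sum_prod_type]
  · intro z
    refine ⟨fun y => ?_, ?_⟩
    · dsimp only
      split_ifs
      · positivity
      · exact div_nonneg (Finset.sum_nonneg fun _ _ => hP _) (hP₀' z)
    · by_cases h : P₀ z = 0
      · simp [h]
      · simp only [h, if_false]
        rw [← Finset.sum_div, div_eq_one_iff_eq h]
  · intro z
    refine ⟨fun y => ?_, ?_⟩
    · dsimp only
      split_ifs
      · positivity
      · exact div_nonneg (Finset.sum_nonneg fun _ _ => hP _) (hP₀' z)
    · by_cases h : P₀ z = 0
      · simp [h]
      · simp only [h, if_false]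
        rw [← Finset.sum_div, div_eq_one_iff_eq h, Finset.sum_comm]
  · intro x y₀ y₁ y₂
    by_cases h : P₀ (x, y₀) = 0
    · rw [h, zero_mul, zero_mul]
      have h1 := (Finset.sum_eq_zero_iff_of_nonneg
        (fun b₁ _ => Finset.sum_nonneg fun b₂ _ => hP (x, y₀, b₁, b₂))).1 h y₁ (Finset.mem_univ _)
      exact (Finset.sum_eq_zero_iff_of_nonneg (fun b₂ _ => hP (x, y₀, y₁, b₂))).1 h1 y₂
        (Finset.mem_univ _)
    · simp only [h, if_false]
      have := hM x y₀ y₁ y₂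
      change _ * P₀ (x, y₀) = _ at this
      field_simp
      linarith

/-- Given `(X, Y₀)`, the observation `Y₁` is independent of `Y₂`. -/
theorem cent_markov {P : 𝒳 × 𝒴₀ × 𝒴₁ × 𝒴₂ → ℝ} (hM : IsMarkov P) (hP : ∀ s, 0 ≤ P s) :
    cent P (fun v => v.2.2.1) (fun v => (v.2.2.2, v.1, v.2.1)) =
      cent P (fun v => v.2.2.1) (fun v => (v.1, v.2.1)) := by
  classical
  refine cent_pair_eq_of_indep hP _ _ _ ?_
  rintro ⟨x, y₀, y₁, y₂⟩ -
  have e1 := law_of_injective P (F := fun v => (v.2.2.1, v.2.2.2, v.1, v.2.1)) (by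
      rintro ⟨a, b, c, d⟩ ⟨a', b', c', d'⟩ h
      simp only [Prod.mk.injEq] at h ⊢
      tauto) (x, y₀, y₁, y₂)
  have e2 : law P (fun v => (v.1, v.2.1)) (x, y₀) = ∑ b₁ : 𝒴₁, ∑ b₂ : 𝒴₂, P (x, y₀, b₁, b₂) := by
    unfold law
    simp only [Fintype.sum_prod_type, Prod.mk.injEq]
    rw [Finset.sum_eq_single x (by intro b _ hb; simp [hb]) (by simp),
      Finset.sum_eq_single y₀ (by intro b _ hb; simp [hb]) (by simp)]
    simp
  have e3 : law P (fun v => (v.2.2.1, v.1, v.2.1)) (y₁, x, y₀) = ∑ b₂ : 𝒴₂, P (x, y₀, y₁, b₂) := by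
    unfold law
    simp only [Fintype.sum_prod_type, Prod.mk.injEq]
    rw [Finset.sum_eq_single x (by intro b _ hb; simp [hb]) (by simp),
      Finset.sum_eq_single y₀ (by intro b _ hb; simp [hb]) (by simp),
      Finset.sum_eq_single y₁ (by intro b _ hb; simp [hb]) (by simp)]
    simp
  have e4 : law P (fun v => (v.2.2.2, v.1, v.2.1)) (y₂, x, y₀) = ∑ b₁ : 𝒴₁, P (x, y₀, b₁, y₂) := by
    unfold law
    simp only [Fintype.sum_prod_type, Prod.mk.injEq]
    rw [Finset.sum_eq_single x (by intro b _ hb; simp [hb]) (by simp),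
      Finset.sum_eq_single y₀ (by intro b _ hb; simp [hb]) (by simp)]
    refine Finset.sum_congr rfl fun b _ => ?_
    rw [Finset.sum_eq_single y₂ (by intro b _ hb; simp [hb]) (by simp)]
    simp
  dsimp only at e1 e2 e3 e4 ⊢
  rw [e1, e2, e3, e4]
  exact hM x y₀ y₁ y₂

theorem IsMarkov.swap {P : 𝒳 × 𝒴₀ × 𝒴₁ × 𝒴₂ → ℝ} (hM : IsMarkov P) : IsMarkov (swapLaw P) := by
  intro x y₀ y₂ y₁
  have := hM x y₀ y₁ y₂
  simp only [swapLaw]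
  rw [Finset.sum_comm, this, mul_comm]

end NLetter

theorem cent_congr_right {Ω α β γ : Type*} [Fintype Ω] (p : Ω → ℝ) (f : Ω → α) {g : Ω → β}
    {h : Ω → γ} (hgh : ∀ ω ω', g ω = g ω' ↔ h ω = h ω') : cent p f g = cent p f h :=
  cent_congr p (fun ω ω' => and_congr_right fun _ => hgh ω ω') hgh

theorem forall_iff_of_ne {ι : Type*} (i : ι) (p : ι → Prop) :
    (∀ j, p j) ↔ p i ∧ ∀ j : {j // j ≠ i}, p j := by
  refine ⟨fun h => ⟨h i, fun j => h j⟩, fun h j => ?_⟩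
  by_cases hj : j = i
  · exact hj ▸ h.1
  · exact h.2 ⟨j, hj⟩

/-! ### The converse: single-letterization of a code -/

section Converse

variable {𝒳 𝒴₀ 𝒴₁ 𝒴₂ : Type*} [Fintype 𝒳] [Fintype 𝒴₀] [Fintype 𝒴₁] [Fintype 𝒴₂] {n M₁ M₂ : ℕ}
  {P : 𝒳 × 𝒴₀ × 𝒴₁ × 𝒴₂ → ℝ}

theorem cent_letter_rest (hP : ∀ s, 0 ≤ P s) (hP1 : ∑ s, P s = 1) {α β : Type*} [Fintype α]
    [Fintype β] (f : 𝒳 × 𝒴₀ × 𝒴₁ × 𝒴₂ → α) (g : 𝒳 × 𝒴₀ × 𝒴₁ × 𝒴₂ → β) (i : Fin n) :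
    cent (prodLaw (Fin n) P) (fun s => f (s i))
      (fun s => (g (s i), fun j : {j // j ≠ i} => s j)) = cent P f g := by
  rw [← condEntropy_eq_cent (prodLaw_nonneg hP), condEntropy_mixture _ _ _ _ (fun _ => P)
    (law_letter_rest P i), ← Finset.sum_mul, condEntropy_eq_cent hP]
  have := sum_prodLaw (ι := {j // j ≠ i}) hP1
  unfold prodLaw at this
  rw [this, one_mul]

/-- The part of the first message that describes the observation noise. -/
theorem sum_noise_le_cent (hP : ∀ s, 0 ≤ P s) (hP1 : ∑ s, P s = 1) (hM : IsMarkov P)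
    (φ₁ : (Fin n → 𝒴₁) → Fin M₁) :
    ∑ i, (cent P (fun v => v.2.2.1) (fun v => (v.1, v.2.1)) -
      cent (prodLaw (Fin n) P) (fun s => (s i).2.2.1)
        (fun s => (φ₁ (fun j => (s j).2.2.1), fun j => ((s j).1, (s j).2.1)))) ≤
    cent (prodLaw (Fin n) P) (fun s => φ₁ (fun j => (s j).2.2.1))
      (fun s => (fun j => (s j).2.2.2, fun j => ((s j).1, (s j).2.1))) := by
  have hp := prodLaw_nonneg (ι := Fin n) hP
  set p := prodLaw (Fin n) P
  -- The message is a function of the block of `Y₁`, so its conditional entropy equals the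
  -- information it carries about that block given all of `Y₂`, `X`, `Y₀`.
  have e := cent_swap p (fun s j => (s j).2.2.1) (fun s => φ₁ (fun j => (s j).2.2.1))
    (fun s => (fun j => (s j).2.2.2, fun j => ((s j).1, (s j).2.1)))
  rw [cent_eq_zero_of_determines p (fun s => φ₁ (fun j => (s j).2.2.1))
    (fun s => (fun j => (s j).2.2.1, fun j => (s j).2.2.2, fun j => ((s j).1, (s j).2.1))),
    add_zero] at e
  rotate_left
  · intro ω ω' h
    exact congrArg φ₁ (Prod.mk.inj h).1
  have l := sum_cent_le_cent_tuple hp (fun s j => (s j).2.2.1)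
    (fun s => (fun j => (s j).2.2.2, fun j => ((s j).1, (s j).2.1)))
  have u := cent_tuple_le hp (fun s j => (s j).2.2.1) (fun s => (φ₁ (fun j => (s j).2.2.1),
    (fun j => (s j).2.2.2, fun j => ((s j).1, (s j).2.1))))
  have u' : ∀ i : Fin n, cent p (fun s => (s i).2.2.1) (fun s => (φ₁ (fun j => (s j).2.2.1),
      (fun j => (s j).2.2.2, fun j => ((s j).1, (s j).2.1)))) ≤
      cent p (fun s => (s i).2.2.1)
        (fun s => (φ₁ (fun j => (s j).2.2.1), fun j => ((s j).1, (s j).2.1))) := by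
    intro i
    refine cent_le_of_determines hp _ _ _ ?_
    intro ω ω' h
    simp only [Prod.mk.injEq] at h ⊢
    exact ⟨h.1, h.2.2⟩
  -- By independence across positions and the Markov property, a letter of `Y₁` given all the other
  -- data depends only on its own `(X, Y₀)`; the lower bound on the block entropy is thus a sum of
  -- single-letter entropies.
  have l' : ∀ i : Fin n, cent p (fun s => (s i).2.2.1)
      (fun s => (fun j : {j // j ≠ i} => (s j).2.2.1,
        (fun j => (s j).2.2.2, fun j => ((s j).1, (s j).2.1)))) =
      cent P (fun v => v.2.2.1) (fun v => (v.1, v.2.1)) := by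
    intro i
    rw [← cent_markov hM hP, ← cent_letter_rest hP hP1 _ _ i]
    refine cent_congr_right p _ ?_
    intro ω ω'
    simp only [funext_iff, Prod.ext_iff]
    rw [forall_iff_of_ne i (fun j => (ω j).2.2.2 = (ω' j).2.2.2),
      forall_iff_of_ne i (fun j => (ω j).1 = (ω' j).1 ∧ (ω j).2.1 = (ω' j).2.1)]
    simp only [forall_and]
    tauto
  rw [Finset.sum_sub_distrib]
  have h1 := Finset.sum_le_sum fun i (_ : i ∈ Finset.univ) => u' i
  simp only [l'] at l
  linarith

theorem law_prodLaw_swap :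
    law (prodLaw (Fin n) P) (fun s j => ((s j).1, (s j).2.1, (s j).2.2.2, (s j).2.2.1)) =
      prodLaw (Fin n) (swapLaw P) := by
  funext s
  refine (law_of_injective _ ?_ (fun j => ((s j).1, (s j).2.1, (s j).2.2.2, (s j).2.2.1))).trans rfl
  intro ω ω' h
  funext j
  have := congrFun h j
  simp only [Prod.ext_iff] at this ⊢
  tauto

theorem sum_noise_le_cent' (hP : ∀ s, 0 ≤ P s) (hP1 : ∑ s, P s = 1) (hM : IsMarkov P)
    (φ₂ : (Fin n → 𝒴₂) → Fin M₂) :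
    ∑ i, (cent P (fun v => v.2.2.2) (fun v => (v.1, v.2.1)) -
      cent (prodLaw (Fin n) P) (fun s => (s i).2.2.2)
        (fun s => (φ₂ (fun j => (s j).2.2.2), fun j => ((s j).1, (s j).2.1)))) ≤
    cent (prodLaw (Fin n) P) (fun s => φ₂ (fun j => (s j).2.2.2))
      (fun s => (fun j => (s j).2.2.1, fun j => ((s j).1, (s j).2.1))) := by
  have hs1 : ∑ s, swapLaw P s = 1 := by
    rw [← law_swap, sum_law, hP1]
  have := sum_noise_le_cent (n := n) (P := swapLaw P) (fun s => hP _) hs1 hM.swap φ₂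
  simp only [← law_prodLaw_swap, ← cent_map] at this
  rwa [← law_swap, ← cent_map] at this

/-- The variable `q`, the values of `(X, Y₀)` off position `i`, acts as a time-sharing variable:
conditioned on it, the messages are the auxiliaries produced by the block channels. The conditioning
variable `h` may have any form that generates the same partition as `g` together with `q`. -/
theorem cent_letter_messages (hP : ∀ s, 0 ≤ P s) {P₀ : 𝒳 × 𝒴₀ → ℝ}
    {V₁ : 𝒳 × 𝒴₀ → 𝒴₁ → ℝ} {V₂ : 𝒳 × 𝒴₀ → 𝒴₂ → ℝ}
    (hV₁ : ∀ z, V₁ z ∈ stdSimplex ℝ 𝒴₁) (hV₂ : ∀ z, V₂ z ∈ stdSimplex ℝ 𝒴₂)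
    (hfac : ∀ x y₀ y₁ y₂, P (x, y₀, y₁, y₂) = P₀ (x, y₀) * V₁ (x, y₀) y₁ * V₂ (x, y₀) y₂)
    (φ₁ : (Fin n → 𝒴₁) → Fin M₁) (φ₂ : (Fin n → 𝒴₂) → Fin M₂) (i : Fin n) {α β γ : Type*}
    [Fintype α] [Fintype β] (f : 𝒳 × 𝒴₀ × 𝒴₁ × 𝒴₂ × Fin M₁ × Fin M₂ → α)
    (g : 𝒳 × 𝒴₀ × 𝒴₁ × 𝒴₂ × Fin M₁ × Fin M₂ → β) (h : (Fin n → 𝒳 × 𝒴₀ × 𝒴₁ × 𝒴₂) → γ)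
    (hh : ∀ s s', h s = h s' ↔
      ((g ((s i).1, (s i).2.1, (s i).2.2.1, (s i).2.2.2,
        φ₁ (fun j => (s j).2.2.1), φ₂ (fun j => (s j).2.2.2)) =
      g ((s' i).1, (s' i).2.1, (s' i).2.2.1, (s' i).2.2.2,
        φ₁ (fun j => (s' j).2.2.1), φ₂ (fun j => (s' j).2.2.2))) ∧
      ∀ j : {j // j ≠ i}, (s j).1 = (s' j).1 ∧ (s j).2.1 = (s' j).2.1)) :
    cent (prodLaw (Fin n) P) (fun s => f ((s i).1, (s i).2.1, (s i).2.2.1, (s i).2.2.2,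
        φ₁ (fun j => (s j).2.2.1), φ₂ (fun j => (s j).2.2.2))) h =
      ∑ q : {j // j ≠ i} → 𝒳 × 𝒴₀, (∏ j, P₀ (q j)) *
        cent (auxJoint P (blockChannel V₁ φ₁ i q) (blockChannel V₂ φ₂ i q)) f g := by
  have := condEntropy_mixture _ _ _ _ _ (law_letter_messages hfac φ₁ φ₂ i) f g
  rw [condEntropy_eq_cent (prodLaw_nonneg hP)] at this
  simp only [condEntropy_eq_cent (auxJoint_nonneg hP
    (isChannel_blockChannel hV₁ φ₁ i _) (isChannel_blockChannel hV₂ φ₂ i _))] at this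
  rw [← this]
  refine cent_congr_right _ _ fun s s' => ?_
  rw [hh s s']
  simp only [Prod.mk.injEq, funext_iff]

/-- Single-letterization: a code whose messages leave a small equivocation has its rates and
distortion in every convex upper set that contains the two single-letter regions. -/
theorem mem_of_code {S : Set (ℝ × ℝ × ℝ)} (hS : Convex ℝ S) (hU : IsUpperSet S)
    (hS₁ : rdRegion₁ P ⊆ S) (hS₂ : rdRegion₂ P ⊆ S)
    (hP : ∀ s, 0 ≤ P s) (hP1 : ∑ s, P s = 1) (hM : IsMarkov P) (hn : 0 < n)
    (φ₁ : (Fin n → 𝒴₁) → Fin M₁) (φ₂ : (Fin n → 𝒴₂) → Fin M₂) {R₁ R₂ D : ℝ}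
    (hR₁ : Real.log M₁ / n ≤ R₁) (hR₂ : Real.log M₂ / n ≤ R₂)
    (hD : ∑ i, cent (prodLaw (Fin n) P) (fun s => (s i).1)
      (fun s => ((φ₁ (fun j => (s j).2.2.1), φ₂ (fun j => (s j).2.2.2)), fun j => (s j).2.1)) ≤
      n * D) : (R₁, R₂, D) ∈ S := by
  have hne : Nonempty (𝒳 × 𝒴₀ × 𝒴₁ × 𝒴₂) := by
    by_contra h
    rw [not_nonempty_iff] at h
    simp at hP1
  obtain ⟨x', y₀', y₁', y₂'⟩ := hne
  have : Nonempty 𝒴₁ := ⟨y₁'⟩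
  have : Nonempty 𝒴₂ := ⟨y₂'⟩
  have : Nonempty (Fin M₁) := ⟨φ₁ fun _ => y₁'⟩
  have : Nonempty (Fin M₂) := ⟨φ₂ fun _ => y₂'⟩
  have hn' : (0 : ℝ) < n := by exact_mod_cast hn
  obtain ⟨P₀, V₁, V₂, hP₀, hP₀1, hV₁, hV₂, hfac⟩ := hM.exists_factorization hP
  rw [hP1] at hP₀1
  have hp := prodLaw_nonneg (ι := Fin n) hP
  have hp1 := sum_prodLaw (ι := Fin n) hP1
  have c₁ := fun (i : Fin n) (q : {j // j ≠ i} → 𝒳 × 𝒴₀) => isChannel_blockChannel hV₁ φ₁ i q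
  have c₂ := fun (i : Fin n) (q : {j // j ≠ i} → 𝒳 × 𝒴₀) => isChannel_blockChannel hV₂ φ₂ i q
  have hw : ∀ i : Fin n, ∑ q : {j // j ≠ i} → 𝒳 × 𝒴₀, ∏ j, P₀ (q j) = 1 := fun i =>
    sum_prodLaw (ι := {j // j ≠ i}) hP₀1
  set p := prodLaw (Fin n) P with hpdef
  let m₁ : (Fin n → 𝒳 × 𝒴₀ × 𝒴₁ × 𝒴₂) → Fin M₁ := fun s => φ₁ (fun j => (s j).2.2.1)
  let m₂ : (Fin n → 𝒳 × 𝒴₀ × 𝒴₁ × 𝒴₂) → Fin M₂ := fun s => φ₂ (fun j => (s j).2.2.2)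
  let X : (Fin n → 𝒳 × 𝒴₀ × 𝒴₁ × 𝒴₂) → Fin n → 𝒳 := fun s j => (s j).1
  let Y : (Fin n → 𝒳 × 𝒴₀ × 𝒴₁ × 𝒴₂) → Fin n → 𝒴₀ := fun s j => (s j).2.1
  let G : (Fin n → 𝒳 × 𝒴₀ × 𝒴₁ × 𝒴₂) → Fin n → 𝒳 × 𝒴₀ := fun s j => ((s j).1, (s j).2.1)
  have hE : cent p X (fun s => ((m₁ s, m₂ s), Y s)) ≤ n * D :=
    (cent_tuple_le hp X (fun s => ((m₁ s, m₂ s), Y s))).trans hD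
  have K₁ := sum_noise_le_cent (n := n) hP hP1 hM φ₁
  have K₂ := sum_noise_le_cent' (n := n) hP hP1 hM φ₂
  have A₁ : ∀ i, cent P (fun v => v.2.2.1) (fun v => (v.1, v.2.1)) -
      cent p (fun s => (s i).2.2.1) (fun s => (m₁ s, G s)) =
      ∑ q : {j // j ≠ i} → 𝒳 × 𝒴₀, (∏ j, P₀ (q j)) *
        noiseInfo₁ P (blockChannel V₁ φ₁ i q) (blockChannel V₂ φ₂ i q) := by
    intro i
    have e : ∀ q : {j // j ≠ i} → 𝒳 × 𝒴₀,
        cent (auxJoint P (blockChannel V₁ φ₁ i q) (blockChannel V₂ φ₂ i q))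
          (fun v => v.2.2.1) (fun v => (v.1, v.2.1)) =
        cent P (fun v => v.2.2.1) (fun v => (v.1, v.2.1)) := fun q =>
      cent_source (P := P) (c₁ i q) (c₂ i q) (fun v => v.2.2.1) (fun v => (v.1, v.2.1))
    simp only [noiseInfo₁, e, mul_sub, Finset.sum_sub_distrib, ← Finset.sum_mul, hw, one_mul]
    rw [← cent_letter_messages hP hV₁ hV₂ hfac φ₁ φ₂ i (fun v => v.2.2.1) (fun v => (v.2.2.2.2.1, v.1, v.2.1)) (fun s => (m₁ s, G s))]
    intro s s'
    simp only [Prod.mk.injEq, G, funext_iff]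
    rw [forall_iff_of_ne i (fun j => (s j).1 = (s' j).1 ∧ (s j).2.1 = (s' j).2.1)]
    tauto
  have A₂ : ∀ i, cent P (fun v => v.2.2.2) (fun v => (v.1, v.2.1)) -
      cent p (fun s => (s i).2.2.2) (fun s => (m₂ s, G s)) =
      ∑ q : {j // j ≠ i} → 𝒳 × 𝒴₀, (∏ j, P₀ (q j)) *
        noiseInfo₂ P (blockChannel V₁ φ₁ i q) (blockChannel V₂ φ₂ i q) := by
    intro i
    have e : ∀ q : {j // j ≠ i} → 𝒳 × 𝒴₀,
        cent (auxJoint P (blockChannel V₁ φ₁ i q) (blockChannel V₂ φ₂ i q))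
          (fun v => v.2.2.2.1) (fun v => (v.1, v.2.1)) =
        cent P (fun v => v.2.2.2) (fun v => (v.1, v.2.1)) := fun q =>
      cent_source (P := P) (c₁ i q) (c₂ i q) (fun v => v.2.2.2) (fun v => (v.1, v.2.1))
    simp only [noiseInfo₂, e, mul_sub, Finset.sum_sub_distrib, ← Finset.sum_mul, hw, one_mul]
    rw [← cent_letter_messages hP hV₁ hV₂ hfac φ₁ φ₂ i (fun v => v.2.2.2.1) (fun v => (v.2.2.2.2.2, v.1, v.2.1)) (fun s => (m₂ s, G s))]
    intro s s'
    simp only [Prod.mk.injEq, G, funext_iff]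
    rw [forall_iff_of_ne i (fun j => (s j).1 = (s' j).1 ∧ (s j).2.1 = (s' j).2.1)]
    tauto
  -- The block equivocation is bounded below by conditioning each `X i` on all other entries of `X`
  -- as well, which is exactly the conditioning on `q` built into the averaged quantities.
  have B₁₂ : ∑ i, ∑ q : {j // j ≠ i} → 𝒳 × 𝒴₀, (∏ j, P₀ (q j)) *
      equivoc₁₂ P (blockChannel V₁ φ₁ i q) (blockChannel V₂ φ₂ i q) ≤
      cent p X (fun s => ((m₁ s, m₂ s), Y s)) := by
    refine le_trans (Finset.sum_le_sum fun i _ => le_of_eq ?_) (sum_cent_le_cent_tuple hp X _)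
    unfold equivoc₁₂
    rw [← cent_letter_messages hP hV₁ hV₂ hfac φ₁ φ₂ i (fun v => v.1) (fun v => (v.2.2.2.2.1, v.2.2.2.2.2, v.2.1))
      (fun s => (fun j : {j // j ≠ i} => X s j, (m₁ s, m₂ s), Y s))]
    intro s s'
    simp only [Prod.mk.injEq, X, Y, funext_iff]
    rw [forall_iff_of_ne i (fun j => (s j).2.1 = (s' j).2.1)]
    simp only [forall_and]
    tauto
  have B₁ : ∑ i, ∑ q : {j // j ≠ i} → 𝒳 × 𝒴₀, (∏ j, P₀ (q j)) *
      equivoc₁ P (blockChannel V₁ φ₁ i q) (blockChannel V₂ φ₂ i q) ≤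
      cent p X (fun s => (m₁ s, Y s)) := by
    refine le_trans (Finset.sum_le_sum fun i _ => le_of_eq ?_) (sum_cent_le_cent_tuple hp X _)
    unfold equivoc₁
    rw [← cent_letter_messages hP hV₁ hV₂ hfac φ₁ φ₂ i (fun v => v.1) (fun v => (v.2.2.2.2.1, v.2.1))
      (fun s => (fun j : {j // j ≠ i} => X s j, m₁ s, Y s))]
    intro s s'
    simp only [Prod.mk.injEq, X, Y, funext_iff]
    rw [forall_iff_of_ne i (fun j => (s j).2.1 = (s' j).2.1)]
    simp only [forall_and]
    tauto
  have B₂ : ∑ i, ∑ q : {j // j ≠ i} → 𝒳 × 𝒴₀, (∏ j, P₀ (q j)) *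
      equivoc₂ P (blockChannel V₁ φ₁ i q) (blockChannel V₂ φ₂ i q) ≤
      cent p X (fun s => (m₂ s, Y s)) := by
    refine le_trans (Finset.sum_le_sum fun i _ => le_of_eq ?_) (sum_cent_le_cent_tuple hp X _)
    unfold equivoc₂
    rw [← cent_letter_messages hP hV₁ hV₂ hfac φ₁ φ₂ i (fun v => v.1) (fun v => (v.2.2.2.2.2, v.2.1))
      (fun s => (fun j : {j // j ≠ i} => X s j, m₂ s, Y s))]
    intro s s'
    simp only [Prod.mk.injEq, X, Y, funext_iff]
    rw [forall_iff_of_ne i (fun j => (s j).2.1 = (s' j).2.1)]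
    simp only [forall_and]
    tauto
  have B₀ : n * equivoc₀ P ≤ cent p X Y := by
    refine le_trans (le_of_eq ?_) (sum_cent_le_cent_tuple hp X _)
    have hc : n * equivoc₀ P = ∑ _i : Fin n, equivoc₀ P := by simp
    rw [hc]
    refine Finset.sum_congr rfl fun i _ => ?_
    rw [cent_letter_messages hP hV₁ hV₂ hfac φ₁ φ₂ i (fun v => v.1) (fun v => v.2.1)
      (fun s => (fun j : {j // j ≠ i} => X s j, Y s))]
    · have e : ∀ q : {j // j ≠ i} → 𝒳 × 𝒴₀,
          cent (auxJoint P (blockChannel V₁ φ₁ i q) (blockChannel V₂ φ₂ i q))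
            (fun v => v.1) (fun v => v.2.1) = equivoc₀ P := fun q =>
        cent_source (P := P) (c₁ i q) (c₂ i q) (fun v => v.1) (fun v => v.2.1)
      simp only [e, ← Finset.sum_mul, hw, one_mul]
    · intro s s'
      simp only [Prod.mk.injEq, X, Y, funext_iff]
      rw [forall_iff_of_ne i (fun j => (s j).2.1 = (s' j).2.1)]
      simp only [forall_and]
      tauto
  -- Each message entropy splits into a part about `X` and a part left once `X` and `Y₀` are known.
  -- The latter dominates the noise description by `K₁` and `K₂`; the former is a difference of
  -- block equivocations. All message entropies are at most the logarithm of the number of messages.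
  have r₁ := cent_swap p X m₁ (fun s => (m₂ s, Y s))
  have r₂ := cent_swap p X m₂ (fun s => (m₁ s, Y s))
  have r₃ := cent_swap p X m₂ Y
  have s₁ : cent p X (fun s => (m₁ s, m₂ s, Y s)) = cent p X (fun s => ((m₁ s, m₂ s), Y s)) :=
    cent_congr_right p X (by intro s s'; simp only [Prod.mk.injEq]; tauto)
  have s₂ : cent p X (fun s => (m₂ s, m₁ s, Y s)) = cent p X (fun s => ((m₁ s, m₂ s), Y s)) :=
    cent_congr_right p X (by intro s s'; simp only [Prod.mk.injEq]; tauto)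
  have t₁ : cent p m₁ (fun s => (fun j => (s j).2.2.2, G s)) ≤
      cent p m₁ (fun s => (X s, m₂ s, Y s)) := by
    refine cent_le_of_determines hp _ _ _ ?_
    intro s s' h
    simp only [Prod.mk.injEq, G, X, Y, funext_iff, m₂] at h ⊢
    exact ⟨fun j => (h.2 j).1, congrArg φ₂ (funext h.1), fun j => (h.2 j).2⟩
  have t₂ : cent p m₂ (fun s => (fun j => (s j).2.2.1, G s)) ≤
      cent p m₂ (fun s => (X s, m₁ s, Y s)) := by
    refine cent_le_of_determines hp _ _ _ ?_
    intro s s' h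
    simp only [Prod.mk.injEq, G, X, Y, funext_iff, m₁] at h ⊢
    exact ⟨fun j => (h.2 j).1, congrArg φ₁ (funext h.1), fun j => (h.2 j).2⟩
  have t₃ : cent p m₂ (fun s => (X s, m₁ s, Y s)) ≤ cent p m₂ (fun s => (X s, Y s)) := by
    refine cent_le_of_determines hp _ _ _ ?_
    intro s s' h
    simp only [Prod.mk.injEq] at h ⊢
    tauto
  have l₁ := cent_le_log_card hp hp1 m₁ (fun s => (m₂ s, Y s))
  have l₂ := cent_le_log_card hp hp1 m₂ (fun s => (m₁ s, Y s))
  have l₃ := cent_le_log_card hp hp1 m₂ Y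
  have k₁ := cent_le_log_card hp hp1 m₁ (fun s => (fun j => (s j).2.2.2, G s))
  have k₂ := cent_le_log_card hp hp1 m₂ (fun s => (fun j => (s j).2.2.1, G s))
  rw [Fintype.card_fin] at l₁ l₂ l₃ k₁ k₂
  rw [div_le_iff₀ hn'] at hR₁ hR₂
  have K₁' := (Finset.sum_congr rfl fun i _ => (A₁ i).symm).trans_le K₁
  have K₂' := (Finset.sum_congr rfl fun i _ => (A₂ i).symm).trans_le K₂
  -- The time-sharing weights describe a uniform position `i` and independent copies of `(X, Y₀)`
  -- off that position.
  have avg : ∀ f : (Σ i : Fin n, ({j // j ≠ i} → 𝒳 × 𝒴₀)) → ℝ,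
      n * ∑ t : (Σ i : Fin n, ({j // j ≠ i} → 𝒳 × 𝒴₀)), ((∏ j, P₀ (t.2 j)) / n) * f t =
      ∑ i, ∑ q : {j // j ≠ i} → 𝒳 × 𝒴₀, (∏ j, P₀ (q j)) * f ⟨i, q⟩ := by
    intro f
    rw [Fintype.sum_sigma, Finset.mul_sum]
    refine Finset.sum_congr rfl fun i _ => ?_
    rw [Finset.mul_sum]
    refine Finset.sum_congr rfl fun q _ => ?_
    field_simp
  refine mem_of_averaged_outer_bound hS hU
    (J := Σ i : Fin n, ({j // j ≠ i} → 𝒳 × 𝒴₀)) (fun t => (∏ j, P₀ (t.2 j)) / n)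
    (fun t => div_nonneg (Finset.prod_nonneg fun _ _ => hP₀ _) hn'.le) ?_
    (fun t => noiseInfo₁ P (blockChannel V₁ φ₁ t.1 t.2) (blockChannel V₂ φ₂ t.1 t.2))
    (fun t => noiseInfo₂ P (blockChannel V₁ φ₁ t.1 t.2) (blockChannel V₂ φ₂ t.1 t.2))
    (fun t => equivoc₁ P (blockChannel V₁ φ₁ t.1 t.2) (blockChannel V₂ φ₂ t.1 t.2))
    (fun t => equivoc₂ P (blockChannel V₁ φ₁ t.1 t.2) (blockChannel V₂ φ₂ t.1 t.2))
    (fun t => equivoc₁₂ P (blockChannel V₁ φ₁ t.1 t.2) (blockChannel V₂ φ₂ t.1 t.2))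
    (fun t => noiseInfo₁_nonneg hP (c₁ _ _) (c₂ _ _))
    (fun t => noiseInfo₂_nonneg hP (c₁ _ _) (c₂ _ _))
    (fun t => hS₁ (corner_mem_rdRegion₁ hP (c₁ _ _) (c₂ _ _)))
    (fun t => hS₁ (semicorner_mem_rdRegion₁ hP (c₁ _ _) (c₂ _ _)))
    (fun t => hS₂ (corner_mem_rdRegion₂ hP (c₁ _ _) (c₂ _ _)))
    (fun t => hS₂ (semicorner_mem_rdRegion₂ hP (c₁ _ _) (c₂ _ _)))
    (hS₁ (origin_mem_rdRegion₁ hP)) ?_ ?_ ?_ ?_ ?_ ?_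
  · have := avg (fun _ => 1)
    simp only [mul_one, hw] at this
    rw [Finset.sum_const, Finset.card_fin, nsmul_one] at this
    exact mul_left_cancel₀ hn'.ne' (this.trans (mul_one _).symm)
  all_goals
    rw [← mul_le_mul_iff_right₀ hn']
    simp only [mul_sub, mul_add, avg]
    linarith

/-- Finite expected loss forces the estimate to be positive wherever the source has positive
probability. The extended-real loss is then an ordinary average of logarithms, and Gibbs' inequality
applies to each letter. -/
theorem sum_cent_le_of_expectedLoss (hP : ∀ s, 0 ≤ P s)
    (φ₁ : (Fin n → 𝒴₁) → Fin M₁) (φ₂ : (Fin n → 𝒴₂) → Fin M₂)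
    (ψ : Fin M₁ → Fin M₂ → (Fin n → 𝒴₀) → Fin n → 𝒳 → ℝ) {D : ℝ} (hn : 0 < n) (hD : 0 ≤ D)
    (hψ : ∀ m₁ m₂ y i, ψ m₁ m₂ y i ∈ stdSimplex ℝ 𝒳)
    (hle : expectedLoss P φ₁ φ₂ ψ ≤ ENNReal.ofReal D) :
    ∑ i, cent (prodLaw (Fin n) P) (fun s => (s i).1)
      (fun s => ((φ₁ (fun j => (s j).2.2.1), φ₂ (fun j => (s j).2.2.2)), fun j => (s j).2.1)) ≤
      n * D := by
  have hn' : (0 : ℝ) < n := by exact_mod_cast hn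
  have hp := prodLaw_nonneg (ι := Fin n) hP
  set q : (Fin n → 𝒳 × 𝒴₀ × 𝒴₁ × 𝒴₂) → Fin n → ℝ := fun s i =>
    ψ (φ₁ fun j => (s j).2.2.1) (φ₂ fun j => (s j).2.2.2) (fun j => (s j).2.1) i (s i).1 with hq
  have q0 : ∀ s i, 0 ≤ q s i := fun s i => (hψ _ _ _ _).1 _
  have q1 : ∀ s i, q s i ≤ 1 := fun s i => by
    rw [← (hψ (φ₁ fun j => (s j).2.2.1) (φ₂ fun j => (s j).2.2.2) (fun j => (s j).2.1) i).2]
    exact Finset.single_le_sum (f := fun x => ψ (φ₁ fun j => (s j).2.2.1)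
      (φ₂ fun j => (s j).2.2.2) (fun j => (s j).2.1) i x) (fun x _ => (hψ _ _ _ _).1 x)
      (Finset.mem_univ _)
  have hfin : expectedLoss P φ₁ φ₂ ψ ≠ ∞ := ne_top_of_le_ne_top ENNReal.ofReal_ne_top hle
  have hpos : ∀ s, 0 < prodLaw (Fin n) P s → ∀ i, 0 < q s i := by
    intro s hs i
    refine (q0 s i).lt_of_ne fun h0 => hfin ?_
    unfold expectedLoss
    refine ENNReal.sum_eq_top.2 ⟨s, Finset.mem_univ _, ?_⟩
    have h1 : (∑ i, logLoss (ψ (φ₁ fun j => (s j).2.2.1) (φ₂ fun j => (s j).2.2.2)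
        (fun j => (s j).2.1) i) (s i).1) = ∞ := by
      refine ENNReal.sum_eq_top.2 ⟨i, Finset.mem_univ _, ?_⟩
      unfold logLoss
      exact if_pos h0.symm
    rw [h1, ENNReal.top_div_of_ne_top (ENNReal.natCast_ne_top n), ENNReal.mul_top]
    exact (ENNReal.ofReal_pos.2 hs).ne'
  have hterm : ∀ s, ENNReal.ofReal (∏ i, P (s i)) * ((∑ i, logLoss
      (ψ (φ₁ fun j => (s j).2.2.1) (φ₂ fun j => (s j).2.2.2) (fun j => (s j).2.1) i)
          (s i).1) / (n : ℝ≥0∞)) =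
      ENNReal.ofReal (prodLaw (Fin n) P s * ((∑ i, -Real.log (q s i)) / n)) := by
    intro s
    rcases (hp s).eq_or_lt with h | h
    · have h' := h.symm
      unfold prodLaw at h'
      rw [← h, h']
      simp
    · rw [ENNReal.ofReal_mul (hp s), ENNReal.ofReal_div_of_pos hn', ENNReal.ofReal_natCast,
        ENNReal.ofReal_sum_of_nonneg]
      · congr 2
        refine Finset.sum_congr rfl fun i _ => ?_
        unfold logLoss
        rw [if_neg (hpos s h i).ne', one_div, Real.log_inv]
      · intro i _
        exact neg_nonneg.2 (Real.log_nonpos (q0 s i) (q1 s i))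
  have hnn : ∀ s, 0 ≤ prodLaw (Fin n) P s * ((∑ i, -Real.log (q s i)) / n) := fun s =>
    mul_nonneg (hp s) (div_nonneg (Finset.sum_nonneg fun i _ =>
      neg_nonneg.2 (Real.log_nonpos (q0 s i) (q1 s i))) hn'.le)
  unfold expectedLoss at hle
  rw [Finset.sum_congr rfl fun s _ => hterm s, ← ENNReal.ofReal_sum_of_nonneg fun s _ => hnn s,
    ENNReal.ofReal_le_ofReal_iff hD] at hle
  have hbound : ∀ i, cent (prodLaw (Fin n) P) (fun s => (s i).1)
      (fun s => ((φ₁ (fun j => (s j).2.2.1), φ₂ (fun j => (s j).2.2.2)), fun j => (s j).2.1)) ≤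
      -∑ s, prodLaw (Fin n) P s * Real.log (q s i) := fun i =>
    cent_le_cross hp (fun s => (s i).1)
      (fun s => ((φ₁ (fun j => (s j).2.2.1), φ₂ (fun j => (s j).2.2.2)), fun j => (s j).2.1))
      (fun b x => ψ b.1.1 b.1.2 b.2 i x) (fun b x => (hψ _ _ _ _).1 x)
      (fun b => (hψ _ _ _ _).2.le) (fun s hs => hpos s hs i)
  refine (Finset.sum_le_sum fun i _ => hbound i).trans ?_
  calc ∑ i, -∑ s, prodLaw (Fin n) P s * Real.log (q s i)
      = n * ∑ s, prodLaw (Fin n) P s * ((∑ i, -Real.log (q s i)) / n) := by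
        simp only [← Finset.sum_neg_distrib]
        rw [Finset.sum_comm, Finset.mul_sum]
        refine Finset.sum_congr rfl fun s _ => ?_
        rw [← mul_assoc, mul_comm (n : ℝ), mul_assoc, mul_div_cancel₀ _ hn'.ne', Finset.mul_sum]
        refine Finset.sum_congr rfl fun i _ => ?_
        ring
    _ ≤ n * D := by gcongr

theorem mem_of_isAchievable {S : Set (ℝ × ℝ × ℝ)} (hS : Convex ℝ S) (hU : IsUpperSet S)
    (hS₁ : rdRegion₁ P ⊆ S) (hS₂ : rdRegion₂ P ⊆ S)
    (hP : ∀ s, 0 ≤ P s) (hP1 : ∑ s, P s = 1) (hM : IsMarkov P) {R₁ R₂ D : ℝ}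
    (h : IsAchievable P R₁ R₂ D) : (R₁, R₂, D) ∈ S := by
  obtain ⟨n, M₁, M₂, φ₁, φ₂, ψ, hn, hψ, hR₁, hR₂, hD, hle⟩ := h
  exact mem_of_code hS hU hS₁ hS₂ hP hP1 hM hn φ₁ φ₂ hR₁ hR₂
    (sum_cent_le_of_expectedLoss hP φ₁ φ₂ ψ hn hD hψ hle)

end Converse

/-! ### Carathéodory's theorem and compact convex hulls -/

section Caratheodory

variable {E : Type*} [AddCommGroup E] [Module ℝ E] [FiniteDimensional ℝ E]

/-- Carathéodory's theorem with a fixed number of points. -/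
theorem exists_fin_combination {N : ℕ} (hN : Module.finrank ℝ E + 1 = N) {s : Set E} {x : E}
    (hx : x ∈ convexHull ℝ s) :
    ∃ (w : Fin N → ℝ) (z : Fin N → E),
      w ∈ stdSimplex ℝ (Fin N) ∧ (∀ i, z i ∈ s) ∧ ∑ i, w i • z i = x := by
  obtain ⟨y, hy⟩ := convexHull_nonempty_iff.1 ⟨x, hx⟩
  obtain ⟨ι, _, z, w, hz, hind, hw, hw1, hx⟩ := eq_pos_convex_span_of_mem_convexHull hx
  have hcard : Fintype.card ι ≤ Fintype.card (Fin N) := by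
    rw [Fintype.card_fin, ← hN]
    exact hind.card_le_finrank_succ.trans (Nat.succ_le_succ (Submodule.finrank_le _))
  -- Unused indices get weight zero and the arbitrary point `y` of `s`.
  obtain ⟨e⟩ := Function.Embedding.nonempty_of_card_le hcard
  have hin : ∀ i, Function.extend e w (fun _ => (0 : ℝ)) (e i) = w i := fun i => e.injective.extend_apply w (fun _ => (0 : ℝ)) i
  have hin' : ∀ i, Function.extend e z (fun _ => y) (e i) = z i :=
    fun i => e.injective.extend_apply z _ i
  have hout : ∀ k, k ∉ Set.range e → Function.extend e w (fun _ => (0 : ℝ)) k = 0 := fun k hk =>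
    Function.extend_apply' w (fun _ => (0 : ℝ)) k hk
  refine ⟨Function.extend e w (fun _ => (0 : ℝ)), Function.extend e z (fun _ => y), ⟨fun k => ?_, ?_⟩, fun k => ?_,
    ?_⟩
  · by_cases hk : k ∈ Set.range e
    · obtain ⟨i, rfl⟩ := hk
      rw [hin]
      exact (hw i).le
    · rw [hout k hk]
  · rw [← hw1]
    exact (Fintype.sum_of_injective e e.injective w _ hout (fun i => (hin i).symm)).symm
  · by_cases hk : k ∈ Set.range e
    · obtain ⟨i, rfl⟩ := hk
      rw [hin']
      exact hz ⟨i, rfl⟩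
    · rw [Function.extend_apply' z _ k hk]
      exact hy
  · rw [← hx]
    refine (Fintype.sum_of_injective e e.injective (fun i => w i • z i) _ ?_ ?_).symm
    · intro k hk
      rw [hout k hk, zero_smul]
    · intro i
      rw [hin, hin']

/-- With the number of points fixed by the dimension, the hull is the continuous image of a simplex
times a finite power of `s`. -/
theorem isCompact_convexHull_of_isCompact [TopologicalSpace E] [IsTopologicalAddGroup E]
    [ContinuousSMul ℝ E] {s : Set E} (hs : IsCompact s) : IsCompact (convexHull ℝ s) := by
  let N := Module.finrank ℝ E + 1
  have hc : IsCompact ((stdSimplex ℝ (Fin N)) ×ˢ (Set.univ.pi fun _ : Fin N => s)) :=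
    (isCompact_stdSimplex ℝ (Fin N)).prod (isCompact_univ_pi fun _ => hs)
  have hf : Continuous fun t : (Fin N → ℝ) × (Fin N → E) => ∑ i, t.1 i • t.2 i := by fun_prop
  convert hc.image hf using 1
  ext x
  constructor
  · intro hx
    obtain ⟨w, z, hw, hz, h⟩ := exists_fin_combination rfl hx
    exact ⟨(w, z), ⟨hw, fun i _ => hz i⟩, h⟩
  · rintro ⟨⟨w, z⟩, ⟨hw, hz⟩, rfl⟩
    exact (convex_convexHull ℝ s).sum_mem (fun i _ => hw.1 i) hw.2
      (fun i _ => subset_convexHull ℝ s (hz i trivial))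

end Caratheodory

/-! ### Bounding the auxiliary alphabets -/

section Reduction

/-- A channel can be replaced by one with a bounded output alphabet that has the same values of
finitely many functionals which are additive over the output letters. -/
theorem exists_reduced_channel {𝒴 : Type*} [Fintype 𝒴] [Nonempty 𝒴] {m r : ℕ}
    {W : 𝒴 → Fin m → ℝ} (hW : IsChannel W) (Φ : Fin r → Fin m → ℝ) :
    ∃ (l : Fin (Fintype.card 𝒴 + r + 1) → ℝ) (σ : Fin (Fintype.card 𝒴 + r + 1) → Fin m),
      (∀ k, 0 ≤ l k) ∧ IsChannel (fun y k => l k * W y (σ k)) ∧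
      ∀ a, ∑ k, l k * Φ a (σ k) = ∑ u, Φ a u := by
  obtain ⟨y₀⟩ := ‹Nonempty 𝒴›
  have hm : 0 < m := by
    rcases Nat.eq_zero_or_pos m with h | h
    · subst h
      have := (hW y₀).2
      simp at this
    · exact h
  have hm' : (0 : ℝ) < m := by exact_mod_cast hm
  -- Each output letter is recorded by its channel column and its functional values. Carathéodory is
  -- applied to the uniform average of these vectors and the weights are multiplied by `m`; the
  -- column coordinates then say that the rescaled columns again form a channel.
  let v : Fin m → (𝒴 ⊕ Fin r → ℝ) := fun u => Sum.elim (fun y => W y u) (fun a => Φ a u)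
  have hx : ∑ u, (m : ℝ)⁻¹ • v u ∈ convexHull ℝ (Set.range v) :=
    (convex_convexHull ℝ _).sum_mem (fun _ _ => by positivity)
      (by simp [hm'.ne']) (fun u _ => subset_convexHull ℝ _ ⟨u, rfl⟩)
  have hN : Module.finrank ℝ (𝒴 ⊕ Fin r → ℝ) + 1 = Fintype.card 𝒴 + r + 1 := by simp
  obtain ⟨w, z, hw, hz, hsum⟩ := exists_fin_combination hN hx
  choose σ hσ using hz
  have hsum' : ∀ c, ∑ k, (m * w k) * v (σ k) c = ∑ u, v u c := by
    intro c
    have := congrFun hsum c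
    simp only [Finset.sum_apply, Pi.smul_apply, smul_eq_mul, ← hσ, ← Finset.mul_sum] at this
    rw [eq_inv_mul_iff_mul_eq₀ hm'.ne', Finset.mul_sum] at this
    rw [← this]
    exact Finset.sum_congr rfl fun k _ => by ring
  refine ⟨fun k => m * w k, σ, fun k => mul_nonneg hm'.le (hw.1 k), fun y => ⟨fun k => ?_, ?_⟩,
    fun a => hsum' (Sum.inr a)⟩
  · exact mul_nonneg (mul_nonneg hm'.le (hw.1 k)) ((hW y).1 _)
  · exact (hsum' (Sum.inl y)).trans (hW y).2

variable {𝒳 𝒴₀ 𝒴₁ 𝒴₂ : Type*} [Fintype 𝒳] [Fintype 𝒴₀] [Fintype 𝒴₁] [Fintype 𝒴₂]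
  {m₁ m₂ : ℕ} {P : 𝒳 × 𝒴₀ × 𝒴₁ × 𝒴₂ → ℝ}

/-- The part of the joint law with a given value of the first auxiliary variable. -/
def sliceLeft (P : 𝒳 × 𝒴₀ × 𝒴₁ × 𝒴₂ → ℝ) (W₁ : 𝒴₁ → Fin m₁ → ℝ) (W₂ : 𝒴₂ → Fin m₂ → ℝ)
    (u : Fin m₁) : 𝒳 × 𝒴₀ × 𝒴₁ × 𝒴₂ × Fin m₂ → ℝ :=
  fun v => auxJoint P W₁ W₂ (v.1, v.2.1, v.2.2.1, v.2.2.2.1, u, v.2.2.2.2)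

/-- The part of the joint law with a given value of the second auxiliary variable. -/
def sliceRight (P : 𝒳 × 𝒴₀ × 𝒴₁ × 𝒴₂ → ℝ) (W₁ : 𝒴₁ → Fin m₁ → ℝ) (W₂ : 𝒴₂ → Fin m₂ → ℝ)
    (u : Fin m₂) : 𝒳 × 𝒴₀ × 𝒴₁ × 𝒴₂ × Fin m₁ → ℝ :=
  fun v => auxJoint P W₁ W₂ (v.1, v.2.1, v.2.2.1, v.2.2.2.1, v.2.2.2.2, u)

/-- Conditional entropy given `U₁` is a sum over its letters, and rescaling a channel column by `l
k` rescales the corresponding term by `l k`. This is the additivity that the reduction needs. -/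
theorem cent_sliceLeft {K : ℕ} (hP : ∀ s, 0 ≤ P s) {W₁ : 𝒴₁ → Fin m₁ → ℝ} {W₂ : 𝒴₂ → Fin m₂ → ℝ}
    (h₁ : IsChannel W₁) (h₂ : IsChannel W₂) (l : Fin K → ℝ) (σ : Fin K → Fin m₁)
    (h : IsChannel (fun y k => l k * W₁ y (σ k))) {α β γ : Type*} [Fintype α] [Fintype β]
    (f : 𝒳 × 𝒴₀ × 𝒴₁ × 𝒴₂ × Fin m₂ → α) (g : 𝒳 × 𝒴₀ × 𝒴₁ × 𝒴₂ × Fin m₂ → β)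
    (G : 𝒳 × 𝒴₀ × 𝒴₁ × 𝒴₂ × Fin K × Fin m₂ → γ)
    (hG : ∀ v v', G v = G v' ↔ g (v.1, v.2.1, v.2.2.1, v.2.2.2.1, v.2.2.2.2.2) =
      g (v'.1, v'.2.1, v'.2.2.1, v'.2.2.2.1, v'.2.2.2.2.2) ∧ v.2.2.2.2.1 = v'.2.2.2.2.1) :
    cent (auxJoint P (fun y k => l k * W₁ y (σ k)) W₂)
      (fun v => f (v.1, v.2.1, v.2.2.1, v.2.2.2.1, v.2.2.2.2.2)) G =
      ∑ k, l k * cent (sliceLeft P W₁ W₂ (σ k)) f g := by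
  have key := condEntropy_mixture (auxJoint P (fun y k => l k * W₁ y (σ k)) W₂)
    (fun v => (v.1, v.2.1, v.2.2.1, v.2.2.2.1, v.2.2.2.2.2)) (fun v => v.2.2.2.2.1) l
    (fun k => sliceLeft P W₁ W₂ (σ k)) ?_ f g
  · rw [condEntropy_eq_cent (auxJoint_nonneg hP h h₂)] at key
    have e : ∀ k, condEntropy (sliceLeft P W₁ W₂ (σ k)) f g =
        cent (sliceLeft P W₁ W₂ (σ k)) f g := fun k =>
      condEntropy_eq_cent (fun v => auxJoint_nonneg hP h₁ h₂ _) f g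
    simp only [e] at key
    rw [← key]
    refine cent_congr_right _ _ fun v v' => ?_
    rw [hG]
    simp only [Prod.mk.injEq]
  · rintro ⟨x, y₀, y₁, y₂, u₂⟩ k
    refine (law_of_injective _ ?_ (x, y₀, y₁, y₂, k, u₂)).trans ?_
    · rintro ⟨a, b, c, d, e, f⟩ ⟨a', b', c', d', e', f'⟩ h
      simp only [Prod.mk.injEq] at h ⊢
      tauto
    · simp only [auxJoint, sliceLeft]
      ring

theorem cent_sliceRight {K : ℕ} (hP : ∀ s, 0 ≤ P s) {W₁ : 𝒴₁ → Fin m₁ → ℝ}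
    {W₂ : 𝒴₂ → Fin m₂ → ℝ}
    (h₁ : IsChannel W₁) (h₂ : IsChannel W₂) (l : Fin K → ℝ) (σ : Fin K → Fin m₂)
    (h : IsChannel (fun y k => l k * W₂ y (σ k))) {α β γ : Type*} [Fintype α] [Fintype β]
    (f : 𝒳 × 𝒴₀ × 𝒴₁ × 𝒴₂ × Fin m₁ → α) (g : 𝒳 × 𝒴₀ × 𝒴₁ × 𝒴₂ × Fin m₁ → β)
    (G : 𝒳 × 𝒴₀ × 𝒴₁ × 𝒴₂ × Fin m₁ × Fin K → γ)
    (hG : ∀ v v', G v = G v' ↔ g (v.1, v.2.1, v.2.2.1, v.2.2.2.1, v.2.2.2.2.1) =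
      g (v'.1, v'.2.1, v'.2.2.1, v'.2.2.2.1, v'.2.2.2.2.1) ∧ v.2.2.2.2.2 = v'.2.2.2.2.2) :
    cent (auxJoint P W₁ (fun y k => l k * W₂ y (σ k)))
      (fun v => f (v.1, v.2.1, v.2.2.1, v.2.2.2.1, v.2.2.2.2.1)) G =
      ∑ k, l k * cent (sliceRight P W₁ W₂ (σ k)) f g := by
  have key := condEntropy_mixture (auxJoint P W₁ (fun y k => l k * W₂ y (σ k)))
    (fun v => (v.1, v.2.1, v.2.2.1, v.2.2.2.1, v.2.2.2.2.1)) (fun v => v.2.2.2.2.2) l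
    (fun k => sliceRight P W₁ W₂ (σ k)) ?_ f g
  · rw [condEntropy_eq_cent (auxJoint_nonneg hP h₁ h)] at key
    have e : ∀ k, condEntropy (sliceRight P W₁ W₂ (σ k)) f g =
        cent (sliceRight P W₁ W₂ (σ k)) f g := fun k =>
      condEntropy_eq_cent (fun v => auxJoint_nonneg hP h₁ h₂ _) f g
    simp only [e] at key
    rw [← key]
    refine cent_congr_right _ _ fun v v' => ?_
    rw [hG]
    simp only [Prod.mk.injEq]
  · rintro ⟨x, y₀, y₁, y₂, u₁⟩ k
    refine (law_of_injective _ ?_ (x, y₀, y₁, y₂, u₁, k)).trans ?_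
    · rintro ⟨a, b, c, d, e, f⟩ ⟨a', b', c', d', e', f'⟩ h
      simp only [Prod.mk.injEq] at h ⊢
      tauto
    · simp only [auxJoint, sliceRight]
      ring

theorem cent_reduced_left {K : ℕ} (hP : ∀ s, 0 ≤ P s) {W₁ : 𝒴₁ → Fin m₁ → ℝ}
    {W₂ : 𝒴₂ → Fin m₂ → ℝ} (h₁ : IsChannel W₁) (h₂ : IsChannel W₂) {l : Fin K → ℝ}
    {σ : Fin K → Fin m₁} (h : IsChannel (fun y k => l k * W₁ y (σ k))) {α : Type*} [Fintype α]
    (f : 𝒳 × 𝒴₀ × 𝒴₁ × 𝒴₂ × Fin m₂ → α)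
    (hf : ∑ k, l k * cent (sliceLeft P W₁ W₂ (σ k)) f (fun v => (v.2.2.2.2, v.2.1)) =
      ∑ u, cent (sliceLeft P W₁ W₂ u) f (fun v => (v.2.2.2.2, v.2.1))) :
    cent (auxJoint P (fun y k => l k * W₁ y (σ k)) W₂)
      (fun v => f (v.1, v.2.1, v.2.2.1, v.2.2.2.1, v.2.2.2.2.2))
      (fun v => (v.2.2.2.2.1, v.2.2.2.2.2, v.2.1)) =
    cent (auxJoint P W₁ W₂) (fun v => f (v.1, v.2.1, v.2.2.1, v.2.2.2.1, v.2.2.2.2.2))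
      (fun v => (v.2.2.2.2.1, v.2.2.2.2.2, v.2.1)) := by
  -- The original channel is itself of the reduced form, with unit weights and identity selection.
  have hid : IsChannel (fun y k => (fun _ => (1 : ℝ)) k * W₁ y (id k)) := by simpa using h₁
  have e := cent_sliceLeft hP h₁ h₂ (fun _ => 1) id hid f (fun v => (v.2.2.2.2, v.2.1))
    (fun v => (v.2.2.2.2.1, v.2.2.2.2.2, v.2.1)) (by
      intro v v'
      simp only [Prod.mk.injEq]
      tauto)
  simp only [one_mul, id] at e
  rw [cent_sliceLeft hP h₁ h₂ l σ h f (fun v => (v.2.2.2.2, v.2.1)), hf, e]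
  intro v v'
  simp only [Prod.mk.injEq]
  tauto

theorem cent_reduced_right {K : ℕ} (hP : ∀ s, 0 ≤ P s) {W₁ : 𝒴₁ → Fin m₁ → ℝ}
    {W₂ : 𝒴₂ → Fin m₂ → ℝ} (h₁ : IsChannel W₁) (h₂ : IsChannel W₂) {l : Fin K → ℝ}
    {σ : Fin K → Fin m₂} (h : IsChannel (fun y k => l k * W₂ y (σ k))) {α β : Type*} [Fintype α]
    [Fintype β] (f : 𝒳 × 𝒴₀ × 𝒴₁ × 𝒴₂ × Fin m₁ → α) (g : 𝒳 × 𝒴₀ × 𝒴₁ × 𝒴₂ × Fin m₁ → β)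
    (hf : ∑ k, l k * cent (sliceRight P W₁ W₂ (σ k)) f g =
      ∑ u, cent (sliceRight P W₁ W₂ u) f g) :
    cent (auxJoint P W₁ (fun y k => l k * W₂ y (σ k)))
      (fun v => f (v.1, v.2.1, v.2.2.1, v.2.2.2.1, v.2.2.2.2.1))
      (fun v => (v.2.2.2.2.2, g (v.1, v.2.1, v.2.2.1, v.2.2.2.1, v.2.2.2.2.1))) =
    cent (auxJoint P W₁ W₂) (fun v => f (v.1, v.2.1, v.2.2.1, v.2.2.2.1, v.2.2.2.2.1))
      (fun v => (v.2.2.2.2.2, g (v.1, v.2.1, v.2.2.1, v.2.2.2.1, v.2.2.2.2.1))) := by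
  have hid : IsChannel (fun y k => (fun _ => (1 : ℝ)) k * W₂ y (id k)) := by simpa using h₂
  have e := cent_sliceRight hP h₁ h₂ (fun _ => 1) id hid f g
    (fun v => (v.2.2.2.2.2, g (v.1, v.2.1, v.2.2.1, v.2.2.2.1, v.2.2.2.2.1))) (by
      intro v v'
      simp only [Prod.mk.injEq]
      tauto)
  simp only [one_mul, id] at e
  rw [cent_sliceRight hP h₁ h₂ l σ h f g, hf, e]
  intro v v'
  simp only [Prod.mk.injEq]
  tauto

/-- Only `H(Y₁ | U₁, U₂, Y₀)` and `H(X | U₁, U₂, Y₀)` involve `U₁`, so two functionals are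
preserved; one more letter comes from Carathéodory. -/
theorem exists_reduced_left [Nonempty 𝒴₁] (hP : ∀ s, 0 ≤ P s) {W₁ : 𝒴₁ → Fin m₁ → ℝ}
    {W₂ : 𝒴₂ → Fin m₂ → ℝ} (h₁ : IsChannel W₁) (h₂ : IsChannel W₂) :
    ∃ W : 𝒴₁ → Fin (Fintype.card 𝒴₁ + 2 + 1) → ℝ, IsChannel W ∧ cost P W W₂ = cost P W₁ W₂ := by
  obtain ⟨l, σ, -, hW, hΦ⟩ := exists_reduced_channel h₁ ![
    fun u => cent (sliceLeft P W₁ W₂ u) (fun v => v.2.2.1) (fun v => (v.2.2.2.2, v.2.1)),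
    fun u => cent (sliceLeft P W₁ W₂ u) (fun v => v.1) (fun v => (v.2.2.2.2, v.2.1))]
  refine ⟨_, hW, ?_⟩
  have c1 := cent_reduced_left hP h₁ h₂ hW (fun v => v.2.2.1) (hΦ 0)
  have c2 := cent_reduced_left hP h₁ h₂ hW (fun v => v.1) (hΦ 1)
  have d1 := (cent_right (P := P) (W₂ := W₂) hW (fun v => v.2.2.1) (fun v => (v.2.2.2.2, v.2.1))).trans
    (cent_right h₁ _ _).symm
  have d2 := (cent_right (P := P) (W₂ := W₂) hW (fun v => v.2.2.2.1) (fun v => v.2.1)).trans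
    (cent_right h₁ _ _).symm
  have d3 := (cent_right (P := P) (W₂ := W₂) hW (fun v => v.2.2.2.1)
    (fun v => (v.2.2.2.2, v.2.1))).trans (cent_right h₁ _ _).symm
  unfold cost
  dsimp only at c1 c2 d1 d2 d3
  rw [c1, c2, d1, d2, d3]

/-- Four entropies in the cost triple involve `U₂`; `H(Y₂ | Y₀)` depends on the source alone. -/
theorem exists_reduced_right [Nonempty 𝒴₂] (hP : ∀ s, 0 ≤ P s) {W₁ : 𝒴₁ → Fin m₁ → ℝ}
    {W₂ : 𝒴₂ → Fin m₂ → ℝ} (h₁ : IsChannel W₁) (h₂ : IsChannel W₂) :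
    ∃ W : 𝒴₂ → Fin (Fintype.card 𝒴₂ + 4 + 1) → ℝ, IsChannel W ∧ cost P W₁ W = cost P W₁ W₂ := by
  obtain ⟨l, σ, -, hW, hΦ⟩ := exists_reduced_channel h₂ ![
    fun u => cent (sliceRight P W₁ W₂ u) (fun v => v.2.2.1) (fun v => v.2.1),
    fun u => cent (sliceRight P W₁ W₂ u) (fun v => v.2.2.1) (fun v => (v.2.2.2.2, v.2.1)),
    fun u => cent (sliceRight P W₁ W₂ u) (fun v => v.2.2.2.1) (fun v => v.2.1),
    fun u => cent (sliceRight P W₁ W₂ u) (fun v => v.1) (fun v => (v.2.2.2.2, v.2.1))]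
  refine ⟨_, hW, ?_⟩
  have c1 := cent_reduced_right hP h₁ h₂ hW (fun v => v.2.2.1) (fun v => v.2.1) (hΦ 0)
  have c2 := cent_reduced_right hP h₁ h₂ hW (fun v => v.2.2.1) (fun v => (v.2.2.2.2, v.2.1)) (hΦ 1)
  have c3 := cent_reduced_right hP h₁ h₂ hW (fun v => v.2.2.2.1) (fun v => v.2.1) (hΦ 2)
  have c4 := cent_reduced_right hP h₁ h₂ hW (fun v => v.1) (fun v => (v.2.2.2.2, v.2.1)) (hΦ 3)
  have d := (cent_source (P := P) h₁ hW (fun v => v.2.2.2) (fun v => v.2.1)).trans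
    (cent_source h₁ h₂ _ _).symm
  have sw : ∀ {K : ℕ} (p : 𝒳 × 𝒴₀ × 𝒴₁ × 𝒴₂ × Fin m₁ × Fin K → ℝ),
      cent p (fun v => v.2.2.1) (fun v => (v.2.2.2.2.1, v.2.2.2.2.2, v.2.1)) =
        cent p (fun v => v.2.2.1) (fun v => (v.2.2.2.2.2, v.2.2.2.2.1, v.2.1)) ∧
      cent p (fun v => v.1) (fun v => (v.2.2.2.2.1, v.2.2.2.2.2, v.2.1)) =
        cent p (fun v => v.1) (fun v => (v.2.2.2.2.2, v.2.2.2.2.1, v.2.1)) := by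
    intro K p
    constructor <;> apply cent_congr_right <;> intro v v' <;> simp only [Prod.mk.injEq] <;> tauto
  unfold cost
  dsimp only at c1 c2 c3 c4 d
  rw [(sw _).1, (sw _).2, (sw _).1, (sw _).2, c1, c2, c3, c4, d]

end Reduction

/-! ### Closedness of the convex hull, and the converse inclusion -/

section Closed

/-- This form is continuous in the weights even where a probability vanishes. -/
theorem ent_eq_sum_negMulLog {Ω α : Type*} [Fintype Ω] [Fintype α] (p : Ω → ℝ) (f : Ω → α) :
    ent p f = ∑ a, Real.negMulLog (law p f a) := by
  unfold ent Real.negMulLog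
  rw [← sum_law_mul p f (fun a => Real.log (law p f a)), ← Finset.sum_neg_distrib]
  simp only [neg_mul]

theorem continuous_ent {Ω α T : Type*} [Fintype Ω] [Fintype α] [TopologicalSpace T]
    {p : T → Ω → ℝ} (hp : ∀ ω, Continuous fun t => p t ω) (f : Ω → α) :
    Continuous fun t => ent (p t) f := by
  simp only [ent_eq_sum_negMulLog]
  refine continuous_finsetSum _ fun c _ => Real.continuous_negMulLog.comp ?_
  unfold law
  refine continuous_finsetSum _ fun ω _ => ?_
  split_ifs
  exacts [hp ω, continuous_const]

theorem continuous_cent {Ω α β T : Type*} [Fintype Ω] [Fintype α] [Fintype β] [TopologicalSpace T]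
    {p : T → Ω → ℝ} (hp : ∀ ω, Continuous fun t => p t ω) (f : Ω → α) (g : Ω → β) :
    Continuous fun t => cent (p t) f g :=
  (continuous_ent hp _).sub (continuous_ent hp _)

variable {𝒳 𝒴₀ 𝒴₁ 𝒴₂ : Type*} [Fintype 𝒳] [Fintype 𝒴₀] [Fintype 𝒴₁] [Fintype 𝒴₂]
  {P : 𝒳 × 𝒴₀ × 𝒴₁ × 𝒴₂ → ℝ}

theorem continuous_cost (P : 𝒳 × 𝒴₀ × 𝒴₁ × 𝒴₂ → ℝ) (m₁ m₂ : ℕ) :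
    Continuous fun t : (𝒴₁ → Fin m₁ → ℝ) × (𝒴₂ → Fin m₂ → ℝ) => cost P t.1 t.2 := by
  have hp : ∀ ω, Continuous fun t : (𝒴₁ → Fin m₁ → ℝ) × (𝒴₂ → Fin m₂ → ℝ) =>
      auxJoint P t.1 t.2 ω := by
    intro ω
    simp only [auxJoint]
    fun_prop
  unfold cost
  exact ((continuous_cent hp _ _).sub (continuous_cent hp _ _)).prodMk
    (((continuous_cent hp _ _).sub (continuous_cent hp _ _)).prodMk (continuous_cent hp _ _))

theorem isCompact_setOf_isChannel (𝒴 : Type*) [Fintype 𝒴] (m : ℕ) :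
    IsCompact {W : 𝒴 → Fin m → ℝ | IsChannel W} := by
  have := isCompact_univ_pi fun _ : 𝒴 => isCompact_stdSimplex ℝ (Fin m)
  convert this using 1
  ext W
  simp [IsChannel]

/-- The rate-distortion triples of auxiliary variables with bounded alphabets. -/
def boundedCosts (P : 𝒳 × 𝒴₀ × 𝒴₁ × 𝒴₂ → ℝ) : Set (ℝ × ℝ × ℝ) :=
  (fun t : (𝒴₁ → Fin (Fintype.card 𝒴₁ + 2 + 1) → ℝ) × (𝒴₂ → Fin (Fintype.card 𝒴₂ + 4 + 1) → ℝ) =>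
    cost P t.1 t.2) '' ({W | IsChannel W} ×ˢ {W | IsChannel W})

theorem isCompact_boundedCosts (P : 𝒳 × 𝒴₀ × 𝒴₁ × 𝒴₂ → ℝ) : IsCompact (boundedCosts P) :=
  ((isCompact_setOf_isChannel _ _).prod (isCompact_setOf_isChannel _ _)).image
    (continuous_cost P _ _)

-- With bounded alphabets the costs form a compact set, whose sum with the closed orthant is closed.
-- The slack `ε` in the distortion can therefore tend to zero.
open Pointwise in
theorem rdRegion₁_eq [Nonempty 𝒴₁] [Nonempty 𝒴₂] (hP : ∀ s, 0 ≤ P s) :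
    rdRegion₁ P = boundedCosts P + Set.Ici 0 := by
  have hcl : IsClosed (boundedCosts P + Set.Ici (0 : ℝ × ℝ × ℝ)) :=
    isClosed_Ici.add_left_of_isCompact (isCompact_boundedCosts P)
  apply Set.Subset.antisymm
  · intro t ht
    rw [mem_rdRegion₁_iff hP] at ht
    have hmem : ∀ ε : ℝ, 0 < ε → (t.1, t.2.1, t.2.2 + ε) ∈
        boundedCosts P + Set.Ici (0 : ℝ × ℝ × ℝ) := by
      intro ε hε
      obtain ⟨m₁, m₂, W₁, W₂, h₁, h₂, hle⟩ := ht ε hε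
      obtain ⟨W₁', h₁', e₁⟩ := exists_reduced_left hP h₁ h₂
      obtain ⟨W₂', h₂', e₂⟩ := exists_reduced_right hP h₁' h₂
      refine ⟨cost P W₁' W₂', ⟨(W₁', W₂'), ⟨h₁', h₂'⟩, rfl⟩, _, ?_,
        add_sub_cancel _ (t.1, t.2.1, t.2.2 + ε)⟩
      rw [e₂, e₁]
      exact sub_nonneg.2 hle
    have hlim : Filter.Tendsto (fun ε : ℝ => (t.1, t.2.1, t.2.2 + ε))
        (nhdsWithin 0 (Set.Ioi 0)) (nhds t) := by
      have : Continuous fun ε : ℝ => (t.1, t.2.1, t.2.2 + ε) := by fun_prop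
      have h := (this.tendsto 0).mono_left (nhdsWithin_le_nhds (s := Set.Ioi 0))
      simpa using h
    exact hcl.mem_of_tendsto hlim (by
      filter_upwards [self_mem_nhdsWithin] with ε hε using hmem ε hε)
  · rintro t ⟨_, ⟨⟨W₁, W₂⟩, ⟨h₁, h₂⟩, rfl⟩, c, hc, rfl⟩
    exact cost_mem_rdRegion₁ hP h₁ h₂ (le_add_of_nonneg_right hc)

open Pointwise in
theorem rdRegion₂_eq [Nonempty 𝒴₁] [Nonempty 𝒴₂] (hP : ∀ s, 0 ≤ P s) :
    rdRegion₂ P = swapRates '' boundedCosts (swapLaw P) + Set.Ici 0 := by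
  ext t
  rw [mem_rdRegion₂_iff hP, rdRegion₁_eq (P := swapLaw P) (fun s => hP _)]
  constructor
  · rintro ⟨a, ha, c, hc, h⟩
    refine ⟨swapRates a, ⟨a, ha, rfl⟩, swapRates c, ⟨hc.2.1, hc.1, hc.2.2⟩, ?_⟩
    exact congrArg swapRates h
  · rintro ⟨_, ⟨a, ha, rfl⟩, c, hc, rfl⟩
    exact ⟨a, ha, swapRates c, ⟨hc.2.1, hc.1, hc.2.2⟩, rfl⟩

open Pointwise in
theorem convexHull_rdRegions_eq [Nonempty 𝒴₁] [Nonempty 𝒴₂] (hP : ∀ s, 0 ≤ P s) :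
    convexHull ℝ (rdRegion₁ P ∪ rdRegion₂ P) =
      convexHull ℝ (boundedCosts P ∪ swapRates '' boundedCosts (swapLaw P)) + Set.Ici 0 := by
  rw [rdRegion₁_eq hP, rdRegion₂_eq hP, ← Set.union_add, convexHull_add,
    (convex_Ici (0 : ℝ × ℝ × ℝ)).convexHull_eq]

/-- Convex hulls commute with Minkowski sums, so the hull is a compact convex set plus a closed
orthant. -/
theorem isClosed_convexHull_rdRegions [Nonempty 𝒴₁] [Nonempty 𝒴₂] (hP : ∀ s, 0 ≤ P s) :
    IsClosed (convexHull ℝ (rdRegion₁ P ∪ rdRegion₂ P)) := by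
  rw [convexHull_rdRegions_eq hP]
  refine isClosed_Ici.add_left_of_isCompact (isCompact_convexHull_of_isCompact ?_)
  refine (isCompact_boundedCosts P).union ((isCompact_boundedCosts _).image ?_)
  unfold swapRates
  fun_prop

theorem isUpperSet_convexHull_rdRegions [Nonempty 𝒴₁] [Nonempty 𝒴₂] (hP : ∀ s, 0 ≤ P s) :
    IsUpperSet (convexHull ℝ (rdRegion₁ P ∪ rdRegion₂ P)) := by
  rw [convexHull_rdRegions_eq hP]
  exact (isUpperSet_Ici _).add_left

/-- The converse part of the coding theorem. -/
theorem rdRegion_subset (hP : P ∈ stdSimplex ℝ (𝒳 × 𝒴₀ × 𝒴₁ × 𝒴₂)) (hM : IsMarkov P) :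
    rdRegion P ⊆ convexHull ℝ (rdRegion₁ P ∪ rdRegion₂ P) := by
  have hne : Nonempty (𝒳 × 𝒴₀ × 𝒴₁ × 𝒴₂) := by
    by_contra h
    rw [not_nonempty_iff] at h
    have := hP.2
    simp at this
  obtain ⟨x', y₀', y₁', y₂'⟩ := hne
  have : Nonempty 𝒴₁ := ⟨y₁'⟩
  have : Nonempty 𝒴₂ := ⟨y₂'⟩
  refine closure_minimal ?_ (isClosed_convexHull_rdRegions hP.1)
  rintro ⟨R₁, R₂, D⟩ h
  exact mem_of_isAchievable (convex_convexHull ℝ _) (isUpperSet_convexHull_rdRegions hP.1)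
    (Set.subset_union_left.trans (subset_convexHull ℝ _))
    (Set.subset_union_right.trans (subset_convexHull ℝ _)) hP.1 hP.2 hM h

end Closed

/-! ### Second moments under product laws -/

section ProductMoments

variable {ι S : Type*} [Fintype ι] [DecidableEq ι] [Fintype S] {P : S → ℝ}

theorem sum_prodLaw_mul (hP : ∑ a, P a = 1) (i : ι) (h : S → ℝ) :
    ∑ s, prodLaw ι P s * h (s i) = ∑ a, P a * h a := by
  have e : ∀ s : ι → S, prodLaw ι P s * h (s i) = ∏ j, (P (s j) * if j = i then h (s j) else 1) := by
    intro s
    have e' : (∏ j, if j = i then h (s j) else 1) = h (s i) := by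
      rw [Fintype.prod_eq_single i (fun x hx => if_neg hx), if_pos rfl]
    rw [Finset.prod_mul_distrib, e', prodLaw]
  rw [Finset.sum_congr rfl fun s _ => e s,
    sum_pi_prod (fun j a => P a * if j = i then h a else 1),
    Fintype.prod_eq_single i (by intro x hx; simp [hx, hP])]
  simp

theorem sum_prodLaw_mul_mul (hP : ∑ a, P a = 1) {i i' : ι} (hi : i ≠ i') (h h' : S → ℝ) :
    ∑ s, prodLaw ι P s * (h (s i) * h' (s i')) = (∑ a, P a * h a) * ∑ a, P a * h' a := by
  have e : ∀ s : ι → S, prodLaw ι P s * (h (s i) * h' (s i')) =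
      ∏ j, (P (s j) * if j = i then h (s j) else if j = i' then h' (s j) else 1) := by
    intro s
    have e' : (∏ j, if j = i then h (s j) else if j = i' then h' (s j) else 1) =
        h (s i) * h' (s i') := by
      rw [Fintype.prod_eq_mul i i' hi (fun x hx => by rw [if_neg hx.1, if_neg hx.2]), if_pos rfl,
        if_neg hi.symm, if_pos rfl]
    rw [Finset.prod_mul_distrib, e', prodLaw]
  rw [Finset.sum_congr rfl fun s _ => e s,
    sum_pi_prod (fun j a => P a * if j = i then h a else if j = i' then h' a else 1),
    Fintype.prod_eq_mul i i' hi (by rintro x ⟨h1, h2⟩; simp [h1, h2, hP])]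
  simp [hi.symm]

/-- The second moment of a sum of independent centred variables. -/
theorem sum_prodLaw_sq (hP : ∑ a, P a = 1) (g : ι → S → ℝ) (hg : ∀ i, ∑ a, P a * g i a = 0) :
    ∑ s, prodLaw ι P s * (∑ i, g i (s i)) ^ 2 = ∑ i, ∑ a, P a * g i a ^ 2 := by
  have e : ∀ s : ι → S, prodLaw ι P s * (∑ i, g i (s i)) ^ 2 =
      ∑ i, ∑ j, prodLaw ι P s * (g i (s i) * g j (s j)) := by
    intro s
    rw [sq, Finset.sum_mul_sum, Finset.mul_sum]
    simp only [Finset.mul_sum]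
  rw [Finset.sum_congr rfl fun s _ => e s, Finset.sum_comm]
  refine Finset.sum_congr rfl fun i _ => ?_
  rw [Finset.sum_comm, Finset.sum_eq_single i]
  · simp only [← sq]
    exact sum_prodLaw_mul hP i (fun a => g i a ^ 2)
  · intro j _ hj
    rw [sum_prodLaw_mul_mul hP hj.symm, hg, zero_mul]
  · simp

open Classical in
/-- Chebyshev's inequality for the empirical mean. -/
theorem sum_prodLaw_deviation_le {n : ℕ} (hn : 0 < n) (hP0 : ∀ a, 0 ≤ P a) (hP : ∑ a, P a = 1)
    (h : S → ℝ) {ε : ℝ} (hε : 0 < ε) :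
    (∑ s, prodLaw (Fin n) P s *
      if n * ε ≤ |∑ i, (h (s i) - ∑ a, P a * h a)| then 1 else 0) ≤
      (∑ a, P a * (h a - ∑ a, P a * h a) ^ 2) / (n * ε ^ 2) := by
  have hn' : (0 : ℝ) < n := by exact_mod_cast hn
  set μ := ∑ a, P a * h a with hμ
  have hsq := sum_prodLaw_sq (ι := Fin n) hP (fun _ a => h a - μ) (by
    intro i
    simp only [mul_sub, Finset.sum_sub_distrib, ← Finset.sum_mul, hP, one_mul]
    exact sub_self _)
  rw [Finset.sum_const, Finset.card_univ, Fintype.card_fin, nsmul_eq_mul] at hsq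
  rw [le_div_iff₀ (by positivity)]
  refine le_of_mul_le_mul_left ?_ hn'
  rw [← hsq, Finset.sum_mul, Finset.mul_sum]
  refine Finset.sum_le_sum fun s _ => ?_
  have h0 := prodLaw_nonneg (ι := Fin n) hP0 s
  split_ifs with hc
  · have : (n * ε) ^ 2 ≤ (∑ i, (h (s i) - μ)) ^ 2 := by
      rw [← sq_abs (∑ i, (h (s i) - μ))]
      gcongr
    calc (n : ℝ) * (prodLaw (Fin n) P s * 1 * (n * ε ^ 2)) = prodLaw (Fin n) P s * (n * ε) ^ 2 := by
          ring
      _ ≤ _ := by gcongr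
  · simp only [mul_zero, zero_mul]
    positivity

end ProductMoments

/-! ### Random hashing: decodability and uniformity -/

section Hashing

variable {U B : Type*} [Fintype U] [DecidableEq U] [Fintype B] [Nonempty B]

/-- The weight of a function under the uniform distribution on all functions. -/
def hashLaw (U B : Type*) [Fintype U] [Fintype B] : (U → B) → ℝ :=
  prodLaw U (fun _ : B => (Fintype.card B : ℝ)⁻¹)

theorem sum_uniform : ∑ _b : B, (Fintype.card B : ℝ)⁻¹ = 1 := by
  simp

theorem hashLaw_nonneg (θ : U → B) : 0 ≤ hashLaw U B θ :=
  prodLaw_nonneg (fun _ => by positivity) θ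

theorem sum_hashLaw : ∑ θ, hashLaw U B θ = 1 := sum_prodLaw sum_uniform

-- A uniform random function takes independent uniform values at distinct points.
open Classical in
theorem sum_hashLaw_collision {u u' : U} (h : u ≠ u') :
    (∑ θ, hashLaw U B θ * if θ u = θ u' then 1 else 0) = (Fintype.card B : ℝ)⁻¹ := by
  have e : ∀ θ : U → B, (hashLaw U B θ * if θ u = θ u' then 1 else 0) =
      ∑ b, hashLaw U B θ * ((if θ u = b then 1 else 0) * if θ u' = b then 1 else 0) := by
    intro θ
    rw [← Finset.mul_sum]
    congr 1
    simp [eq_comm]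
  have hB : (Fintype.card B : ℝ) ≠ 0 := by exact_mod_cast Fintype.card_ne_zero
  rw [Finset.sum_congr rfl fun θ _ => e θ, Finset.sum_comm]
  have e2 : ∀ b : B, (∑ θ, hashLaw U B θ * ((if θ u = b then 1 else 0) *
      if θ u' = b then 1 else 0)) = (Fintype.card B : ℝ)⁻¹ * (Fintype.card B : ℝ)⁻¹ := by
    intro b
    refine (sum_prodLaw_mul_mul sum_uniform h (fun c => if c = b then 1 else 0)
      (fun c => if c = b then 1 else 0)).trans ?_
    simp
  rw [Finset.sum_congr rfl fun b _ => e2 b]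
  simp [hB]

open Classical in
/-- The decoder that looks for a plausible sequence in the received bin. -/
def binDecoder {Z : Type*} [Nonempty U] (T : Z → Finset U) (θ : U → B) (b : B) (z : Z) : U :=
  if h : ∃ u ∈ T z, θ u = b then h.choose else Classical.arbitrary U

open Classical in
/-- Random binning: the average probability of a decoding error. -/
theorem sum_hashLaw_error_le {Ω Z : Type*} [Fintype Ω] [Nonempty U] {q : Ω → ℝ}
    (hq : ∀ ω, 0 ≤ q ω) (hq1 : ∑ ω, q ω = 1) (u : Ω → U) (z : Ω → Z) (T : Z → Finset U) {τ : ℝ}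
    (hT : ∀ z, ((T z).card : ℝ) ≤ τ) :
    (∑ θ : U → B, hashLaw U B θ *
      ∑ ω, q ω * if binDecoder T θ (θ (u ω)) (z ω) ≠ u ω then 1 else 0) ≤
      (∑ ω, q ω * if u ω ∉ T (z ω) then 1 else 0) + τ / Fintype.card B := by
  -- An error requires that the true value be implausible or that another plausible value share its
  -- bin.
  have pt : ∀ (θ : U → B) (ω : Ω), (if binDecoder T θ (θ (u ω)) (z ω) ≠ u ω then (1 : ℝ) else 0) ≤
      (if u ω ∉ T (z ω) then 1 else 0) +
        ∑ u' ∈ (T (z ω)).erase (u ω), if θ u' = θ (u ω) then 1 else 0 := by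
    intro θ ω
    have hs : 0 ≤ ∑ u' ∈ (T (z ω)).erase (u ω), if θ u' = θ (u ω) then (1 : ℝ) else 0 :=
      Finset.sum_nonneg fun _ _ => by split_ifs <;> norm_num
    by_cases h1 : u ω ∈ T (z ω)
    · by_cases h2 : binDecoder T θ (θ (u ω)) (z ω) = u ω
      · simp [h1, h2]
      · have hex : ∃ u' ∈ T (z ω), θ u' = θ (u ω) := ⟨u ω, h1, rfl⟩
        have hdec : binDecoder T θ (θ (u ω)) (z ω) = hex.choose := dif_pos hex
        obtain ⟨g1, g2⟩ := hex.choose_spec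
        rw [← hdec] at g1 g2
        have := Finset.single_le_sum (f := fun u' => if θ u' = θ (u ω) then (1 : ℝ) else 0)
          (fun _ _ => by split_ifs <;> norm_num) (Finset.mem_erase.2 ⟨h2, g1⟩)
        simp only [g2, if_true] at this
        simpa [h1, h2] using this
    · have : (if binDecoder T θ (θ (u ω)) (z ω) ≠ u ω then (1 : ℝ) else 0) ≤ 1 := by
        split_ifs <;> norm_num
      rw [if_pos h1]
      linarith
  have hN : (0 : ℝ) < Fintype.card B := by exact_mod_cast Fintype.card_pos
  have swap : (∑ θ : U → B, hashLaw U B θ *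
      ∑ ω, q ω * if binDecoder T θ (θ (u ω)) (z ω) ≠ u ω then 1 else 0) =
      ∑ ω, q ω * ∑ θ : U → B, hashLaw U B θ *
        if binDecoder T θ (θ (u ω)) (z ω) ≠ u ω then 1 else 0 := by
    simp only [Finset.mul_sum]
    rw [Finset.sum_comm]
    exact Finset.sum_congr rfl fun _ _ => Finset.sum_congr rfl fun _ _ => by ring
  rw [swap]
  have hω : ∀ ω, (∑ θ : U → B, hashLaw U B θ *
      if binDecoder T θ (θ (u ω)) (z ω) ≠ u ω then 1 else 0) ≤
      (if u ω ∉ T (z ω) then 1 else 0) + τ / Fintype.card B := by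
    intro ω
    calc _ ≤ ∑ θ : U → B, hashLaw U B θ * ((if u ω ∉ T (z ω) then 1 else 0) +
          ∑ u' ∈ (T (z ω)).erase (u ω), if θ u' = θ (u ω) then 1 else 0) :=
          Finset.sum_le_sum fun θ _ => mul_le_mul_of_nonneg_left (pt θ ω) (hashLaw_nonneg θ)
      _ = (if u ω ∉ T (z ω) then 1 else 0) + ∑ u' ∈ (T (z ω)).erase (u ω),
          ∑ θ : U → B, hashLaw U B θ * if θ u' = θ (u ω) then 1 else 0 := by
          simp only [mul_add, Finset.sum_add_distrib, ← Finset.sum_mul, sum_hashLaw, one_mul,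
            Finset.mul_sum]
          rw [Finset.sum_comm]
      _ = (if u ω ∉ T (z ω) then 1 else 0) +
          ((T (z ω)).erase (u ω)).card * (Fintype.card B : ℝ)⁻¹ := by
          congr 1
          rw [Finset.sum_congr rfl fun u' hu' =>
            sum_hashLaw_collision (Finset.ne_of_mem_erase hu'), Finset.sum_const, nsmul_eq_mul]
      _ ≤ _ := by
          rw [div_eq_mul_inv]
          gcongr
          refine le_trans ?_ (hT (z ω))
          exact_mod_cast Finset.card_erase_le
  calc _ ≤ ∑ ω, q ω * ((if u ω ∉ T (z ω) then 1 else 0) + τ / Fintype.card B) :=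
        Finset.sum_le_sum fun ω _ => mul_le_mul_of_nonneg_left (hω ω) (hq ω)
    _ = _ := by
        simp only [mul_add, Finset.sum_add_distrib, ← Finset.sum_mul, hq1, one_mul]

open Classical in
/-- Privacy amplification: the bin index of a variable whose probabilities are small is nearly
uniform, on average over the binning. -/
theorem sum_hashLaw_uniformity_le {K M : ℕ} [NeZero K] [NeZero M] {W : U → ℝ}
    (hW : W ∈ stdSimplex ℝ U) {κ : ℝ} (hκ : 0 ≤ κ) :
    (∑ θ : U → Fin K × Fin M, hashLaw U (Fin K × Fin M) θ *
      ∑ k, |(K : ℝ)⁻¹ - ∑ u, if (θ u).1 = k then W u else 0|) ≤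
      √((K - 1) * κ) + 2 * ∑ u, if κ < W u then W u else 0 := by
  have hK : (0 : ℝ) < K := by exact_mod_cast NeZero.pos K
  have hM : (0 : ℝ) < M := by exact_mod_cast NeZero.pos M
  have hK1 : (1 : ℝ) ≤ K := by exact_mod_cast NeZero.pos K
  -- Truncation: the weights up to `κ` have squares summing to at most `κ`, which bounds the
  -- variance of a bin mass, while the heavy weights `W''` are charged directly, once to the uniform
  -- reference and once to the bins.
  set W' : U → ℝ := fun u => if κ < W u then 0 else W u with hW'
  set W'' : U → ℝ := fun u => if κ < W u then W u else 0 with hW''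
  have hsplit : ∀ u, W u = W' u + W'' u := by
    intro u
    simp only [hW', hW'']
    split_ifs <;> simp
  have hW'0 : ∀ u, 0 ≤ W' u := fun u => by
    simp only [hW']
    split_ifs
    exacts [le_rfl, hW.1 u]
  have hW''0 : ∀ u, 0 ≤ W'' u := fun u => by
    simp only [hW'']
    split_ifs
    exacts [hW.1 u, le_rfl]
  have hW'κ : ∀ u, W' u ^ 2 ≤ κ * W u := fun u => by
    simp only [hW']
    split_ifs with h
    · simpa using mul_nonneg hκ (hW.1 u)
    · rw [sq]
      exact mul_le_mul_of_nonneg_right (not_lt.1 h) (hW.1 u)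
  let g : Fin K → Fin K × Fin M → ℝ := fun k b => (if b.1 = k then 1 else 0) - (K : ℝ)⁻¹
  let Z : (U → Fin K × Fin M) → Fin K → ℝ := fun θ k => ∑ u, W' u * g k (θ u)
  have pt : ∀ θ : U → Fin K × Fin M, (∑ k, |(K : ℝ)⁻¹ - ∑ u, if (θ u).1 = k then W u else 0|) ≤
      ∑ k, |Z θ k| + 2 * ∑ u, W'' u := by
    intro θ
    have e1 : ∀ k, |(K : ℝ)⁻¹ - ∑ u, if (θ u).1 = k then W u else 0| ≤
        |Z θ k| + ((K : ℝ)⁻¹ * ∑ u, W'' u + ∑ u, if (θ u).1 = k then W'' u else 0) := by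
      intro k
      have e : (K : ℝ)⁻¹ - ∑ u, (if (θ u).1 = k then W u else 0) =
          -Z θ k + ((K : ℝ)⁻¹ * ∑ u, W'' u - ∑ u, if (θ u).1 = k then W'' u else 0) := by
        have h1 : (K : ℝ)⁻¹ = ∑ u, (K : ℝ)⁻¹ * W u := by rw [← Finset.mul_sum, hW.2, mul_one]
        conv_lhs => rw [h1]
        simp only [Z, g, Finset.mul_sum]
        rw [← Finset.sum_sub_distrib, ← Finset.sum_sub_distrib, ← Finset.sum_neg_distrib,
          ← Finset.sum_add_distrib]
        refine Finset.sum_congr rfl fun u _ => ?_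
        have := hsplit u
        split_ifs <;> rw [this] <;> ring
      rw [e]
      refine (abs_add_le _ _).trans ?_
      rw [abs_neg]
      gcongr
      refine (abs_sub _ _).trans (le_of_eq ?_)
      rw [abs_of_nonneg (mul_nonneg (by positivity) (Finset.sum_nonneg fun u _ => hW''0 u)),
        abs_of_nonneg (Finset.sum_nonneg fun u _ => by split_ifs; exacts [hW''0 u, le_rfl])]
    refine (Finset.sum_le_sum fun k _ => e1 k).trans (le_of_eq ?_)
    rw [Finset.sum_add_distrib, Finset.sum_add_distrib, Finset.sum_const, Finset.card_univ,
      Fintype.card_fin, nsmul_eq_mul, mul_inv_cancel_left₀ hK.ne', Finset.sum_comm]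
    simp only [Finset.sum_ite_eq, Finset.mem_univ, if_true]
    ring
  have hfst : ∀ h : Fin K → ℝ, ∑ b : Fin K × Fin M, h b.1 = M * ∑ c, h c := by
    intro h
    simp [Fintype.sum_prod_type, Finset.mul_sum]
  have hcard : (Fintype.card (Fin K × Fin M) : ℝ) = K * M := by simp
  have hmean : ∀ k : Fin K, ∑ b : Fin K × Fin M, (Fintype.card (Fin K × Fin M) : ℝ)⁻¹ * g k b = 0 := by
    intro k
    rw [← Finset.mul_sum, hfst (fun c => (if c = k then 1 else 0) - (K : ℝ)⁻¹)]
    simp [Finset.sum_sub_distrib, hK.ne']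
  have hvar : ∀ k : Fin K, ∑ b : Fin K × Fin M, (Fintype.card (Fin K × Fin M) : ℝ)⁻¹ * g k b ^ 2 =
      (K - 1) / K ^ 2 := by
    intro k
    have e : ∀ b : Fin K × Fin M, g k b ^ 2 =
        (if b.1 = k then 1 - 2 * (K : ℝ)⁻¹ else 0) + (K : ℝ)⁻¹ ^ 2 := by
      intro b
      simp only [g]
      split_ifs <;> ring
    rw [← Finset.mul_sum, Finset.sum_congr rfl fun b _ => e b,
      hfst (fun c => (if c = k then 1 - 2 * (K : ℝ)⁻¹ else 0) + (K : ℝ)⁻¹ ^ 2), hcard,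
      Finset.sum_add_distrib]
    simp only [Finset.sum_const, Finset.card_univ, Fintype.card_fin, nsmul_eq_mul,
      Finset.sum_ite_eq', Finset.mem_univ, if_true]
    field_simp
    ring
  have hZ : ∀ k, ∑ θ, hashLaw U (Fin K × Fin M) θ * Z θ k ^ 2 ≤ (K - 1) / K ^ 2 * κ := by
    intro k
    have := sum_prodLaw_sq (ι := U) (sum_uniform (B := Fin K × Fin M)) (fun u b => W' u * g k b) (by
      intro u
      have := hmean k
      calc _ = W' u * ∑ b : Fin K × Fin M, (Fintype.card (Fin K × Fin M) : ℝ)⁻¹ * g k b := by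
            rw [Finset.mul_sum]
            exact Finset.sum_congr rfl fun b _ => by ring
        _ = 0 := by rw [this, mul_zero])
    refine this.trans_le ?_
    have e : ∀ u, ∑ b : Fin K × Fin M, (Fintype.card (Fin K × Fin M) : ℝ)⁻¹ * (W' u * g k b) ^ 2 =
        W' u ^ 2 * ((K - 1) / K ^ 2) := by
      intro u
      rw [← hvar k, Finset.mul_sum]
      exact Finset.sum_congr rfl fun b _ => by ring
    rw [Finset.sum_congr rfl fun u _ => e u, ← Finset.sum_mul, mul_comm]
    refine mul_le_mul_of_nonneg_left ?_ (div_nonneg (by linarith) (by positivity))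
    refine (Finset.sum_le_sum fun u _ => hW'κ u).trans ?_
    rw [← Finset.mul_sum, hW.2, mul_one]
  -- Cauchy–Schwarz over pairs `(θ, k)`. The indicator of one bin has variance `(K - 1) / K ^ 2`, so
  -- summing over `k` and multiplying by the total mass `K` leaves `(K - 1) * κ`.
  have hmain : (∑ θ, hashLaw U (Fin K × Fin M) θ * ∑ k, |Z θ k|) ≤ √((K - 1) * κ) := by
    refine Real.le_sqrt_of_sq_le ?_
    have cs := Finset.sum_sq_le_sum_mul_sum_of_sq_le_mul
      (Finset.univ : Finset ((U → Fin K × Fin M) × Fin K))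
      (r := fun t => hashLaw U (Fin K × Fin M) t.1 * |Z t.1 t.2|)
      (f := fun t => hashLaw U (Fin K × Fin M) t.1)
      (g := fun t => hashLaw U (Fin K × Fin M) t.1 * Z t.1 t.2 ^ 2)
      (fun t _ => hashLaw_nonneg _) (fun t _ => mul_nonneg (hashLaw_nonneg _) (sq_nonneg _))
      (fun t _ => by rw [mul_pow, sq_abs]; exact le_of_eq (by ring))
    rw [Fintype.sum_prod_type, Fintype.sum_prod_type, Fintype.sum_prod_type_right] at cs
    simp only [← Finset.mul_sum, Finset.sum_const, Finset.card_univ, Fintype.card_fin,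
      nsmul_eq_mul, sum_hashLaw, mul_one] at cs
    refine cs.trans ?_
    calc (K : ℝ) * ∑ k, ∑ θ, hashLaw U (Fin K × Fin M) θ * Z θ k ^ 2
        ≤ K * ∑ _k : Fin K, ((K : ℝ) - 1) / K ^ 2 * κ := by
          gcongr with k
          exact hZ k
      _ = (K - 1) * κ := by
          rw [Finset.sum_const, Finset.card_univ, Fintype.card_fin, nsmul_eq_mul]
          field_simp
  calc _ ≤ ∑ θ, hashLaw U (Fin K × Fin M) θ * (∑ k, |Z θ k| + 2 * ∑ u, W'' u) :=
        Finset.sum_le_sum fun θ _ => mul_le_mul_of_nonneg_left (pt θ) (hashLaw_nonneg θ)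
    _ = (∑ θ, hashLaw U (Fin K × Fin M) θ * ∑ k, |Z θ k|) + 2 * ∑ u, W'' u := by
        simp only [mul_add, Finset.sum_add_distrib, ← Finset.sum_mul, sum_hashLaw, one_mul]
    _ ≤ _ := by gcongr

end Hashing

/-! ### One-shot coding by binning and derandomization -/

section OneShot

/-- A randomized encoder can be replaced by a deterministic one without increasing the cost. -/
theorem exists_deterministic {𝒮 A U : Type*} [Fintype 𝒮] [Fintype A] [Fintype U] [Nonempty U]
    (p : 𝒮 → ℝ) (α : 𝒮 → A) (E : A → U → ℝ) (hE : ∀ a, E a ∈ stdSimplex ℝ U) (c : 𝒮 → U → ℝ) :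
    ∃ e : A → U, ∑ s, p s * c s (e (α s)) ≤ ∑ s, p s * ∑ u, E (α s) u * c s u := by
  classical
  let D : A → U → ℝ := fun a u => ∑ s, if α s = a then p s * c s u else 0
  have hmin : ∀ a, ∃ u, ∀ u', D a u ≤ D a u' := fun a => Finite.exists_min (D a)
  choose e he using hmin
  refine ⟨e, ?_⟩
  have h1 : ∑ s, p s * c s (e (α s)) = ∑ a, D a (e a) := by
    simp only [D]
    rw [Finset.sum_comm]
    simp
  have h2 : ∑ s, p s * ∑ u, E (α s) u * c s u = ∑ a, ∑ u, E a u * D a u := by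
    simp only [D, Finset.mul_sum]
    rw [Finset.sum_comm]
    rw [Finset.sum_comm (s := (Finset.univ : Finset A))]
    refine Finset.sum_congr rfl fun u _ => ?_
    rw [Finset.sum_comm]
    refine Finset.sum_congr rfl fun s _ => ?_
    simp only [mul_ite, mul_zero, Finset.sum_ite_eq, Finset.mem_univ, if_true]
    ring
  rw [h1, h2]
  refine Finset.sum_le_sum fun a _ => ?_
  calc D a (e a) = ∑ u, E a u * D a (e a) := by rw [← Finset.sum_mul, (hE a).2, one_mul]
    _ ≤ _ := Finset.sum_le_sum fun u _ => mul_le_mul_of_nonneg_left (he a u) ((hE a).1 u)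

/-- The product laws are exchanged one factor at a time: `F₁F₂ - G₁G₂ = F₁(F₂ - G₂) + (F₁ - G₁)G₂`.
-/
theorem sum_mul_mul_le {𝔘 𝔙 : Type*} [Fintype 𝔘] [Fintype 𝔙] {F₁ G₁ : 𝔘 → ℝ} {F₂ G₂ : 𝔙 → ℝ}
    {c : 𝔘 → 𝔙 → ℝ} {L : ℝ} (hF0 : ∀ u, 0 ≤ F₁ u) (hF1 : ∑ u, F₁ u = 1) (hG0 : ∀ v, 0 ≤ G₂ v)
    (hG1 : ∑ v, G₂ v = 1) (hc0 : ∀ u v, 0 ≤ c u v) (hcL : ∀ u v, c u v ≤ L) :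
    ∑ u, ∑ v, F₁ u * F₂ v * c u v ≤
      ∑ u, ∑ v, G₁ u * G₂ v * c u v + L * (∑ u, |F₁ u - G₁ u| + ∑ v, |F₂ v - G₂ v|) := by
  have e : L * (∑ u, |F₁ u - G₁ u| + ∑ v, |F₂ v - G₂ v|) =
      ∑ u, ∑ v, (L * (|F₁ u - G₁ u| * G₂ v) + L * (F₁ u * |F₂ v - G₂ v|)) := by
    simp only [Finset.sum_add_distrib, ← Finset.mul_sum, hG1, mul_one, ← Finset.sum_mul, hF1,
      one_mul, mul_add]
  rw [e]
  simp only [← Finset.sum_add_distrib]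
  refine Finset.sum_le_sum fun u _ => Finset.sum_le_sum fun v _ => ?_
  have h1 : F₁ u * (F₂ v - G₂ v) * c u v ≤ L * (F₁ u * |F₂ v - G₂ v|) := by
    calc F₁ u * (F₂ v - G₂ v) * c u v ≤ F₁ u * |F₂ v - G₂ v| * c u v := by
          gcongr
          exacts [hc0 u v, hF0 u, le_abs_self _]
      _ ≤ F₁ u * |F₂ v - G₂ v| * L := by
          gcongr
          exacts [mul_nonneg (hF0 u) (abs_nonneg _), hcL u v]
      _ = _ := by ring
  have h2 : (F₁ u - G₁ u) * G₂ v * c u v ≤ L * (|F₁ u - G₁ u| * G₂ v) := by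
    calc (F₁ u - G₁ u) * G₂ v * c u v ≤ |F₁ u - G₁ u| * G₂ v * c u v := by
          gcongr
          exacts [hc0 u v, hG0 v, le_abs_self _]
      _ ≤ |F₁ u - G₁ u| * G₂ v * L := by
          gcongr
          exacts [mul_nonneg (abs_nonneg _) (hG0 v), hcL u v]
      _ = _ := by ring
  linarith

theorem exists_le_of_weighted_sum_le {H : Type*} [Fintype H] {w err : H → ℝ} {bound : ℝ}
    (hw : ∀ h, 0 ≤ w h) (hw1 : ∑ h, w h = 1) (hle : ∑ h, w h * err h ≤ bound) :
    ∃ h, err h ≤ bound := by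
  by_contra! hcon
  have hlt : ∑ h, w h * bound < ∑ h, w h * err h := by
    refine Finset.sum_lt_sum (fun h _ => mul_le_mul_of_nonneg_left (hcon h).le (hw h)) ?_
    by_contra! hno
    have hz : ∀ h, w h = 0 := fun h => by
      by_contra hne
      have := hno h (Finset.mem_univ h)
      exact absurd this (not_le.2 (mul_lt_mul_of_pos_left (hcon h)
        (lt_of_le_of_ne (hw h) (Ne.symm hne))))
    simp [hz] at hw1
  rw [← Finset.sum_mul, hw1, one_mul] at hlt
  exact absurd hle (not_le.2 hlt)

open Classical in
/-- The probability of a bin. -/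
def binProb {A U : Type*} [Fintype U] {K : ℕ} (W : A → U → ℝ) (f : U → Fin K) (a : A)
    (k : Fin K) : ℝ := ∑ u, if f u = k then W a u else 0

open Classical in
/-- The conditional law of the auxiliary variable given the observation and the bin. -/
def binEncoder {A U : Type*} [Fintype U] {K : ℕ} (W : A → U → ℝ) (f : U → Fin K) (k : Fin K)
    (a : A) (u : U) : ℝ :=
  if binProb W f a k = 0 then W a u else (if f u = k then W a u else 0) / binProb W f a k

section Bin

variable {A U : Type*} [Fintype U] {K : ℕ} {W : A → U → ℝ}

theorem binProb_nonneg (hW : ∀ a, W a ∈ stdSimplex ℝ U) (f : U → Fin K) (a : A) (k : Fin K) :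
    0 ≤ binProb W f a k :=
  Finset.sum_nonneg fun u _ => by
    split_ifs
    exacts [(hW a).1 u, le_rfl]

theorem binEncoder_mem (hW : ∀ a, W a ∈ stdSimplex ℝ U) (f : U → Fin K) (k : Fin K) (a : A) :
    binEncoder W f k a ∈ stdSimplex ℝ U := by
  classical
  have h0 := binProb_nonneg hW f a k
  by_cases h : binProb W f a k = 0
  · have : binEncoder W f k a = W a := by
      funext u
      exact if_pos h
    rw [this]
    exact hW a
  · refine ⟨fun u => ?_, ?_⟩
    · simp only [binEncoder, if_neg h]
      refine div_nonneg ?_ h0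
      split_ifs
      exacts [(hW a).1 u, le_rfl]
    · simp only [binEncoder, if_neg h]
      rw [← Finset.sum_div]
      exact div_self h

-- Drawing the bin uniformly and then `U` given the bin, or drawing `U` and reading off its bin,
-- uses the same conditional law of `U`, so the distance is that of the bin marginals. An empty bin
-- costs `1 / K` under any default pmf.
open Classical in
theorem sum_abs_binEncoder_sub [NeZero K] (hW : ∀ a, W a ∈ stdSimplex ℝ U) (f : U → Fin K) (a : A) :
    ∑ t : Fin K × U, |(K : ℝ)⁻¹ * binEncoder W f t.1 a t.2 - if f t.2 = t.1 then W a t.2 else 0| =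
      ∑ k, |(K : ℝ)⁻¹ - binProb W f a k| := by
  rw [Fintype.sum_prod_type]
  refine Finset.sum_congr rfl fun k _ => ?_
  dsimp only
  have hE := binEncoder_mem hW f k a
  by_cases h : binProb W f a k = 0
  · have hz : ∀ u, (if f u = k then W a u else 0) = 0 := by
      intro u
      have := (Finset.sum_eq_zero_iff_of_nonneg (s := Finset.univ)
        (f := fun u => if f u = k then W a u else 0) (fun u _ => by
          split_ifs
          exacts [(hW a).1 u, le_rfl])).1 h u (Finset.mem_univ u)
      exact this
    simp only [hz, h, sub_zero]
    have : ∀ u, |(K : ℝ)⁻¹ * binEncoder W f k a u| = (K : ℝ)⁻¹ * binEncoder W f k a u := fun u =>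
      abs_of_nonneg (mul_nonneg (by positivity) (hE.1 u))
    simp only [this]
    rw [← Finset.mul_sum, hE.2, mul_one, abs_of_nonneg (by positivity)]
  · have : ∀ u, (if f u = k then W a u else 0) = binProb W f a k * binEncoder W f k a u := by
      intro u
      rw [binEncoder, if_neg h, mul_div_cancel₀ _ h]
    simp only [this, ← sub_mul, abs_mul]
    have hab : ∀ u, |binEncoder W f k a u| = binEncoder W f k a u := fun u => abs_of_nonneg (hE.1 u)
    simp only [hab]
    rw [← Finset.mul_sum, hE.2, mul_one]

end Bin

variable {𝒮 A B C U V : Type*} [Fintype 𝒮] [Fintype A] [Fintype B] [Fintype U] [Fintype V]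
  [Nonempty U] [Nonempty V]

open Classical in
/-- The performance of the binning scheme for fixed binnings. -/
theorem exists_code_of_binning {p : 𝒮 → ℝ} (hp : ∀ s, 0 ≤ p s) (α : 𝒮 → A) (β : 𝒮 → B) (γ : 𝒮 → C)
    {W₁ : A → U → ℝ} {W₂ : B → V → ℝ} (hW₁ : ∀ a, W₁ a ∈ stdSimplex ℝ U)
    (hW₂ : ∀ b, W₂ b ∈ stdSimplex ℝ V) {K₁ M₁ K₂ M₂ : ℕ} [NeZero K₁] [NeZero K₂]
    (θ₁ : U → Fin K₁ × Fin M₁) (θ₂ : V → Fin K₂ × Fin M₂) (d₁ : Fin K₁ × Fin M₁ → V × C → U)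
    (d₂ : Fin K₂ × Fin M₂ → C → V) {ℓ : 𝒮 → U → V → ℝ} {L : ℝ} (hℓ0 : ∀ s u v, 0 ≤ ℓ s u v)
    (hℓL : ∀ s u v, ℓ s u v ≤ L) :
    ∃ (φ₁ : A → Fin M₁) (φ₂ : B → Fin M₂) (dec : Fin M₁ → Fin M₂ → C → U × V),
      ∑ s, p s * ℓ s (dec (φ₁ (α s)) (φ₂ (β s)) (γ s)).1 (dec (φ₁ (α s)) (φ₂ (β s)) (γ s)).2 ≤
      ∑ s, p s * ∑ u, ∑ v, W₁ (α s) u * W₂ (β s) v * (ℓ s u v +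
        L * ((if d₁ (θ₁ u) (v, γ s) ≠ u then 1 else 0) +
          if d₂ (θ₂ v) (γ s) ≠ v then 1 else 0)) +
      L * (∑ s, p s * ∑ k, |(K₁ : ℝ)⁻¹ - binProb W₁ (fun u => (θ₁ u).1) (α s) k| +
        ∑ s, p s * ∑ k, |(K₂ : ℝ)⁻¹ - binProb W₂ (fun v => (θ₂ v).1) (β s) k|) := by
  have hK₁ : (0 : ℝ) < K₁ := by exact_mod_cast NeZero.pos K₁
  have hK₂ : (0 : ℝ) < K₂ := by exact_mod_cast NeZero.pos K₂
  set f₁ : U → Fin K₁ := fun u => (θ₁ u).1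
  set f₂ : V → Fin K₂ := fun v => (θ₂ v).1
  -- Successive decoding: the second auxiliary is recovered from the side information and then
  -- serves as side information for the first.
  let dec : Fin K₁ → Fin K₂ → Fin M₁ → Fin M₂ → C → U × V := fun k₁ k₂ m₁ m₂ c =>
    (d₁ (k₁, m₁) (d₂ (k₂, m₂) c, c), d₂ (k₂, m₂) c)
  let loss : 𝒮 → Fin K₁ × U → Fin K₂ × V → ℝ := fun s t₁ t₂ =>
    ℓ s (dec t₁.1 t₂.1 (θ₁ t₁.2).2 (θ₂ t₂.2).2 (γ s)).1
      (dec t₁.1 t₂.1 (θ₁ t₁.2).2 (θ₂ t₂.2).2 (γ s)).2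
  -- The cost of the randomized scheme with frozen bin indices, known to the encoders and the
  -- decoder. Its mean over uniform indices is compared below with the ideal scheme, in which the
  -- indices are those of the auxiliaries themselves.
  let J : Fin K₁ → Fin K₂ → ℝ := fun k₁ k₂ => ∑ s, p s * ∑ u, binEncoder W₁ f₁ k₁ (α s) u *
    ∑ v, binEncoder W₂ f₂ k₂ (β s) v * loss s (k₁, u) (k₂, v)
  set R := ∑ s, p s * ∑ u, ∑ v, W₁ (α s) u * W₂ (β s) v * (ℓ s u v +
        L * ((if d₁ (θ₁ u) (v, γ s) ≠ u then 1 else 0) +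
          if d₂ (θ₂ v) (γ s) ≠ v then 1 else 0)) +
      L * (∑ s, p s * ∑ k, |(K₁ : ℝ)⁻¹ - binProb W₁ f₁ (α s) k| +
        ∑ s, p s * ∑ k, |(K₂ : ℝ)⁻¹ - binProb W₂ f₂ (β s) k|) with hR
  have havg : ∑ t : Fin K₁ × Fin K₂, J t.1 t.2 ≤ ∑ _t : Fin K₁ × Fin K₂, R := by
    have e1 : ∑ t : Fin K₁ × Fin K₂, J t.1 t.2 = (K₁ * K₂) * ∑ s, p s *
        ∑ t₁ : Fin K₁ × U, ∑ t₂ : Fin K₂ × V, ((K₁ : ℝ)⁻¹ * binEncoder W₁ f₁ t₁.1 (α s) t₁.2) *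
          ((K₂ : ℝ)⁻¹ * binEncoder W₂ f₂ t₂.1 (β s) t₂.2) * loss s t₁ t₂ := by
      simp only [J, Fintype.sum_prod_type, Finset.mul_sum]
      have e : ∀ k₁ : Fin K₁, (∑ k₂ : Fin K₂, ∑ s, ∑ u, ∑ v, p s * (binEncoder W₁ f₁ k₁ (α s) u *
          (binEncoder W₂ f₂ k₂ (β s) v * loss s (k₁, u) (k₂, v)))) = ∑ s, ∑ u, ∑ k₂, ∑ v, p s *
          (binEncoder W₁ f₁ k₁ (α s) u *
          (binEncoder W₂ f₂ k₂ (β s) v * loss s (k₁, u) (k₂, v))) := by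
        intro k₁
        rw [Finset.sum_comm]
        refine Finset.sum_congr rfl fun s _ => ?_
        rw [Finset.sum_comm]
      simp only [e]
      rw [Finset.sum_comm]
      refine Finset.sum_congr rfl fun s _ => Finset.sum_congr rfl fun k₁ _ =>
        Finset.sum_congr rfl fun u _ => Finset.sum_congr rfl fun k₂ _ =>
        Finset.sum_congr rfl fun v _ => ?_
      field_simp
    rw [e1, Finset.sum_const, Finset.card_univ, Fintype.card_prod, Fintype.card_fin,
      Fintype.card_fin, nsmul_eq_mul, Nat.cast_mul]
    refine mul_le_mul_of_nonneg_left ?_ (by positivity)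
    rw [hR, ← Finset.sum_add_distrib, Finset.mul_sum, ← Finset.sum_add_distrib]
    refine Finset.sum_le_sum fun s _ => ?_
    rw [← mul_add, mul_left_comm, ← mul_add]
    refine mul_le_mul_of_nonneg_left ?_ (hp s)
    have n1 : ∑ t₁ : Fin K₁ × U, (K₁ : ℝ)⁻¹ * binEncoder W₁ f₁ t₁.1 (α s) t₁.2 = 1 := by
      rw [Fintype.sum_prod_type]
      simp only [← Finset.mul_sum, (binEncoder_mem hW₁ f₁ _ _).2, Finset.sum_const,
        Finset.card_univ, Fintype.card_fin, nsmul_eq_mul, mul_one]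
      exact mul_inv_cancel₀ hK₁.ne'
    have n2 : ∑ t₂ : Fin K₂ × V, (if f₂ t₂.2 = t₂.1 then W₂ (β s) t₂.2 else 0) = 1 := by
      rw [Fintype.sum_prod_type_right]
      simp only [Finset.sum_ite_eq, Finset.mem_univ, if_true, (hW₂ _).2]
    have key := sum_mul_mul_le (F₁ := fun t₁ : Fin K₁ × U => (K₁ : ℝ)⁻¹ *
        binEncoder W₁ f₁ t₁.1 (α s) t₁.2)
      (G₁ := fun t₁ => if f₁ t₁.2 = t₁.1 then W₁ (α s) t₁.2 else 0)
      (F₂ := fun t₂ : Fin K₂ × V => (K₂ : ℝ)⁻¹ * binEncoder W₂ f₂ t₂.1 (β s) t₂.2)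
      (G₂ := fun t₂ => if f₂ t₂.2 = t₂.1 then W₂ (β s) t₂.2 else 0) (c := loss s) (L := L)
      (fun t => mul_nonneg (by positivity) ((binEncoder_mem hW₁ f₁ _ _).1 _)) n1
      (fun t => by
        split_ifs
        exacts [(hW₂ _).1 _, le_rfl]) n2 (fun _ _ => hℓ0 _ _ _) (fun _ _ => hℓL _ _ _)
    rw [sum_abs_binEncoder_sub hW₁, sum_abs_binEncoder_sub hW₂] at key
    refine key.trans (add_le_add ?_ (le_of_eq (by ring)))
    rw [Fintype.sum_prod_type_right]
    refine Finset.sum_le_sum fun u _ => ?_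
    have g1 : ∀ k₁ : Fin K₁, ∑ t₂ : Fin K₂ × V, (if f₁ u = k₁ then W₁ (α s) u else 0) *
        (if f₂ t₂.2 = t₂.1 then W₂ (β s) t₂.2 else 0) * loss s (k₁, u) t₂ =
        if f₁ u = k₁ then ∑ v, W₁ (α s) u * W₂ (β s) v * loss s (k₁, u) (f₂ v, v) else 0 := by
      intro k₁
      split_ifs
      · rw [Fintype.sum_prod_type_right]
        simp
      · simp
    simp only [g1, Finset.sum_ite_eq, Finset.mem_univ, if_true]
    refine Finset.sum_le_sum fun v _ => ?_
    refine mul_le_mul_of_nonneg_left ?_ (mul_nonneg ((hW₁ _).1 _) ((hW₂ _).1 _))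
    have hL : 0 ≤ L := (hℓ0 s u v).trans (hℓL s u v)
    have hle : loss s (f₁ u, u) (f₂ v, v) ≤ L := hℓL _ _ _
    have h0 := hℓ0 s u v
    by_cases c2 : d₂ (θ₂ v) (γ s) = v
    · by_cases c1 : d₁ (θ₁ u) (v, γ s) = u
      · have : loss s (f₁ u, u) (f₂ v, v) = ℓ s u v := by
          show ℓ s (d₁ (θ₁ u) (d₂ (θ₂ v) (γ s), γ s)) (d₂ (θ₂ v) (γ s)) = ℓ s u v
          rw [c2, c1]
        rw [this]
        simp [c1, c2]
      · simp only [ne_eq, c1, c2, not_true, not_false_iff, if_true, if_false]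
        linarith
    · have : (0 : ℝ) ≤ if d₁ (θ₁ u) (v, γ s) ≠ u then 1 else 0 := by split_ifs <;> norm_num
      rw [if_pos c2]
      nlinarith
  -- Some pair of indices does no worse than the average; fixing it costs no rate. The private
  -- randomness of the encoders is then removed, one encoder at a time.
  obtain ⟨⟨k₁, k₂⟩, -, hk⟩ := Finset.exists_le_of_sum_le
    ⟨((0 : Fin K₁), (0 : Fin K₂)), Finset.mem_univ _⟩ havg
  obtain ⟨e₁, he₁⟩ := exists_deterministic p α (binEncoder W₁ f₁ k₁) (binEncoder_mem hW₁ f₁ k₁)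
    (fun s u => ∑ v, binEncoder W₂ f₂ k₂ (β s) v * loss s (k₁, u) (k₂, v))
  obtain ⟨e₂, he₂⟩ := exists_deterministic p β (binEncoder W₂ f₂ k₂) (binEncoder_mem hW₂ f₂ k₂)
    (fun s v => loss s (k₁, e₁ (α s)) (k₂, v))
  exact ⟨fun a => (θ₁ (e₁ a)).2, fun b => (θ₂ (e₂ b)).2, dec k₁ k₂, (he₂.trans he₁).trans hk⟩

open Classical in
/-- One-shot achievability: two encoders, of which the second is decoded first. -/
theorem exists_one_shot_code {p : 𝒮 → ℝ} (hp : p ∈ stdSimplex ℝ 𝒮) (α : 𝒮 → A) (β : 𝒮 → B)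
    (γ : 𝒮 → C) {W₁ : A → U → ℝ} {W₂ : B → V → ℝ} (hW₁ : ∀ a, W₁ a ∈ stdSimplex ℝ U)
    (hW₂ : ∀ b, W₂ b ∈ stdSimplex ℝ V) {K₁ M₁ K₂ M₂ : ℕ} [NeZero K₁] [NeZero K₂] [NeZero M₁]
    [NeZero M₂] (T₁ : V × C → Finset U) (T₂ : C → Finset V) {τ₁ τ₂ κ₁ κ₂ : ℝ}
    (hT₁ : ∀ z, ((T₁ z).card : ℝ) ≤ τ₁) (hT₂ : ∀ z, ((T₂ z).card : ℝ) ≤ τ₂) (hκ₁ : 0 ≤ κ₁)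
    (hκ₂ : 0 ≤ κ₂) {ℓ : 𝒮 → U → V → ℝ} {L : ℝ} (hL : 0 ≤ L) (hℓ0 : ∀ s u v, 0 ≤ ℓ s u v)
    (hℓL : ∀ s u v, ℓ s u v ≤ L) :
    ∃ (φ₁ : A → Fin M₁) (φ₂ : B → Fin M₂) (dec : Fin M₁ → Fin M₂ → C → U × V),
      ∑ s, p s * ℓ s (dec (φ₁ (α s)) (φ₂ (β s)) (γ s)).1 (dec (φ₁ (α s)) (φ₂ (β s)) (γ s)).2 ≤
      ∑ t : 𝒮 × U × V, p t.1 * W₁ (α t.1) t.2.1 * W₂ (β t.1) t.2.2 * ℓ t.1 t.2.1 t.2.2 +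
      L * (((∑ t : 𝒮 × U × V, p t.1 * W₁ (α t.1) t.2.1 * W₂ (β t.1) t.2.2 *
            if t.2.1 ∉ T₁ (t.2.2, γ t.1) then 1 else 0) + τ₁ / (K₁ * M₁) + √((K₁ - 1) * κ₁) +
          2 * ∑ t : 𝒮 × U × V, p t.1 * W₁ (α t.1) t.2.1 * W₂ (β t.1) t.2.2 *
            if κ₁ < W₁ (α t.1) t.2.1 then 1 else 0) +
        ((∑ t : 𝒮 × U × V, p t.1 * W₁ (α t.1) t.2.1 * W₂ (β t.1) t.2.2 *
            if t.2.2 ∉ T₂ (γ t.1) then 1 else 0) + τ₂ / (K₂ * M₂) + √((K₂ - 1) * κ₂) +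
          2 * ∑ t : 𝒮 × U × V, p t.1 * W₁ (α t.1) t.2.1 * W₂ (β t.1) t.2.2 *
            if κ₂ < W₂ (β t.1) t.2.2 then 1 else 0)) := by
  set q : 𝒮 × U × V → ℝ := fun t => p t.1 * W₁ (α t.1) t.2.1 * W₂ (β t.1) t.2.2 with hq
  have hq0 : ∀ t, 0 ≤ q t := fun t =>
    mul_nonneg (mul_nonneg (hp.1 _) ((hW₁ _).1 _)) ((hW₂ _).1 _)
  have hqs : ∀ g : 𝒮 × U × V → ℝ, ∑ t, q t * g t =
      ∑ s, p s * ∑ u, ∑ v, W₁ (α s) u * W₂ (β s) v * g (s, u, v) := by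
    intro g
    simp only [hq, Fintype.sum_prod_type, Finset.mul_sum]
    refine Finset.sum_congr rfl fun s _ => Finset.sum_congr rfl fun u _ =>
      Finset.sum_congr rfl fun v _ => by ring
  have hq1 : ∑ t, q t = 1 := by
    have := hqs (fun _ => 1)
    simp only [mul_one, ← Finset.mul_sum, (hW₂ _).2, (hW₁ _).2, hp.2] at this
    exact this
  have c₁ : (Fintype.card (Fin K₁ × Fin M₁) : ℝ) = K₁ * M₁ := by simp
  have c₂ : (Fintype.card (Fin K₂ × Fin M₂) : ℝ) = K₂ * M₂ := by simp
  -- The error of the first decoder is measured with the true second auxiliary as side information,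
  -- so it does not involve `θ₂` and the two hashes can be chosen separately.
  obtain ⟨θ₁, hθ₁⟩ := exists_le_of_weighted_sum_le
    (w := hashLaw U (Fin K₁ × Fin M₁))
    (err := fun θ => (∑ t, q t * if binDecoder T₁ θ (θ t.2.1) (t.2.2, γ t.1) ≠ t.2.1 then 1 else 0) +
      ∑ s, p s * ∑ k, |(K₁ : ℝ)⁻¹ - binProb W₁ (fun u => (θ u).1) (α s) k|)
    (bound := (∑ t, q t * if t.2.1 ∉ T₁ (t.2.2, γ t.1) then 1 else 0) + τ₁ / (K₁ * M₁) +
      √((K₁ - 1) * κ₁) + 2 * ∑ t, q t * if κ₁ < W₁ (α t.1) t.2.1 then 1 else 0)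
    hashLaw_nonneg sum_hashLaw (by
      have h1 := sum_hashLaw_error_le (B := Fin K₁ × Fin M₁) hq0 hq1 (fun t => t.2.1)
        (fun t => (t.2.2, γ t.1)) T₁ hT₁
      have h2 : (∑ θ, hashLaw U (Fin K₁ × Fin M₁) θ *
          ∑ s, p s * ∑ k, |(K₁ : ℝ)⁻¹ - binProb W₁ (fun u => (θ u).1) (α s) k|) ≤
          √((K₁ - 1) * κ₁) + 2 * ∑ t, q t * if κ₁ < W₁ (α t.1) t.2.1 then 1 else 0 := by
        have e : (√((K₁ - 1) * κ₁) + 2 * ∑ t, q t * if κ₁ < W₁ (α t.1) t.2.1 then 1 else 0) =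
            ∑ s, p s * (√((K₁ - 1) * κ₁) +
              2 * ∑ u, if κ₁ < W₁ (α s) u then W₁ (α s) u else 0) := by
          rw [hqs]
          simp only [mul_add, Finset.sum_add_distrib, ← Finset.sum_mul, hp.2, one_mul,
            Finset.mul_sum, mul_ite, mul_one, mul_zero]
          congr 1
          refine Finset.sum_congr rfl fun s _ => Finset.sum_congr rfl fun u _ => ?_
          split_ifs
          · simp only [← Finset.mul_sum, (hW₂ _).2]
            ring
          · simp
        rw [e]
        simp only [Finset.mul_sum (s := (Finset.univ : Finset 𝒮))]
        rw [Finset.sum_comm]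
        refine Finset.sum_le_sum fun s _ => ?_
        have := mul_le_mul_of_nonneg_left
          (sum_hashLaw_uniformity_le (K := K₁) (M := M₁) (hW₁ (α s)) hκ₁) (hp.1 s)
        refine le_trans (le_of_eq ?_) this
        rw [Finset.mul_sum]
        exact Finset.sum_congr rfl fun θ _ => mul_left_comm _ _ _
      rw [c₁] at h1
      simp only [mul_add, Finset.sum_add_distrib]
      linarith)
  obtain ⟨θ₂, hθ₂⟩ := exists_le_of_weighted_sum_le
    (w := hashLaw V (Fin K₂ × Fin M₂))
    (err := fun θ => (∑ t, q t * if binDecoder T₂ θ (θ t.2.2) (γ t.1) ≠ t.2.2 then 1 else 0) +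
      ∑ s, p s * ∑ k, |(K₂ : ℝ)⁻¹ - binProb W₂ (fun v => (θ v).1) (β s) k|)
    (bound := (∑ t, q t * if t.2.2 ∉ T₂ (γ t.1) then 1 else 0) + τ₂ / (K₂ * M₂) +
      √((K₂ - 1) * κ₂) + 2 * ∑ t, q t * if κ₂ < W₂ (β t.1) t.2.2 then 1 else 0)
    hashLaw_nonneg sum_hashLaw (by
      have h1 := sum_hashLaw_error_le (B := Fin K₂ × Fin M₂) hq0 hq1 (fun t => t.2.2)
        (fun t => γ t.1) T₂ hT₂
      have h2 : (∑ θ, hashLaw V (Fin K₂ × Fin M₂) θ *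
          ∑ s, p s * ∑ k, |(K₂ : ℝ)⁻¹ - binProb W₂ (fun v => (θ v).1) (β s) k|) ≤
          √((K₂ - 1) * κ₂) + 2 * ∑ t, q t * if κ₂ < W₂ (β t.1) t.2.2 then 1 else 0 := by
        have e : (√((K₂ - 1) * κ₂) + 2 * ∑ t, q t * if κ₂ < W₂ (β t.1) t.2.2 then 1 else 0) =
            ∑ s, p s * (√((K₂ - 1) * κ₂) +
              2 * ∑ v, if κ₂ < W₂ (β s) v then W₂ (β s) v else 0) := by
          rw [hqs]
          simp only [mul_add, Finset.sum_add_distrib, ← Finset.sum_mul, hp.2, one_mul,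
            Finset.mul_sum, mul_ite, mul_one, mul_zero]
          congr 1
          refine Finset.sum_congr rfl fun s _ => ?_
          rw [Finset.sum_comm]
          refine Finset.sum_congr rfl fun v _ => ?_
          split_ifs
          · simp only [← Finset.mul_sum, ← Finset.sum_mul, (hW₁ _).2]
            ring
          · simp
        rw [e]
        simp only [Finset.mul_sum (s := (Finset.univ : Finset 𝒮))]
        rw [Finset.sum_comm]
        refine Finset.sum_le_sum fun s _ => ?_
        have := mul_le_mul_of_nonneg_left
          (sum_hashLaw_uniformity_le (K := K₂) (M := M₂) (hW₂ (β s)) hκ₂) (hp.1 s)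
        refine le_trans (le_of_eq ?_) this
        rw [Finset.mul_sum]
        exact Finset.sum_congr rfl fun θ _ => mul_left_comm _ _ _
      rw [c₂] at h1
      simp only [mul_add, Finset.sum_add_distrib]
      linarith)
  obtain ⟨φ₁, φ₂, dec, h⟩ := exists_code_of_binning hp.1 α β γ hW₁ hW₂ θ₁ θ₂ (binDecoder T₁ θ₁)
    (binDecoder T₂ θ₂) hℓ0 hℓL
  refine ⟨φ₁, φ₂, dec, h.trans ?_⟩
  rw [← hqs (fun t => ℓ t.1 t.2.1 t.2.2 +
        L * ((if binDecoder T₁ θ₁ (θ₁ t.2.1) (t.2.2, γ t.1) ≠ t.2.1 then 1 else 0) +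
          if binDecoder T₂ θ₂ (θ₂ t.2.2) (γ t.1) ≠ t.2.2 then 1 else 0))]
  have e : ∑ t, q t * (ℓ t.1 t.2.1 t.2.2 +
        L * ((if binDecoder T₁ θ₁ (θ₁ t.2.1) (t.2.2, γ t.1) ≠ t.2.1 then 1 else 0) +
          if binDecoder T₂ θ₂ (θ₂ t.2.2) (γ t.1) ≠ t.2.2 then 1 else 0)) =
      ∑ t, q t * ℓ t.1 t.2.1 t.2.2 + L *
        ((∑ t, q t * if binDecoder T₁ θ₁ (θ₁ t.2.1) (t.2.2, γ t.1) ≠ t.2.1 then 1 else 0) +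
        ∑ t, q t * if binDecoder T₂ θ₂ (θ₂ t.2.2) (γ t.1) ≠ t.2.2 then 1 else 0) := by
    rw [← Finset.sum_add_distrib, Finset.mul_sum, ← Finset.sum_add_distrib]
    exact Finset.sum_congr rfl fun t _ => by ring
  rw [e, add_assoc, ← mul_add]
  refine add_le_add le_rfl (mul_le_mul_of_nonneg_left ?_ hL)
  exact (le_of_eq (by ring)).trans (add_le_add hθ₁ hθ₂)

end OneShot

/-! ### Typical sequences and bin sizes -/

section Typicality

variable {T : Type*} [Fintype T] {J : T → ℝ} {c : T → ℝ} {n : ℕ} {H δ : ℝ}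

open Classical in
/-- Memberships which force a deviation of the empirical log-likelihood are unlikely. -/
theorem sum_prodLaw_le_of_deviation (hJ0 : ∀ t, 0 ≤ J t) (hJ1 : ∑ t, J t = 1)
    (hc : ∀ t, 0 < J t → 0 < c t) (hH : H = -∑ t, J t * Real.log (c t)) (hn : 0 < n) (hδ : 0 < δ)
    (E : (Fin n → T) → Prop)
    (hE : ∀ r, E r → (∏ i, c (r i) = Real.exp (∑ i, Real.log (c (r i)))) →
      n * δ ≤ |∑ i, -Real.log (c (r i)) - n * H|) :
    (∑ r, prodLaw (Fin n) J r * if E r then 1 else 0) ≤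
      (∑ t, J t * (-Real.log (c t) - H) ^ 2) / (n * δ ^ 2) := by
  have hH' : H = ∑ t, J t * -Real.log (c t) := by
    rw [hH, ← Finset.sum_neg_distrib]
    simp only [mul_neg]
  have key := sum_prodLaw_deviation_le hn hJ0 hJ1 (fun t => -Real.log (c t)) hδ
  rw [← hH'] at key
  refine le_trans (Finset.sum_le_sum fun r _ => ?_) key
  rcases (prodLaw_nonneg (ι := Fin n) hJ0 r).eq_or_lt with h0 | h0
  · simp [← h0]
  · refine mul_le_mul_of_nonneg_left ?_ h0.le
    by_cases hEr : E r
    · have hpos : ∀ i, 0 < c (r i) := fun i => hc _ (lt_of_le_of_ne (hJ0 _) fun h => by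
        rw [prodLaw, Finset.prod_eq_zero (Finset.mem_univ i) h.symm] at h0
        exact lt_irrefl _ h0)
      have := hE r hEr (by
        rw [Real.exp_sum]
        exact Finset.prod_congr rfl fun i _ => (Real.exp_log (hpos i)).symm)
      rw [if_pos hEr, if_pos]
      simpa [Finset.sum_sub_distrib] using this
    · rw [if_neg hEr]
      split_ifs <;> norm_num

open Classical in
theorem sum_prodLaw_prod_lt_exp_le (hJ0 : ∀ t, 0 ≤ J t) (hJ1 : ∑ t, J t = 1)
    (hc : ∀ t, 0 < J t → 0 < c t) (hH : H = -∑ t, J t * Real.log (c t)) (hn : 0 < n) (hδ : 0 < δ) :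
    (∑ r, prodLaw (Fin n) J r *
      if ∏ i, c (r i) < Real.exp (-(n * (H + δ))) then 1 else 0) ≤
      (∑ t, J t * (-Real.log (c t) - H) ^ 2) / (n * δ ^ 2) := by
  refine sum_prodLaw_le_of_deviation hJ0 hJ1 hc hH hn hδ _ fun r hr he => ?_
  rw [he, Real.exp_lt_exp] at hr
  rw [Finset.sum_neg_distrib]
  refine le_trans ?_ (le_abs_self _)
  linarith

open Classical in
theorem sum_prodLaw_exp_lt_prod_le (hJ0 : ∀ t, 0 ≤ J t) (hJ1 : ∑ t, J t = 1)
    (hc : ∀ t, 0 < J t → 0 < c t) (hH : H = -∑ t, J t * Real.log (c t)) (hn : 0 < n) (hδ : 0 < δ) :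
    (∑ r, prodLaw (Fin n) J r *
      if Real.exp (-(n * (H - δ))) < ∏ i, c (r i) then 1 else 0) ≤
      (∑ t, J t * (-Real.log (c t) - H) ^ 2) / (n * δ ^ 2) := by
  refine sum_prodLaw_le_of_deviation hJ0 hJ1 hc hH hn hδ _ fun r hr he => ?_
  rw [he, Real.exp_lt_exp] at hr
  rw [Finset.sum_neg_distrib]
  refine le_trans ?_ (neg_le_abs _)
  linarith

/-- The conditional pmf of `f` given `g`. -/
def condLaw {α β : Type*} (J : T → ℝ) (f : T → α) (g : T → β) (b : β) (a : α) : ℝ :=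
  law J (fun t => (f t, g t)) (a, b) / law J g b

theorem condLaw_nonneg {α β : Type*} (hJ0 : ∀ t, 0 ≤ J t) (f : T → α) (g : T → β) (b : β) (a : α) :
    0 ≤ condLaw J f g b a := div_nonneg (law_nonneg hJ0 _ _) (law_nonneg hJ0 _ _)

theorem condLaw_pos {α β : Type*} (hJ0 : ∀ t, 0 ≤ J t) (f : T → α) (g : T → β) {t : T}
    (ht : 0 < J t) : 0 < condLaw J f g (g t) (f t) :=
  div_pos (ht.trans_le (le_law hJ0 (fun t => (f t, g t)) t)) (ht.trans_le (le_law hJ0 g t))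

theorem sum_condLaw_le {α β : Type*} [Fintype α] (f : T → α) (g : T → β) (b : β) :
    ∑ a, condLaw J f g b a ≤ 1 := by
  unfold condLaw
  rw [← Finset.sum_div, sum_law_pair]
  exact div_self_le_one _

theorem cent_eq_sum_condLaw {α β : Type*} [Fintype α] [Fintype β] (hJ0 : ∀ t, 0 ≤ J t) (f : T → α)
    (g : T → β) : cent J f g = -∑ t, J t * Real.log (condLaw J f g (g t) (f t)) := by
  rw [← condEntropy_eq_cent hJ0, condEntropy_eq_sum]
  rfl

open Classical in
/-- The sequences whose conditional probability given `z` is at least `κ`. -/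
def likelySet {α β : Type*} [Fintype α] (c : β → α → ℝ) (κ : ℝ) (z : Fin n → β) :
    Finset (Fin n → α) := Finset.univ.filter fun u : Fin n → α => κ ≤ ∏ i, c (z i) (u i)

theorem card_likelySet_le {α β : Type*} [Fintype α] {c : β → α → ℝ} (hc0 : ∀ b a, 0 ≤ c b a)
    (hc1 : ∀ b, ∑ a, c b a ≤ 1) {κ : ℝ} (hκ : 0 < κ) (z : Fin n → β) :
    ((likelySet c κ z).card : ℝ) ≤ κ⁻¹ := by
  classical
  rw [← one_div, le_div_iff₀ hκ]
  calc ((likelySet c κ z).card : ℝ) * κ = ∑ u ∈ likelySet c κ z, κ := by simp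
    _ ≤ ∑ u ∈ likelySet c κ z, ∏ i, c (z i) (u i) := Finset.sum_le_sum fun u hu => by
        simpa [likelySet] using hu
    _ ≤ ∑ u : Fin n → α, ∏ i, c (z i) (u i) := Finset.sum_le_univ_sum_of_nonneg fun u =>
        Finset.prod_nonneg fun i _ => hc0 _ _
    _ = ∏ i, ∑ a, c (z i) a := sum_pi_prod fun i a => c (z i) a
    _ ≤ 1 := Finset.prod_le_one (fun i _ => Finset.sum_nonneg fun a _ => hc0 _ _)
        fun i _ => hc1 _

/-- Sizes of the bins. -/
theorem exists_bin_sizes {H' H R δ : ℝ} (hδ : 0 < δ) (hR : H' - H ≤ R) (hR0 : 0 ≤ R) {n : ℕ}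
    (hn : 0 < n) :
    ∃ K M : ℕ, 0 < K ∧ 0 < M ∧
      Real.exp (n * (H' + δ)) / (K * M) ≤ 1 / (n * δ) ∧
      √((K - 1) * Real.exp (-(n * (H - δ)))) ≤ 2 / (n * δ) ∧
      Real.log M / n ≤ R + 4 * δ + 1 / n := by
  have hn' : (0 : ℝ) < n := by exact_mod_cast hn
  have hexp : ∀ x : ℝ, 0 < x → Real.exp (-x) ≤ 1 / x := fun x hx => by
    rw [Real.exp_neg, ← one_div]
    exact one_div_le_one_div_of_le hx (by linarith [Real.add_one_le_exp x])
  -- The number `K` of frozen indices stays below `exp (n * (H - δ))`, up to rounding, which gives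
  -- near uniformity; `K * M` exceeds `exp (n * (H' + δ))` by a factor of at least `exp (n * δ)`,
  -- which gives decodability. Rounding `K` up keeps `K - 1 < x` even when `x` is small, and `M ≤ 2
  -- * y` accounts for the term `1 / n`.
  set x := Real.exp (n * (H - 2 * δ)) with hx
  set y := Real.exp (n * (R + 4 * δ)) with hy
  have hx0 : 0 < x := Real.exp_pos _
  have hy0 : 0 < y := Real.exp_pos _
  have hy1 : 1 ≤ y := Real.one_le_exp (by positivity)
  have hK : x ≤ (⌈x⌉₊ : ℝ) := Nat.le_ceil x
  have hK' : (⌈x⌉₊ : ℝ) < x + 1 := Nat.ceil_lt_add_one hx0.le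
  have hM : y ≤ ((⌊y⌋₊ + 1 : ℕ) : ℝ) := by
    push_cast
    exact (Nat.lt_floor_add_one y).le
  have hM' : ((⌊y⌋₊ + 1 : ℕ) : ℝ) ≤ 2 * y := by
    push_cast
    linarith [Nat.floor_le hy0.le]
  refine ⟨⌈x⌉₊, ⌊y⌋₊ + 1, Nat.ceil_pos.2 hx0, Nat.succ_pos _, ?_, ?_, ?_⟩
  · calc _ ≤ Real.exp (n * (H' + δ)) / (x * y) := by gcongr
      _ = Real.exp (n * (H' + δ) - (n * (H - 2 * δ) + n * (R + 4 * δ))) := by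
          rw [Real.exp_sub, Real.exp_add]
      _ ≤ Real.exp (-(n * δ)) := Real.exp_le_exp.2 (by nlinarith)
      _ ≤ _ := hexp _ (by positivity)
  · calc _ ≤ √(x * Real.exp (-(n * (H - δ)))) := by
          gcongr
          linarith
      _ = √(Real.exp (-(n * δ / 2)) ^ 2) := by
          rw [hx, ← Real.exp_add, ← Real.exp_nat_mul]
          congr 2
          push_cast
          ring
      _ = Real.exp (-(n * δ / 2)) := Real.sqrt_sq (Real.exp_pos _).le
      _ ≤ 1 / (n * δ / 2) := hexp _ (by positivity)
      _ = _ := by field_simp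
  · rw [div_le_iff₀ hn']
    calc Real.log ((⌊y⌋₊ + 1 : ℕ) : ℝ) ≤ Real.log (2 * y) :=
          Real.log_le_log (by positivity) hM'
      _ = Real.log 2 + n * (R + 4 * δ) := by
          rw [Real.log_mul (by norm_num) hy0.ne', hy, Real.log_exp]
      _ ≤ 1 + n * (R + 4 * δ) := by linarith [Real.log_two_lt_d9]
      _ = _ := by field_simp; ring

open Classical in
/-- Bins and typical sets for one encoder, such that all error terms vanish. -/
theorem exists_binning {α β : Type*} [Fintype α] [Fintype β] (hJ0 : ∀ t, 0 ≤ J t)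
    (hJ1 : ∑ t, J t = 1) (f : T → α) (g : T → β) (hc : ∀ t, 0 < J t → 0 < c t) {R : ℝ}
    (hδ : 0 < δ) (hR : cent J f g - -∑ t, J t * Real.log (c t) ≤ R) (hR0 : 0 ≤ R) :
    ∃ C : ℝ, ∀ n : ℕ, 0 < n → ∃ (K M : ℕ) (S : (Fin n → β) → Finset (Fin n → α)) (τ κ : ℝ),
      0 < K ∧ 0 < M ∧ 0 ≤ κ ∧ (∀ z, ((S z).card : ℝ) ≤ τ) ∧
      Real.log M / n ≤ R + 4 * δ + 1 / n ∧
      (∑ r, prodLaw (Fin n) J r *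
          if (fun i => f (r i)) ∉ S (fun i => g (r i)) then 1 else 0) + τ / (K * M) +
        √((K - 1) * κ) +
        2 * (∑ r, prodLaw (Fin n) J r * if κ < ∏ i, c (r i) then 1 else 0) ≤ C / n := by
  set H := cent J f g with hH
  set G := -∑ t, J t * Real.log (c t) with hG
  refine ⟨(∑ t, J t * (-Real.log (condLaw J f g (g t) (f t)) - H) ^ 2) / δ ^ 2 + 1 / δ + 2 / δ +
    2 * ((∑ t, J t * (-Real.log (c t) - G) ^ 2) / δ ^ 2), fun n hn => ?_⟩
  have hn' : (0 : ℝ) < n := by exact_mod_cast hn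
  obtain ⟨K, M, hK, hM, h1, h2, h3⟩ := exists_bin_sizes hδ hR hR0 hn
  refine ⟨K, M, likelySet (condLaw J f g) (Real.exp (-(n * (H + δ)))), Real.exp (n * (H + δ)),
    Real.exp (-(n * (G - δ))), hK, hM, (Real.exp_pos _).le, fun z => ?_, h3, ?_⟩
  · have := card_likelySet_le (condLaw_nonneg hJ0 f g) (sum_condLaw_le f g)
      (Real.exp_pos (-(n * (H + δ)))) z
    rwa [← Real.exp_neg, neg_neg] at this
  · have h4 := sum_prodLaw_prod_lt_exp_le (c := fun t => condLaw J f g (g t) (f t)) hJ0 hJ1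
      (fun t ht => condLaw_pos hJ0 f g ht) (cent_eq_sum_condLaw hJ0 f g) hn hδ
    have h5 := sum_prodLaw_exp_lt_prod_le hJ0 hJ1 hc hG hn hδ
    have h6 : (∑ r, prodLaw (Fin n) J r * if (fun i => f (r i)) ∉
        likelySet (condLaw J f g) (Real.exp (-(n * (H + δ)))) (fun i => g (r i)) then 1 else 0) =
        ∑ r, prodLaw (Fin n) J r *
          if ∏ i, condLaw J f g (g (r i)) (f (r i)) < Real.exp (-(n * (H + δ))) then 1 else 0 :=
      Finset.sum_congr rfl fun r _ => congrArg _ (if_congr (by simp [likelySet]) rfl rfl)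
    rw [h6]
    rw [← hH] at h4
    refine (add_le_add (add_le_add (add_le_add h4 h1) h2)
      (mul_le_mul_of_nonneg_left h5 zero_le_two)).trans (le_of_eq (by field_simp))

end Typicality

/-! ### Estimates bounded away from zero -/

section Smoothing

variable {T α β : Type*} [Fintype T] [Fintype α] {J : T → ℝ} {η : ℝ}

open Classical in
/-- The conditional pmf mixed with the uniform one. -/
def smoothLaw (J : T → ℝ) (f : T → α) (g : T → β) (η : ℝ) (b : β) (a : α) : ℝ :=
  if law J g b = 0 then (Fintype.card α : ℝ)⁻¹
  else (1 - η) * condLaw J f g b a + η * (Fintype.card α : ℝ)⁻¹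

variable [Nonempty α]

theorem smoothLaw_mem (hJ0 : ∀ t, 0 ≤ J t) (f : T → α) (g : T → β) (hη0 : 0 < η) (hη1 : η < 1)
    (b : β) : smoothLaw J f g η b ∈ stdSimplex ℝ α := by
  have hc : ∑ _a : α, (Fintype.card α : ℝ)⁻¹ = 1 := by simp
  by_cases h : law J g b = 0
  · have : smoothLaw J f g η b = fun _ => (Fintype.card α : ℝ)⁻¹ := by
      funext a
      exact if_pos h
    rw [this]
    exact ⟨fun a => by positivity, hc⟩
  · have : smoothLaw J f g η b =
        fun a => (1 - η) * condLaw J f g b a + η * (Fintype.card α : ℝ)⁻¹ := by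
      funext a
      exact if_neg h
    rw [this]
    refine ⟨fun a => add_nonneg (mul_nonneg (by linarith) (condLaw_nonneg hJ0 _ _ _ _))
      (by positivity), ?_⟩
    rw [Finset.sum_add_distrib, ← Finset.mul_sum, ← Finset.mul_sum, hc]
    unfold condLaw
    rw [← Finset.sum_div, sum_law_pair, div_self h]
    ring

/-- This caps the logarithmic loss, so that rare decoding failures have a small effect on the
expected loss. -/
theorem le_smoothLaw (hJ0 : ∀ t, 0 ≤ J t) (f : T → α) (g : T → β) (hη1 : η < 1)
    (b : β) (a : α) : η * (Fintype.card α : ℝ)⁻¹ ≤ smoothLaw J f g η b a := by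
  unfold smoothLaw
  split_ifs
  · exact mul_le_of_le_one_left (by positivity) hη1.le
  · exact le_add_of_nonneg_left (mul_nonneg (by linarith) (condLaw_nonneg hJ0 _ _ _ _))

/-- On the support the smoothed estimate is at least `1 - η` times the true conditional probability,
which costs at most `-log (1 - η)` per letter. -/
theorem neg_sum_log_smoothLaw_le [Fintype β] (hJ0 : ∀ t, 0 ≤ J t) (hJ1 : ∑ t, J t = 1) (f : T → α)
    (g : T → β) (hη0 : 0 < η) (hη1 : η < 1) :
    ∑ t, J t * -Real.log (smoothLaw J f g η (g t) (f t)) ≤ cent J f g - Real.log (1 - η) := by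
  have e : cent J f g - Real.log (1 - η) =
      ∑ t, J t * (-Real.log (condLaw J f g (g t) (f t)) - Real.log (1 - η)) := by
    rw [cent_eq_sum_condLaw hJ0]
    simp only [mul_sub, Finset.sum_sub_distrib, ← Finset.sum_mul, hJ1, one_mul, mul_neg,
      Finset.sum_neg_distrib]
  rw [e]
  refine Finset.sum_le_sum fun t _ => ?_
  rcases (hJ0 t).eq_or_lt with h | h
  · simp [← h]
  refine mul_le_mul_of_nonneg_left ?_ h.le
  have hpos := condLaw_pos hJ0 f g h
  have hg : law J g (g t) ≠ 0 := (h.trans_le (le_law hJ0 g t)).ne'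
  have h1 : 0 < 1 - η := by linarith
  rw [← neg_add', neg_le_neg_iff, ← Real.log_mul hpos.ne' h1.ne']
  refine Real.log_le_log (by positivity) ?_
  rw [smoothLaw, if_neg hg, mul_comm]
  exact le_add_of_nonneg_right (by positivity)

end Smoothing

/-! ### Achievability of one decoding order -/

section Achievability

variable {𝒳 𝒴₀ 𝒴₁ 𝒴₂ : Type*} [Fintype 𝒳] [Fintype 𝒴₀] [Fintype 𝒴₁] [Fintype 𝒴₂] {m₁ m₂ : ℕ}
variable {P : 𝒳 × 𝒴₀ × 𝒴₁ × 𝒴₂ → ℝ} {W₁ : 𝒴₁ → Fin m₁ → ℝ} {W₂ : 𝒴₂ → Fin m₂ → ℝ}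

theorem logLoss_of_pos {q : 𝒳 → ℝ} {x : 𝒳} (h : 0 < q x) :
    logLoss q x = ENNReal.ofReal (-Real.log (q x)) := by
  rw [logLoss, if_neg h.ne', one_div, Real.log_inv]

/-- For estimates without zeros the expected loss is a finite real number. -/
theorem expectedLoss_eq_ofReal (hP : ∀ s, 0 ≤ P s) {n M₁ M₂ : ℕ} (hn : 0 < n)
    (φ₁ : (Fin n → 𝒴₁) → Fin M₁) (φ₂ : (Fin n → 𝒴₂) → Fin M₂)
    {ψ : Fin M₁ → Fin M₂ → (Fin n → 𝒴₀) → Fin n → 𝒳 → ℝ}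
    (hψ : ∀ a b y i, ψ a b y i ∈ stdSimplex ℝ 𝒳) (hpos : ∀ a b y i x, 0 < ψ a b y i x) :
    expectedLoss P φ₁ φ₂ ψ = ENNReal.ofReal (∑ s, prodLaw (Fin n) P s *
      ((∑ i, -Real.log (ψ (φ₁ fun j => (s j).2.2.1) (φ₂ fun j => (s j).2.2.2)
        (fun j => (s j).2.1) i (s i).1)) / n)) := by
  have hn' : (0 : ℝ) < n := by exact_mod_cast hn
  have hlog : ∀ a b y i x, 0 ≤ -Real.log (ψ a b y i x) := fun a b y i x =>
    neg_nonneg.2 (Real.log_nonpos (hpos a b y i x).le (by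
      rw [← (hψ a b y i).2]
      exact Finset.single_le_sum (fun x _ => (hψ a b y i).1 x) (Finset.mem_univ x)))
  unfold expectedLoss
  rw [ENNReal.ofReal_sum_of_nonneg fun s _ => mul_nonneg (prodLaw_nonneg hP s)
    (div_nonneg (Finset.sum_nonneg fun i _ => hlog _ _ _ _ _) hn'.le)]
  refine Finset.sum_congr rfl fun s _ => ?_
  rw [ENNReal.ofReal_mul (prodLaw_nonneg hP s), ENNReal.ofReal_div_of_pos hn',
    ENNReal.ofReal_natCast, ENNReal.ofReal_sum_of_nonneg fun i _ => hlog _ _ _ _ _]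
  simp only [logLoss_of_pos (hpos _ _ _ _ _), prodLaw]

/-- The law of the sources and the auxiliary sequences, as a product law. -/
theorem sum_blocks {n : ℕ} (g : (Fin n → 𝒳 × 𝒴₀ × 𝒴₁ × 𝒴₂) × (Fin n → Fin m₁) × (Fin n → Fin m₂) → ℝ) :
    ∑ t : (Fin n → 𝒳 × 𝒴₀ × 𝒴₁ × 𝒴₂) × (Fin n → Fin m₁) × (Fin n → Fin m₂),
      prodLaw (Fin n) P t.1 * (∏ i, W₁ (t.1 i).2.2.1 (t.2.1 i)) *
        (∏ i, W₂ (t.1 i).2.2.2 (t.2.2 i)) * g t =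
    ∑ r, prodLaw (Fin n) (auxJoint P W₁ W₂) r *
      g (fun i => ((r i).1, (r i).2.1, (r i).2.2.1, (r i).2.2.2.1), fun i => (r i).2.2.2.2.1,
        fun i => (r i).2.2.2.2.2) := by
  refine Fintype.sum_equiv
    { toFun := fun t i => ((t.1 i).1, (t.1 i).2.1, (t.1 i).2.2.1, (t.1 i).2.2.2, t.2.1 i, t.2.2 i)
      invFun := fun r => (fun i => ((r i).1, (r i).2.1, (r i).2.2.1, (r i).2.2.2.1),
        fun i => (r i).2.2.2.2.1, fun i => (r i).2.2.2.2.2)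
      left_inv := fun _ => rfl
      right_inv := fun _ => rfl } _ _ fun t => ?_
  simp only [Equiv.coe_fn_mk, prodLaw, auxJoint, Finset.prod_mul_distrib]

theorem IsChannel.prod_mem {𝒴 : Type*} {m n : ℕ} {W : 𝒴 → Fin m → ℝ} (h : IsChannel W)
    (y : Fin n → 𝒴) : (fun u : Fin n → Fin m => ∏ i, W (y i) (u i)) ∈ stdSimplex ℝ (Fin n → Fin m) := by
  refine ⟨fun u => Finset.prod_nonneg fun i _ => (h _).1 _, ?_⟩
  rw [sum_pi_prod fun i a => W (y i) a]
  exact Finset.prod_eq_one fun i _ => (h _).2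

theorem IsChannel.nonempty {𝒴 : Type*} {m : ℕ} {W : 𝒴 → Fin m → ℝ} (h : IsChannel W) (y : 𝒴) :
    Nonempty (Fin m) := by
  by_contra hc
  rw [not_nonempty_iff] at hc
  have := (h y).2
  simp at this

theorem sum_auxJoint (hP : ∑ s, P s = 1) (h₁ : IsChannel W₁) (h₂ : IsChannel W₂) :
    ∑ t, auxJoint P W₁ W₂ t = 1 := by
  rw [← hP, ← sum_law (auxJoint P W₁ W₂) (fun v => (v.1, v.2.1, v.2.2.1, v.2.2.2.1)),
    law_auxJoint_source h₁ h₂]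

/-- The rate of the first encoder is at least the binning rate. -/
theorem cent_sub_le_cost_fst (hP : ∀ s, 0 ≤ P s) (h₁ : IsChannel W₁) (h₂ : IsChannel W₂) :
    cent (auxJoint P W₁ W₂) (fun v => v.2.2.2.2.1) (fun v => (v.2.2.2.2.2, v.2.1)) -
      -∑ t, auxJoint P W₁ W₂ t * Real.log (W₁ t.2.2.1 t.2.2.2.2.1) ≤ (cost P W₁ W₂).1 := by
  have hJ := auxJoint_nonneg hP h₁ h₂
  have e := cent_swap (auxJoint P W₁ W₂) (fun v => v.2.2.2.2.1) (fun v => v.2.2.1)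
    (fun v => (v.2.2.2.2.2, v.2.1))
  -- Gibbs' inequality with the channel `W₁` itself as the estimate of `U₁` from `Y₁`.
  have h := cent_le_cross hJ (fun v => v.2.2.2.2.1) (fun v => (v.2.2.1, v.2.2.2.2.2, v.2.1))
    (fun b a => W₁ b.1 a) (fun b a => (h₁ _).1 _) (fun b => (h₁ _).2.le) (fun t ht =>
      lt_of_le_of_ne ((h₁ _).1 _) fun h0 => by
        simp [auxJoint, ← h0] at ht)
  simp only [cost]
  linarith

/-- The rate of the second encoder is at least the binning rate. -/
theorem cent_sub_le_cost_snd (hP : ∀ s, 0 ≤ P s) (h₁ : IsChannel W₁) (h₂ : IsChannel W₂) :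
    cent (auxJoint P W₁ W₂) (fun v => v.2.2.2.2.2) (fun v => v.2.1) -
      -∑ t, auxJoint P W₁ W₂ t * Real.log (W₂ t.2.2.2.1 t.2.2.2.2.2) ≤ (cost P W₁ W₂).2.1 := by
  have hJ := auxJoint_nonneg hP h₁ h₂
  have e := cent_swap (auxJoint P W₁ W₂) (fun v => v.2.2.2.2.2) (fun v => v.2.2.2.1)
    (fun v => v.2.1)
  have h := cent_le_cross hJ (fun v => v.2.2.2.2.2) (fun v => (v.2.2.2.1, v.2.1))
    (fun b a => W₂ b.1 a) (fun b a => (h₂ _).1 _) (fun b => (h₂ _).2.le) (fun t ht =>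
      lt_of_le_of_ne ((h₂ _).1 _) fun h0 => by
        simp [auxJoint, ← h0] at ht)
  simp only [cost]
  linarith

theorem cost_nonneg (hP : ∀ s, 0 ≤ P s) (h₁ : IsChannel W₁) (h₂ : IsChannel W₂) :
    0 ≤ cost P W₁ W₂ := by
  have hJ := auxJoint_nonneg hP h₁ h₂
  refine ⟨sub_nonneg.2 ?_, sub_nonneg.2 ?_, cent_nonneg hJ _ _⟩
  · exact cent_le_of_determines hJ _ _ _ (by simp)
  · exact cent_le_of_determines hJ _ _ _ (by simp)

/-- Block codes for given auxiliary channels. -/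
theorem exists_block_code (hP : P ∈ stdSimplex ℝ (𝒳 × 𝒴₀ × 𝒴₁ × 𝒴₂)) (h₁ : IsChannel W₁)
    (h₂ : IsChannel W₂) {δ η : ℝ} (hδ : 0 < δ) (hη0 : 0 < η) (hη1 : η < 1) :
    ∃ C : ℝ, ∀ n : ℕ, 0 < n → ∃ (M₁ M₂ : ℕ) (φ₁ : (Fin n → 𝒴₁) → Fin M₁)
      (φ₂ : (Fin n → 𝒴₂) → Fin M₂) (ψ : Fin M₁ → Fin M₂ → (Fin n → 𝒴₀) → Fin n → 𝒳 → ℝ),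
      (∀ a b y i, ψ a b y i ∈ stdSimplex ℝ 𝒳) ∧ (∀ a b y i x, 0 < ψ a b y i x) ∧
      Real.log M₁ / n ≤ (cost P W₁ W₂).1 + 4 * δ + 1 / n ∧
      Real.log M₂ / n ≤ (cost P W₁ W₂).2.1 + 4 * δ + 1 / n ∧
      ∑ s, prodLaw (Fin n) P s *
        ((∑ i, -Real.log (ψ (φ₁ fun j => (s j).2.2.1) (φ₂ fun j => (s j).2.2.2)
          (fun j => (s j).2.1) i (s i).1)) / n) ≤
        (cost P W₁ W₂).2.2 - Real.log (1 - η) + C / n := by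
  classical
  have hJ0 := auxJoint_nonneg hP.1 h₁ h₂
  have hJ1 := sum_auxJoint hP.2 h₁ h₂
  have hc := cost_nonneg hP.1 h₁ h₂
  obtain ⟨⟨x, y₀, y₁, y₂⟩⟩ : Nonempty (𝒳 × 𝒴₀ × 𝒴₁ × 𝒴₂) := by
    by_contra hne
    rw [not_nonempty_iff] at hne
    have := hP.2
    simp at this
  have : Nonempty 𝒳 := ⟨x⟩
  have := h₁.nonempty y₁
  have := h₂.nonempty y₂
  set J := auxJoint P W₁ W₂ with hJ
  have hpos₁ : ∀ t, 0 < J t → 0 < W₁ t.2.2.1 t.2.2.2.2.1 := fun t ht =>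
    lt_of_le_of_ne ((h₁ _).1 _) fun h0 => by simp [hJ, auxJoint, ← h0] at ht
  have hpos₂ : ∀ t, 0 < J t → 0 < W₂ t.2.2.2.1 t.2.2.2.2.2 := fun t ht =>
    lt_of_le_of_ne ((h₂ _).1 _) fun h0 => by simp [hJ, auxJoint, ← h0] at ht
  obtain ⟨C₁, hC₁⟩ := exists_binning hJ0 hJ1 (fun v => v.2.2.2.2.1)
    (fun v => (v.2.2.2.2.2, v.2.1)) hpos₁ hδ (cent_sub_le_cost_fst hP.1 h₁ h₂) hc.1
  obtain ⟨C₂, hC₂⟩ := exists_binning hJ0 hJ1 (fun v => v.2.2.2.2.2)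
    (fun v => v.2.1) hpos₂ hδ (cent_sub_le_cost_snd hP.1 h₁ h₂) hc.2.1
  set q := smoothLaw J (fun v => v.1) (fun v => (v.2.2.2.2.1, v.2.2.2.2.2, v.2.1)) η with hq
  have hqmem : ∀ b, q b ∈ stdSimplex ℝ 𝒳 := smoothLaw_mem hJ0 _ _ hη0 hη1
  have hcard : (0 : ℝ) < Fintype.card 𝒳 := by exact_mod_cast Fintype.card_pos
  have hql : ∀ b a, η * (Fintype.card 𝒳 : ℝ)⁻¹ ≤ q b a := le_smoothLaw hJ0 _ _ hη1
  have hηc : 0 < η * (Fintype.card 𝒳 : ℝ)⁻¹ := by positivity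
  have hqpos : ∀ b a, 0 < q b a := fun b a => hηc.trans_le (hql b a)
  have hq1 : ∀ b a, q b a ≤ 1 := fun b a => by
    rw [← (hqmem b).2]
    exact Finset.single_le_sum (fun x _ => (hqmem b).1 x) (Finset.mem_univ a)
  -- The largest possible letter loss; it does not depend on `n`, so the error terms of order `1 /
  -- n` remain of that order after multiplication by it.
  set L := -Real.log (η * (Fintype.card 𝒳 : ℝ)⁻¹) with hLdef
  have hlog0 : ∀ b a, 0 ≤ -Real.log (q b a) := fun b a =>
    neg_nonneg.2 (Real.log_nonpos (hqpos b a).le (hq1 b a))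
  have hlogL : ∀ b a, -Real.log (q b a) ≤ L := fun b a =>
    neg_le_neg (Real.log_le_log hηc (hql b a))
  have hL : 0 ≤ L := (hlog0 (Classical.arbitrary _, Classical.arbitrary _, y₀) x).trans (hlogL _ _)
  refine ⟨L * (C₁ + C₂), fun n hn => ?_⟩
  have hn' : (0 : ℝ) < n := by exact_mod_cast hn
  obtain ⟨K₁, M₁, S₁, τ₁, κ₁, hK₁, hM₁, hκ₁, hS₁, r₁, b₁⟩ := hC₁ n hn
  obtain ⟨K₂, M₂, S₂, τ₂, κ₂, hK₂, hM₂, hκ₂, hS₂, r₂, b₂⟩ := hC₂ n hn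
  have : NeZero K₁ := ⟨hK₁.ne'⟩
  have : NeZero K₂ := ⟨hK₂.ne'⟩
  have : NeZero M₁ := ⟨hM₁.ne'⟩
  have : NeZero M₂ := ⟨hM₂.ne'⟩
  have hp : prodLaw (Fin n) P ∈ stdSimplex ℝ (Fin n → 𝒳 × 𝒴₀ × 𝒴₁ × 𝒴₂) :=
    ⟨prodLaw_nonneg hP.1, sum_prodLaw hP.2⟩
  obtain ⟨φ₁, φ₂, dec, h⟩ := exists_one_shot_code hp (fun s i => (s i).2.2.1)
    (fun s i => (s i).2.2.2) (fun s i => (s i).2.1)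
    (W₁ := fun y u => ∏ i, W₁ (y i) (u i)) (W₂ := fun y u => ∏ i, W₂ (y i) (u i))
    h₁.prod_mem h₂.prod_mem (K₁ := K₁) (M₁ := M₁) (K₂ := K₂) (M₂ := M₂)
    (fun z : (Fin n → Fin m₂) × (Fin n → 𝒴₀) => S₁ fun i => (z.1 i, z.2 i)) S₂ (fun z => hS₁ _) hS₂ hκ₁ hκ₂
    (ℓ := fun s u v => (∑ i, -Real.log (q (u i, v i, (s i).2.1) (s i).1)) / n) hL
    (fun s u v => div_nonneg (Finset.sum_nonneg fun i _ => hlog0 _ _) hn'.le)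
    (fun s u v => by
      rw [div_le_iff₀ hn']
      refine (Finset.sum_le_sum fun i _ => hlogL _ _).trans (le_of_eq ?_)
      simp [mul_comm])
  refine ⟨M₁, M₂, φ₁, φ₂, fun a b y i => q ((dec a b y).1 i, (dec a b y).2 i, y i),
    fun _ _ _ _ => hqmem _, fun _ _ _ _ _ => hqpos _ _, r₁, r₂, h.trans ?_⟩
  simp only [sum_blocks]
  rw [mul_div_assoc, add_div]
  refine add_le_add ?_ (mul_le_mul_of_nonneg_left (add_le_add
    (le_trans (add_le_add (add_le_add (add_le_add (le_of_eq ?_) le_rfl) le_rfl) le_rfl) b₁)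
    (le_trans (add_le_add (add_le_add (add_le_add (le_of_eq ?_) le_rfl) le_rfl) le_rfl) b₂)) hL)
  rotate_left
  · exact Finset.sum_congr rfl fun r _ => by congr
  · exact Finset.sum_congr rfl fun r _ => by congr
  calc ∑ r, prodLaw (Fin n) J r * ((∑ i, -Real.log
        (q ((r i).2.2.2.2.1, (r i).2.2.2.2.2, (r i).2.1) (r i).1)) / n)
      = (∑ i : Fin n, ∑ r, prodLaw (Fin n) J r * -Real.log
        (q ((r i).2.2.2.2.1, (r i).2.2.2.2.2, (r i).2.1) (r i).1)) / n := by
        rw [Finset.sum_comm, Finset.sum_div]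
        refine Finset.sum_congr rfl fun r _ => ?_
        rw [← Finset.mul_sum, mul_div_assoc]
    _ = ∑ t, J t * -Real.log (q (t.2.2.2.2.1, t.2.2.2.2.2, t.2.1) t.1) := by
        have e : ∀ i : Fin n, ∑ r, prodLaw (Fin n) J r * -Real.log
            (q ((r i).2.2.2.2.1, (r i).2.2.2.2.2, (r i).2.1) (r i).1) =
            ∑ t, J t * -Real.log (q (t.2.2.2.2.1, t.2.2.2.2.2, t.2.1) t.1) := fun i =>
          sum_prodLaw_mul hJ1 i fun t => -Real.log (q (t.2.2.2.2.1, t.2.2.2.2.2, t.2.1) t.1)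
        simp only [e, Finset.sum_const, Finset.card_univ, Fintype.card_fin, nsmul_eq_mul]
        field_simp
    _ ≤ _ := neg_sum_log_smoothLaw_le hJ0 hJ1 _ _ hη0 hη1

theorem isAchievable_of_cost_le (hP : P ∈ stdSimplex ℝ (𝒳 × 𝒴₀ × 𝒴₁ × 𝒴₂)) (h₁ : IsChannel W₁)
    (h₂ : IsChannel W₂) {t : ℝ × ℝ × ℝ} (h : cost P W₁ W₂ ≤ t) {ε : ℝ} (hε : 0 < ε) :
    IsAchievable P (t.1 + ε) (t.2.1 + ε) (t.2.2 + ε) := by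
  -- With `δ = ε / 8` the rate excess is `ε / 2 + 1 / n`. The choice of `η` makes the smoothing cost
  -- `-log (1 - η)` equal to `ε / 8`.
  have hη : Real.exp (-(ε / 8)) < 1 := by
    rw [Real.exp_lt_one_iff]
    linarith
  obtain ⟨C, hC⟩ := exists_block_code hP h₁ h₂ (δ := ε / 8) (η := 1 - Real.exp (-(ε / 8)))
    (by positivity) (by linarith) (by linarith [Real.exp_pos (-(ε / 8))])
  rw [sub_sub_cancel, Real.log_exp] at hC
  have t1 : ∀ᶠ n : ℕ in Filter.atTop, C / n < ε / 8 :=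
    (tendsto_const_div_atTop_nhds_zero_nat C).eventually_lt_const (by positivity)
  have t2 : ∀ᶠ n : ℕ in Filter.atTop, (1 : ℝ) / n < ε / 8 :=
    (tendsto_const_div_atTop_nhds_zero_nat 1).eventually_lt_const (by positivity)
  obtain ⟨n, ht1, ht2, hn⟩ := (t1.and (t2.and (Filter.eventually_gt_atTop 0))).exists
  obtain ⟨M₁, M₂, φ₁, φ₂, ψ, hψ, hpos, r₁, r₂, hD⟩ := hC n hn
  have hc := cost_nonneg hP.1 h₁ h₂
  have e1 : 0 ≤ (cost P W₁ W₂).2.2 := hc.2.2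
  have e2 := h.1
  have e3 := h.2.1
  have e4 := h.2.2
  refine ⟨n, M₁, M₂, φ₁, φ₂, ψ, hn, hψ, by linarith, by linarith, by linarith, ?_⟩
  rw [expectedLoss_eq_ofReal hP.1 hn φ₁ φ₂ hψ hpos]
  exact ENNReal.ofReal_le_ofReal (by linarith)

theorem rdRegion₁_subset_rdRegion (hP : P ∈ stdSimplex ℝ (𝒳 × 𝒴₀ × 𝒴₁ × 𝒴₂)) :
    rdRegion₁ P ⊆ rdRegion P := by
  intro t ht
  rw [mem_rdRegion₁_iff hP.1] at ht
  refine Metric.mem_closure_iff.2 fun ε hε => ?_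
  obtain ⟨m₁, m₂, W₁, W₂, h₁, h₂, hc⟩ := ht (ε / 4) (by positivity)
  have hach := isAchievable_of_cost_le hP h₁ h₂ hc (ε := ε / 4) (by positivity)
  refine ⟨(t.1 + ε / 4, t.2.1 + ε / 4, t.2.2 + ε / 4 + ε / 4), hach, ?_⟩
  simp only [Prod.dist_eq, Real.dist_eq, max_lt_iff]
  refine ⟨?_, ?_, ?_⟩ <;> rw [abs_lt] <;> constructor <;> linarith

end Achievability

/-! ### Time sharing and the other decoding order -/

section TimeSharing

variable {𝒳 𝒴₀ 𝒴₁ 𝒴₂ : Type*} [Fintype 𝒳] [Fintype 𝒴₀] [Fintype 𝒴₁] [Fintype 𝒴₂]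
variable {P : 𝒳 × 𝒴₀ × 𝒴₁ × 𝒴₂ → ℝ}

/-- Expected total logarithmic loss of a block code. -/
def totalLoss (P : 𝒳 × 𝒴₀ × 𝒴₁ × 𝒴₂ → ℝ) {n M₁ M₂ : ℕ}
    (φ₁ : (Fin n → 𝒴₁) → Fin M₁) (φ₂ : (Fin n → 𝒴₂) → Fin M₂)
    (ψ : Fin M₁ → Fin M₂ → (Fin n → 𝒴₀) → Fin n → 𝒳 → ℝ) : ℝ≥0∞ :=
  ∑ s : Fin n → 𝒳 × 𝒴₀ × 𝒴₁ × 𝒴₂, ENNReal.ofReal (∏ i, P (s i)) *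
    ∑ i, logLoss (ψ (φ₁ fun j => (s j).2.2.1) (φ₂ fun j => (s j).2.2.2) (fun j => (s j).2.1) i)
      (s i).1

theorem expectedLoss_eq_totalLoss_div {n M₁ M₂ : ℕ}
    (φ₁ : (Fin n → 𝒴₁) → Fin M₁) (φ₂ : (Fin n → 𝒴₂) → Fin M₂)
    (ψ : Fin M₁ → Fin M₂ → (Fin n → 𝒴₀) → Fin n → 𝒳 → ℝ) :
    expectedLoss P φ₁ φ₂ ψ = totalLoss P φ₁ φ₂ ψ / n := by
  simp only [expectedLoss, totalLoss, div_eq_mul_inv, Finset.sum_mul, mul_assoc]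

/-- A code of block length `n` with total rates `A₁`, `A₂` and total loss `L`. -/
def HasCode (P : 𝒳 × 𝒴₀ × 𝒴₁ × 𝒴₂ → ℝ) (n : ℕ) (A₁ A₂ L : ℝ) : Prop :=
  ∃ (M₁ M₂ : ℕ) (φ₁ : (Fin n → 𝒴₁) → Fin M₁) (φ₂ : (Fin n → 𝒴₂) → Fin M₂)
    (ψ : Fin M₁ → Fin M₂ → (Fin n → 𝒴₀) → Fin n → 𝒳 → ℝ),
    (∀ m₁ m₂ y i, ψ m₁ m₂ y i ∈ stdSimplex ℝ 𝒳) ∧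
    Real.log M₁ ≤ A₁ ∧ Real.log M₂ ≤ A₂ ∧ 0 ≤ L ∧ totalLoss P φ₁ φ₂ ψ ≤ ENNReal.ofReal L

theorem isAchievable_iff {R₁ R₂ D : ℝ} :
    IsAchievable P R₁ R₂ D ↔ ∃ n : ℕ, 0 < n ∧ HasCode P n (R₁ * n) (R₂ * n) (D * n) := by
  unfold IsAchievable HasCode
  refine exists_congr fun n => ?_
  have key : ∀ (hn : 0 < n) (M₁ M₂ : ℕ) (φ₁ : (Fin n → 𝒴₁) → Fin M₁) (φ₂ : (Fin n → 𝒴₂) → Fin M₂)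
      (ψ : Fin M₁ → Fin M₂ → (Fin n → 𝒴₀) → Fin n → 𝒳 → ℝ),
      (Real.log M₁ / n ≤ R₁ ∧ Real.log M₂ / n ≤ R₂ ∧
        0 ≤ D ∧ expectedLoss P φ₁ φ₂ ψ ≤ ENNReal.ofReal D) ↔
      (Real.log M₁ ≤ R₁ * n ∧ Real.log M₂ ≤ R₂ * n ∧
        0 ≤ D * n ∧ totalLoss P φ₁ φ₂ ψ ≤ ENNReal.ofReal (D * n)) := by
    intro hn M₁ M₂ φ₁ φ₂ ψ
    have hn' : (0 : ℝ) < n := by exact_mod_cast hn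
    rw [div_le_iff₀ hn', div_le_iff₀ hn', mul_nonneg_iff_of_pos_right hn',
      expectedLoss_eq_totalLoss_div, ENNReal.div_le_iff (by exact_mod_cast hn.ne') (by simp),
      ENNReal.ofReal_mul' hn'.le, ENNReal.ofReal_natCast]
  constructor
  · rintro ⟨M₁, M₂, φ₁, φ₂, ψ, hn, hψ, h⟩
    exact ⟨hn, M₁, M₂, φ₁, φ₂, ψ, hψ, (key hn M₁ M₂ φ₁ φ₂ ψ).1 h⟩
  · rintro ⟨hn, M₁, M₂, φ₁, φ₂, ψ, hψ, h⟩
    exact ⟨M₁, M₂, φ₁, φ₂, ψ, hn, hψ, (key hn M₁ M₂ φ₁ φ₂ ψ).2 h⟩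

/-- Concatenation of codes. -/
theorem HasCode.add (hP : P ∈ stdSimplex ℝ (𝒳 × 𝒴₀ × 𝒴₁ × 𝒴₂)) {n n' : ℕ}
    {A₁ A₂ L A₁' A₂' L' : ℝ} (h : HasCode P n A₁ A₂ L) (h' : HasCode P n' A₁' A₂' L') :
    HasCode P (n + n') (A₁ + A₁') (A₂ + A₂') (L + L') := by
  obtain ⟨M₁, M₂, φ₁, φ₂, ψ, hψ, a₁, a₂, hL, l⟩ := h
  obtain ⟨M₁', M₂', φ₁', φ₂', ψ', hψ', a₁', a₂', hL', l'⟩ := h'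
  obtain ⟨⟨x, y₀, y₁, y₂⟩⟩ : Nonempty (𝒳 × 𝒴₀ × 𝒴₁ × 𝒴₂) := by
    by_contra hne
    rw [not_nonempty_iff] at hne
    have := hP.2
    simp at this
  have ne : ∀ {M : ℕ}, Fin M → (M : ℝ) ≠ 0 := fun i => by exact_mod_cast i.pos.ne'
  refine ⟨M₁ * M₁', M₂ * M₂',
    fun y => finProdFinEquiv (φ₁ fun i => y (Fin.castAdd n' i), φ₁' fun i => y (Fin.natAdd n i)),
    fun y => finProdFinEquiv (φ₂ fun i => y (Fin.castAdd n' i), φ₂' fun i => y (Fin.natAdd n i)),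
    fun m₁ m₂ y => Fin.append
      (ψ (finProdFinEquiv.symm m₁).1 (finProdFinEquiv.symm m₂).1 fun i => y (Fin.castAdd n' i))
      (ψ' (finProdFinEquiv.symm m₁).2 (finProdFinEquiv.symm m₂).2 fun i => y (Fin.natAdd n i)),
    ?_, ?_, ?_, add_nonneg hL hL', ?_⟩
  · intro m₁ m₂ y i
    refine Fin.addCases (fun i => ?_) (fun i => ?_) i
    · simp only [Fin.append_left]
      exact hψ _ _ _ _
    · simp only [Fin.append_right]
      exact hψ' _ _ _ _
  · rw [Nat.cast_mul, Real.log_mul (ne (φ₁ fun _ => y₁)) (ne (φ₁' fun _ => y₁))]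
    exact add_le_add a₁ a₁'
  · rw [Nat.cast_mul, Real.log_mul (ne (φ₂ fun _ => y₂)) (ne (φ₂' fun _ => y₂))]
    exact add_le_add a₂ a₂'
  · rw [ENNReal.ofReal_add hL hL']
    refine le_trans (le_of_eq ?_) (add_le_add l l')
    -- The loss of each subblock depends only on its own letters, so the law of the other subblock
    -- sums to one.
    have one : ∀ k : ℕ, ∑ s : Fin k → 𝒳 × 𝒴₀ × 𝒴₁ × 𝒴₂, ENNReal.ofReal (∏ i, P (s i)) = 1 := by
      intro k
      rw [← ENNReal.ofReal_sum_of_nonneg fun s _ => Finset.prod_nonneg fun i _ => hP.1 (s i),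
        show ∑ s : Fin k → 𝒳 × 𝒴₀ × 𝒴₁ × 𝒴₂, ∏ i, P (s i) = 1 from sum_prodLaw hP.2,
        ENNReal.ofReal_one]
    unfold totalLoss
    rw [← (Fin.appendEquiv n n').sum_comp, Fintype.sum_prod_type]
    simp only [Fin.appendEquiv, Equiv.coe_fn_mk, Fin.prod_univ_add, Fin.append_left,
      Fin.append_right, Fin.sum_univ_add, Equiv.symm_apply_apply]
    simp only [ENNReal.ofReal_mul (Finset.prod_nonneg fun i _ => hP.1 _), mul_add,
      Finset.sum_add_distrib]
    congr 1
    · refine Finset.sum_congr rfl fun s _ => ?_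
      simp only [mul_right_comm _ (ENNReal.ofReal (∏ i : Fin n', _))]
      rw [← Finset.mul_sum, one, mul_one]
    · simp only [mul_assoc]
      simp only [← Finset.mul_sum, ← Finset.sum_mul, one, one_mul]

theorem HasCode.mul (hP : P ∈ stdSimplex ℝ (𝒳 × 𝒴₀ × 𝒴₁ × 𝒴₂)) {n : ℕ} {A₁ A₂ L : ℝ}
    (h : HasCode P n A₁ A₂ L) {k : ℕ} (hk : 0 < k) :
    HasCode P (k * n) (k * A₁) (k * A₂) (k * L) := by
  induction k, hk using Nat.le_induction with
  | base => simpa using h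
  | succ k hk ih =>
    have := ih.add hP h
    convert this using 1 <;> push_cast <;> ring

/-- Using `k * n'` copies of the first code and `k' * n` of the second puts the total block lengths
in the ratio `k : k'`. -/
theorem IsAchievable.combine (hP : P ∈ stdSimplex ℝ (𝒳 × 𝒴₀ × 𝒴₁ × 𝒴₂)) {R₁ R₂ D R₁' R₂' D' : ℝ}
    (h : IsAchievable P R₁ R₂ D) (h' : IsAchievable P R₁' R₂' D') {k k' : ℕ} (hk : 0 < k)
    (hk' : 0 < k') {a b : ℝ} (ha : a * (k + k') = k) (hb : b * (k + k') = k') :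
    IsAchievable P (a * R₁ + b * R₁') (a * R₂ + b * R₂') (a * D + b * D') := by
  rw [isAchievable_iff] at h h' ⊢
  obtain ⟨n, hn, h⟩ := h
  obtain ⟨n', hn', h'⟩ := h'
  refine ⟨k * n' * n + k' * n * n', by positivity, ?_⟩
  have := (h.mul hP (Nat.mul_pos hk hn')).add hP (h'.mul hP (Nat.mul_pos hk' hn))
  have e : ∀ r r' : ℝ, (k * n' : ℕ) * (r * n) + (k' * n : ℕ) * (r' * n') =
      (a * r + b * r') * (k * n' * n + k' * n * n' : ℕ) := by
    intro r r'
    push_cast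
    linear_combination (-(n * n' * r : ℝ)) * ha - (n * n' * r' : ℝ) * hb
  rwa [e, e, e] at this

/-- Concatenation handles rational weights between achievable points. Real weights follow by density
of the rationals, and limit points by taking a second closure, which changes nothing. -/
theorem convex_rdRegion (hP : P ∈ stdSimplex ℝ (𝒳 × 𝒴₀ × 𝒴₁ × 𝒴₂)) : Convex ℝ (rdRegion P) := by
  rw [convex_iff_forall_pos]
  intro x hx y hy a b ha hb hab
  unfold rdRegion
  rw [← closure_closure]
  refine map_mem_closure₂ (f := fun x y : ℝ × ℝ × ℝ => a • x + b • y) (by fun_prop) hx hy ?_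
  rintro x hx y hy
  obtain rfl : b = 1 - a := by linarith
  have hden : a ∈ closure (Set.Ioo (0 : ℝ) 1 ∩ Set.range ((↑) : ℚ → ℝ)) :=
    Rat.denseRange_cast.open_subset_closure_inter isOpen_Ioo ⟨ha, by linarith⟩
  refine map_mem_closure (f := fun a : ℝ => a • x + (1 - a) • y) (by fun_prop) hden ?_
  rintro _ ⟨⟨h0, h1⟩, q, rfl⟩
  have hq0 : 0 < q := by exact_mod_cast h0
  have hq1 : q < 1 := by exact_mod_cast h1
  have hden0 : (0 : ℝ) < q.den := by exact_mod_cast q.den_pos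
  have hnum : ((q.num.toNat : ℤ)) = q.num := Int.toNat_of_nonneg (Rat.num_pos.2 hq0).le
  have hlt : q.num < q.den := by
    have h : (q.num : ℚ) < q.den := by
      rw [← Rat.mul_den_eq_num]
      exact mul_lt_of_lt_one_left (by exact_mod_cast q.den_pos) hq1
    exact_mod_cast h
  have hnumR : (q.num.toNat : ℝ) = q * q.den := by
    have : ((q.num.toNat : ℤ) : ℝ) = (q.num : ℝ) := by rw [hnum]
    rw [Int.cast_natCast] at this
    rw [this, ← Rat.cast_intCast, ← Rat.cast_natCast, ← Rat.cast_mul, Rat.mul_den_eq_num]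
  have hk : 0 < q.num.toNat := by
    have := Rat.num_pos.2 hq0
    omega
  have hk' : 0 < q.den - q.num.toNat := by omega
  have hsum : (q.num.toNat : ℝ) + (q.den - q.num.toNat : ℕ) = q.den := by
    rw [Nat.cast_sub (by omega)]
    ring
  refine IsAchievable.combine hP hx hy hk hk' (by rw [hsum, hnumR]) ?_
  rw [hsum, Nat.cast_sub (by omega), hnumR]
  ring

theorem swapLaw_mem (hP : P ∈ stdSimplex ℝ (𝒳 × 𝒴₀ × 𝒴₁ × 𝒴₂)) :
    swapLaw P ∈ stdSimplex ℝ (𝒳 × 𝒴₀ × 𝒴₂ × 𝒴₁) := by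
  refine ⟨fun _ => hP.1 _, ?_⟩
  rw [← law_swap, sum_law, hP.2]

theorem IsAchievable.swap {R₁ R₂ D : ℝ} (h : IsAchievable (swapLaw P) R₂ R₁ D) :
    IsAchievable P R₁ R₂ D := by
  obtain ⟨n, M₂, M₁, φ₂, φ₁, ψ, hn, hψ, r₂, r₁, hD, hl⟩ := h
  refine ⟨n, M₁, M₂, φ₁, φ₂, fun a b => ψ b a, hn, fun _ _ => hψ _ _, r₁, r₂, hD, hl.trans' ?_⟩
  refine le_of_eq ?_
  exact Fintype.sum_equiv (Equiv.arrowCongr (Equiv.refl _) (Equiv.prodCongr (Equiv.refl _)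
    (Equiv.prodCongr (Equiv.refl _) (Equiv.prodComm _ _)))) _ _ fun s => rfl

theorem rdRegion₂_subset_rdRegion (hP : P ∈ stdSimplex ℝ (𝒳 × 𝒴₀ × 𝒴₁ × 𝒴₂)) :
    rdRegion₂ P ⊆ rdRegion P := by
  intro t ht
  rw [mem_rdRegion₂_iff hP.1] at ht
  have h := rdRegion₁_subset_rdRegion (swapLaw_mem hP) ht
  refine map_mem_closure (f := swapRates) ?_ h
    fun s (hs : IsAchievable (swapLaw P) s.1 s.2.1 s.2.2) => show IsAchievable P _ _ _ from hs.swap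
  unfold swapRates
  fun_prop

end TimeSharing

end CEO

end

theorem proposition3 {𝒳 𝒴₀ 𝒴₁ 𝒴₂ : Type*}
    [Fintype 𝒳] [Fintype 𝒴₀] [Fintype 𝒴₁] [Fintype 𝒴₂]
    (P : 𝒳 × 𝒴₀ × 𝒴₁ × 𝒴₂ → ℝ)
    (hP : P ∈ stdSimplex ℝ (𝒳 × 𝒴₀ × 𝒴₁ × 𝒴₂))
    (hMarkov : CEO.IsMarkov P) :
    CEO.rdRegion P = convexHull ℝ (CEO.rdRegion₁ P ∪ CEO.rdRegion₂ P) :=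
  (CEO.rdRegion_subset hP hMarkov).antisymm <|
    convexHull_min (Set.union_subset (CEO.rdRegion₁_subset_rdRegion hP)
      (CEO.rdRegion₂_subset_rdRegion hP)) (CEO.convex_rdRegion hP)
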